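/- **Setting.** All relational structures are finite, over a fixed finite relational signature $\sigma$; $A$ is a $\sigma$-structure. For a $\sigma$-structure $G$, let $\mathrm{Mor}^+(G,A)$ be the $*$-algebra generated by projections $p_{xa}$ ($x\in G$, $a\in A$) with $(p_{xa})_{a\in A}$ a projection-valued measure (PVM) for each $x$, and $p_{z_1b_1}\cdots p_{z_nb_n}=0$ for all $R\in\sigma$ of arity $n$, $\mathbf z\in R^G$, $\mathbf b\notin R^A$. In $\mathrm{Mor}^{o+}(G,A)$ one imposes in addition $[p_{z_ib},p_{z_jb'}]=0$ for all $R\in\sigma$, $\mathbf z\in R^G$, $i,j$ and $b,b'\in A$. Homomorphisms and algebras are unital, and $C^*$-algebras are nonzero. **Models.** A *min-tensor monoid* $Q$ is a class of $C^*$-algebras that contains $\mathbb C$ and is closed under the minimal tensor product, together with, for each $\mathcal B\in Q$, a set of *admissible* tracial states on $\mathcal B$, such that the state of $\mathbb C$ is admissible and products of admissible tracial states on minimal tensor products are admissible. If nothing is said, all tracial states of members of $Q$ are admissible. A tracial state $\tau$ on a $*$-algebra $\mathcal A$ is *over $Q$* if $\tau=\varphi\circ\pi$ for a $*$-homomorphism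 $\pi:\mathcal A\to\mathcal B\in Q$ and an admissible tracial state $\varphi$ on $\mathcal B$. $Q\subseteq Q'$ means that each $\mathcal B\in Q$ is in $Q'$ and that its $Q$-admissible tracial states are $Q'$-admissible; only the first part is needed in (i) and (ii). $Q$ is *tracial* if every $\mathcal B\in Q$ has an admissible tracial state. The standard models are - $q=\{B(\mathbb C^d):d\ge1\}$; - $qa=\{\mathcal B:\mathcal B\hookrightarrow\mathcal R^\omega\}$, with $\mathcal R$ the hyperfinite $\mathrm{II}_1$ factor and $\omega$ a free ultrafilter on $\mathbb N$; admissible are the restrictions of the trace $\tau_\omega$ of $\mathcal R^\omega$ along such embeddings, so the tracial states over $qa$ are the Connes-embeddable ones; - $qc=\{\mathcal B:\mathcal B\text{ has a tracial state}\}$, and $qc_f=\{\mathcal B:\mathcal B\text{ has a faithful tracial state}\}$; - $C^*$, all $C^*$-algebras. **Gadgets.** A *$Q$-commutativity gadget* for $A$ is a $\sigma$-structure $G$ with elements $x,y\in G$ such that (1) for all $a,b\in A$ there is a $*$-homomorphism $\pi:\mathrm{Mor}^+(G,A)\to\mathcal B\in Q$ with $\pi(p_{xa})=\pi(p_{yb})=1$,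 and (2) for every $*$-homomorphism $\pi:\mathrm{Mor}^+(G,A)\to\mathcal B\in Q$ and all $a,b\in A$, $[\pi(p_{xa}),\pi(p_{yb})]=0$. An *oracular* $Q$-commutativity gadget is defined in the same way with $\mathrm{Mor}^{o+}$ in place of $\mathrm{Mor}^+$. Let $m=\sum_{R}|R^G|$ and $\|s\|_\tau^2=\tau(s^*s)$. - An *$a$-robust* $Q$-commutativity gadget is a $Q$-commutativity gadget $(G,x,y)$ such that for all $\varepsilon>0$ there is $\delta>0$ with the following property. Let $\tau$ be a tracial state over $Q$ on the $*$-algebra generated by PVMs $(p_{za})_{a\in A}$, $z\in G$. If $\frac1m\sum_{R,\,\mathbf z\in R^G,\,\mathbf b\notin R^A}\|p_{z_1b_1}\cdots p_{z_nb_n}\|_\tau^2<\delta$, then $\sum_{a,b\in A}\|[p_{xa},p_{yb}]\|_\tau^2<\varepsilon$. - A *$c$-$v$-robust* $Q$-commutativity gadget is an oracular $Q$-commutativity gadget $(G,x,y)$ such that for all $\varepsilon>0$ there is $\delta>0$ with the following property. Let $\tau$ be a tracial state over $Q$ on the $*$-algebra generated by PVMs $(p_{za})_{a\in A}$, $z\in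 G$, and PVMs $(\Phi^{R,\mathbf z}_{\mathbf b})_{\mathbf b\in R^A}$, $R\in\sigma$, $\mathbf z\in R^G$. If $\frac1m\sum_{R,\,\mathbf z\in R^G,\,\mathbf b\in R^A,\,i}\frac1{\mathrm{ar}(R)}\|\Phi^{R,\mathbf z}_{\mathbf b}(1-p_{z_ib_i})\|_\tau^2<\delta$, then $\sum_{a,b\in A}\|[p_{xa},p_{yb}]\|_\tau^2<\varepsilon$. **Theorem.** Let $A$ be a finite relational structure, and let $Q,Q'$ be min-tensor monoids. 1. (i) If $Q\subseteq Q'$ and $A$ admits a $Q'$-commutativity gadget, then $A$ admits a $Q$-commutativity gadget. 2. (ii) If $Q\subseteq Q'$ and $A$ admits an oracular $Q'$-commutativity gadget, then $A$ admits an oracular $Q$-commutativity gadget. 3. (iii) If $Q\subseteq Q'$, where $Q'$ is tracial or $Q'=C^*$, and $A$ admits an $a$-robust $Q'$-commutativity gadget, then $A$ admits an $a$-robust $Q$-commutativity gadget. 4. (iv) If $Q\subseteq Q'$, where $Q'$ is tracial or $Q'=C^*$, and $A$ admits a $c$-$v$-robust $Q'$-commutativity gadget, then $A$ admits a $c$-$v$-robust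 $Q$-commutativity gadget. 5. (v) If $A$ admits a $Q$-commutativity gadget, then $A$ admits an oracular $Q$-commutativity gadget. 6. (vi) If $Q$ is tracial or $Q=C^*$, and $A$ admits an $a$-robust $Q$-commutativity gadget, then $A$ admits a $c$-$v$-robust $Q$-commutativity gadget. 7. (vii) If $A$ admits a $C^*$-commutativity gadget, then $A$ admits an $a$-robust $Q$-commutativity gadget for all $Q$. 8. (viii) If $A$ admits an oracular $C^*$-commutativity gadget, then $A$ admits a $c$-$v$-robust $Q$-commutativity gadget for all $Q$. 9. (ix) $A$ admits a $qa$-commutativity gadget iff $A$ admits an $a$-robust $qa$-commutativity gadget iff $A$ admits an $a$-robust $q$-commutativity gadget. 10. (x) $A$ admits an oracular $qa$-commutativity gadget iff $A$ admits a $c$-$v$-robust $qa$-commutativity gadget iff $A$ admits a $c$-$v$-robust $q$-commutativity gadget. 11. (xi) $A$ admits a $qc$-commutativity gadget iff $A$ admits an $a$-robust $qc$-commutativity gadget; the same holds with $qc_f$ in place of $qc$. 12. (xii) $A$ admits an oracular $qc$-commutativity gadget iff $A$ admits a $c$-$v$-robust $qc$-commutativity gadget; the same holds with $qc_f$ in place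 of $qc$. -/

import Mathlib

open scoped ComplexOrder NNReal Topology InnerProductSpace

noncomputable section

namespace QuantumCSP

/-! ### Presented unital `*`-algebras -/

/-- The free complex `*`-algebra on a set `X` of self-adjoint generators: noncommutative polynomials
in the letters `X`, with the involution that conjugates coefficients and reverses words. -/
def FreeStarAlg (X : Type) : Type := MonoidAlgebra ℂ (FreeMonoid X)

namespace FreeStarAlg

variable {X : Type}

instance : Ring (FreeStarAlg X) := inferInstanceAs (Ring (MonoidAlgebra ℂ (FreeMonoid X)))

instance : Algebra ℂ (FreeStarAlg X) :=
  inferInstanceAs (Algebra ℂ (MonoidAlgebra ℂ (FreeMonoid X)))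

/-- The monomial `r • w`. -/
def monomial (w : FreeMonoid X) (r : ℂ) : FreeStarAlg X :=
  MonoidAlgebra.single (R := ℂ) (M := FreeMonoid X) w r

theorem monomial_zero (w : FreeMonoid X) : monomial w 0 = 0 :=
  MonoidAlgebra.single_zero (R := ℂ) (M := FreeMonoid X) w

theorem monomial_add (w : FreeMonoid X) (r s : ℂ) :
    monomial w (r + s) = monomial w r + monomial w s :=
  MonoidAlgebra.single_add (R := ℂ) (M := FreeMonoid X) w r s

theorem monomial_mul (v w : FreeMonoid X) (r s : ℂ) :
    monomial v r * monomial w s = monomial (v * w) (r * s) :=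
  MonoidAlgebra.single_mul_single (R := ℂ) (M := FreeMonoid X) v w r s

theorem smul_monomial (c : ℂ) (w : FreeMonoid X) (r : ℂ) :
    c • monomial w r = monomial w (c * r) :=
  MonoidAlgebra.smul_single (R := ℂ) (M := FreeMonoid X) c w r

/-- The generator `x`. -/
def of (x : X) : FreeStarAlg X := monomial (FreeMonoid.of x) 1

theorem induction {P : FreeStarAlg X → Prop} (x : FreeStarAlg X) (zero : P 0)
    (add : ∀ a b, P a → P b → P (a + b)) (mono : ∀ w r, P (monomial w r)) : P x :=
  MonoidAlgebra.induction_linear (R := ℂ) (M := FreeMonoid X) x zero add mono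

/-- The involution, `r • w ↦ conj r • reverse w`. -/
def starHom : FreeStarAlg X →+ FreeStarAlg X :=
  (Finsupp.liftAddHom (α := FreeMonoid X) (M := ℂ) (N := FreeStarAlg X) fun w =>
    { toFun := fun r => monomial (star w) (star r)
      map_zero' := by rw [star_zero, monomial_zero]
      map_add' := fun r s => by rw [star_add, monomial_add] }).comp
    (MonoidAlgebra.coeffAddEquiv (R := ℂ) (M := FreeMonoid X)).toAddMonoidHom

theorem starHom_monomial (w : FreeMonoid X) (r : ℂ) :
    starHom (monomial w r) = monomial (star w) (star r) :=
  Finsupp.liftAddHom_apply_single (α := FreeMonoid X) (M := ℂ) (N := FreeStarAlg X) _ w r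

instance : StarRing (FreeStarAlg X) where
  star := starHom
  star_involutive x := by
    induction x using induction with
    | zero => simp
    | add a b ha hb => simp only [map_add, ha, hb]
    | mono w r => simp only [starHom_monomial, star_star]
  star_mul x y := by
    induction x using induction with
    | zero => simp
    | add a b ha hb => simp only [add_mul, mul_add, map_add, ha, hb]
    | mono w r =>
      induction y using induction with
      | zero => simp
      | add a b ha hb => simp only [add_mul, mul_add, map_add, ha, hb]
      | mono v s => simp only [starHom_monomial, monomial_mul, star_mul]
  star_add x y := map_add starHom x y

instance : StarModule ℂ (FreeStarAlg X) where
  star_smul c x := by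
    change starHom (c • x) = star c • starHom x
    induction x using induction with
    | zero => simp
    | add a b ha hb => simp only [smul_add, map_add, ha, hb]
    | mono w r =>
      simp only [starHom_monomial, smul_monomial, star_mul, mul_comm]

end FreeStarAlg

/-- The relation that kills `rels` and the adjoints of its members. -/
def presRel {X : Type} (rels : Set (FreeStarAlg X)) (a b : FreeStarAlg X) : Prop :=
  (a ∈ rels ∨ star a ∈ rels) ∧ b = 0

/-- The `*`-algebra `ℂ⟨X | rels⟩` generated by self-adjoint elements `X` subject to `r = 0` for
`r ∈ rels`. -/
def PresAlg {X : Type} (rels : Set (FreeStarAlg X)) : Type := RingQuot (presRel rels)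

namespace PresAlg

variable {X : Type} (rels : Set (FreeStarAlg X))

instance : Ring (PresAlg rels) := inferInstanceAs (Ring (RingQuot (presRel rels)))

instance : Algebra ℂ (PresAlg rels) := inferInstanceAs (Algebra ℂ (RingQuot (presRel rels)))

instance : StarRing (PresAlg rels) :=
  RingQuot.starRing (presRel rels) fun a b h =>
    ⟨h.1.symm.imp id fun h' => by rwa [star_star], by rw [h.2, star_zero]⟩

/-- The image of a generator. -/
def gen (x : X) : PresAlg rels := RingQuot.mkAlgHom ℂ (presRel rels) (FreeStarAlg.of x)

end PresAlg

/-! ### Tracial states, weighted algebras -/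

/-- A tracial state on a unital `*`-algebra (positivity is with respect to sums of squares; on a
`C*`-algebra this is the usual notion). -/
structure TracialState (𝒜 : Type) [Ring 𝒜] [StarRing 𝒜] [Algebra ℂ 𝒜] where
  toLin : 𝒜 →ₗ[ℂ] ℂ
  map_one : toLin 1 = 1
  nonneg : ∀ a, 0 ≤ toLin (star a * a)
  tracial : ∀ a b, toLin (a * b) = toLin (b * a)

/-- `‖a‖_τ ^ 2 = τ (a* a)`. -/
def TracialState.normSq {𝒜 : Type} [Ring 𝒜] [StarRing 𝒜] [Algebra ℂ 𝒜]
    (τ : TracialState 𝒜) (a : 𝒜) : ℝ :=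
  (τ.toLin (star a * a)).re

/-- The defect `∑ a, μ(a) ‖a‖_τ ^ 2` of a tracial state on the weighted algebra `(𝒜, μ)`. -/
def TracialState.defect {𝒜 : Type} [Ring 𝒜] [StarRing 𝒜] [Algebra ℂ 𝒜]
    (τ : TracialState 𝒜) (μ : 𝒜 →₀ ℝ≥0) : ℝ :=
  μ.sum fun a w => (w : ℝ) * τ.normSq a

/-! ### Relational structures -/

/-- A relational signature: relation symbols with arities. -/
structure Signature where
  Sym : Type
  ar : Sym → ℕ

/-- A relational structure over `σ` with domain `A`. -/
structure RelStr (σ : Signature) (A : Type) where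
  rel : ∀ R : σ.Sym, Set (Fin (σ.ar R) → A)

variable {σ : Signature} {G A : Type}

/-- The constraints `(R, z)`, `z ∈ R^G`, of a relational structure. -/
def Constraint (𝔾 : RelStr σ G) : Type := Σ R : σ.Sym, {z : Fin (σ.ar R) → G // z ∈ 𝔾.rel R}

instance [Fintype σ.Sym] [Fintype G] (𝔾 : RelStr σ G) : Fintype (Constraint 𝔾) :=
  letI : Finite (Constraint 𝔾) :=
    inferInstanceAs (Finite (Σ R : σ.Sym, {z : Fin (σ.ar R) → G // z ∈ 𝔾.rel R}))
  Fintype.ofFinite _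

/-- The satisfying assignments `b ∈ R^A` of a relation symbol. -/
abbrev Sat (𝔸 : RelStr σ A) (R : σ.Sym) : Type := {b : Fin (σ.ar R) → A // b ∈ 𝔸.rel R}

/-- The violating assignments `b ∉ R^A` of a relation symbol. -/
abbrev Unsat (𝔸 : RelStr σ A) (R : σ.Sym) : Type := {b : Fin (σ.ar R) → A // b ∉ 𝔸.rel R}

instance [Fintype A] (𝔸 : RelStr σ A) (R : σ.Sym) : Fintype (Sat 𝔸 R) := Fintype.ofFinite _

instance [Fintype A] (𝔸 : RelStr σ A) (R : σ.Sym) : Fintype (Unsat 𝔸 R) := Fintype.ofFinite _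

/-! ### Quantum homomorphism algebras -/

/-- The relations saying that `(p s)_{s ∈ S}` is a projection-valued measure (the `p s` being
self-adjoint). -/
def pvmRels {ℱ S : Type} [Ring ℱ] [Fintype S] (p : S → ℱ) : Set ℱ :=
  {r | (∃ s, r = p s * p s - p s) ∨ (∃ s t, s ≠ t ∧ r = p s * p t) ∨ r = ∑ s, p s - 1}

/-- The product `p z₁ b₁ ⋯ p zₙ bₙ`. -/
def prodGen {ℱ : Type} [Ring ℱ] (p : G → A → ℱ) {n : ℕ} (z : Fin n → G) (b : Fin n → A) : ℱ :=
  (List.ofFn fun i => p (z i) (b i)).prod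

/-- The free generator `p_{xa}`. -/
def freeP (x : G) (a : A) : FreeStarAlg (G × A) := FreeStarAlg.of (x, a)

/-- The relations of the assignment algebra: `(p_{xa})_a` is a PVM for every `x`. -/
def assignRels (G A : Type) [Fintype A] : Set (FreeStarAlg (G × A)) :=
  ⋃ x : G, pvmRels fun a : A => freeP x a

/-- The relations of `Mor⁺(G, A)`: moreover `p_{z₁b₁} ⋯ p_{zₙbₙ} = 0` for `z ∈ R^G`, `b ∉ R^A`. -/
def plusRels [Fintype A] (𝔾 : RelStr σ G) (𝔸 : RelStr σ A) : Set (FreeStarAlg (G × A)) :=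
  assignRels G A ∪
    {r | ∃ R : σ.Sym, ∃ z ∈ 𝔾.rel R, ∃ b, b ∉ 𝔸.rel R ∧ r = prodGen freeP z b}

/-- The relations of `Mor°⁺(G, A)`: moreover `p_{zᵢb}` and `p_{zⱼb'}` commute for `z ∈ R^G`. -/
def oPlusRels [Fintype A] (𝔾 : RelStr σ G) (𝔸 : RelStr σ A) : Set (FreeStarAlg (G × A)) :=
  plusRels 𝔾 𝔸 ∪
    {r | ∃ R : σ.Sym, ∃ z ∈ 𝔾.rel R, ∃ i j, ∃ b b' : A,
      r = freeP (z i) b * freeP (z j) b' - freeP (z j) b' * freeP (z i) b}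

/-- The `*`-algebra presenting `Mor⁺(G, A)`. Its unital `*`-homomorphisms to `C*`-algebras are those
of the universal `C*`-algebra with the same generators and relations. (In a `C*`-algebra, projections
that sum to `1` are pairwise orthogonal, so listing orthogonality changes nothing.) -/
abbrev MorPlus [Fintype A] (𝔾 : RelStr σ G) (𝔸 : RelStr σ A) : Type := PresAlg (plusRels 𝔾 𝔸)

/-- The `*`-algebra presenting `Mor°⁺(G, A)`. -/
abbrev MorOPlus [Fintype A] (𝔾 : RelStr σ G) (𝔸 : RelStr σ A) : Type := PresAlg (oPlusRels 𝔾 𝔸)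

/-- The assignment algebra (without its weight): it is generated by PVMs `(p_{xa})_{a ∈ A}`. -/
abbrev MorA (G A : Type) [Fintype A] : Type := PresAlg (assignRels G A)

/-- The generator `p_{xa}` of the assignment algebra. -/
def MorA.p [Fintype A] (x : G) (a : A) : MorA G A := PresAlg.gen (assignRels G A) (x, a)

/-- The weight of the assignment algebra for the uniform distribution on constraints:
`p_{z₁b₁} ⋯ p_{zₙbₙ}` has weight `1/m` for each constraint `(R, z)` and each `b ∉ R^A`. -/
def weightA [Fintype σ.Sym] [Fintype G] [Fintype A] (𝔾 : RelStr σ G) (𝔸 : RelStr σ A) :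
    MorA G A →₀ ℝ≥0 :=
  ∑ c : Constraint 𝔾, ∑ b : Unsat 𝔸 c.1,
    Finsupp.single (prodGen MorA.p c.2.1 b.1) ((Fintype.card (Constraint 𝔾) : ℝ≥0)⁻¹)

/-- Generators of the constraint-variable algebra: `Φ^{R,z}_b` (`z ∈ R^G`, `b ∈ R^A`), `p_{xa}`. -/
abbrev CVGen (𝔾 : RelStr σ G) (𝔸 : RelStr σ A) : Type :=
  (Σ c : Constraint 𝔾, Sat 𝔸 c.1) ⊕ (G × A)

/-- The relations of the constraint-variable algebra: its generators form PVMs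
`(Φ^{R,z}_b)_{b ∈ R^A}` and `(p_{xa})_{a ∈ A}`. -/
def cvRels [Fintype A] (𝔾 : RelStr σ G) (𝔸 : RelStr σ A) : Set (FreeStarAlg (CVGen 𝔾 𝔸)) :=
  (⋃ c : Constraint 𝔾, pvmRels fun b : Sat 𝔸 c.1 => FreeStarAlg.of (Sum.inl ⟨c, b⟩)) ∪
    ⋃ x : G, pvmRels fun a : A => FreeStarAlg.of (Sum.inr (x, a))

/-- The constraint-variable algebra (without its weight). -/
abbrev MorCV [Fintype A] (𝔾 : RelStr σ G) (𝔸 : RelStr σ A) : Type := PresAlg (cvRels 𝔾 𝔸)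

/-- The generator `Φ^{R,z}_b` of the constraint-variable algebra. -/
def MorCV.phi [Fintype A] (𝔾 : RelStr σ G) (𝔸 : RelStr σ A) (c : Constraint 𝔾) (b : Sat 𝔸 c.1) :
    MorCV 𝔾 𝔸 :=
  PresAlg.gen (cvRels 𝔾 𝔸) (Sum.inl ⟨c, b⟩)

/-- The generator `p_{xa}` of the constraint-variable algebra. -/
def MorCV.p [Fintype A] (𝔾 : RelStr σ G) (𝔸 : RelStr σ A) (x : G) (a : A) : MorCV 𝔾 𝔸 :=
  PresAlg.gen (cvRels 𝔾 𝔸) (Sum.inr (x, a))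

/-- The weight of the constraint-variable algebra for the uniform distribution on constraints:
`Φ^{R,z}_b (1 - p_{zᵢbᵢ})` has weight `1/(m ar(R))`. -/
def weightCV [Fintype σ.Sym] [Fintype G] [Fintype A] (𝔾 : RelStr σ G) (𝔸 : RelStr σ A) :
    MorCV 𝔾 𝔸 →₀ ℝ≥0 :=
  ∑ c : Constraint 𝔾, ∑ b : Sat 𝔸 c.1, ∑ i : Fin (σ.ar c.1),
    Finsupp.single (MorCV.phi 𝔾 𝔸 c b * (1 - MorCV.p 𝔾 𝔸 (c.2.1 i) (b.1 i)))
      ((Fintype.card (Constraint 𝔾) : ℝ≥0)⁻¹ / (σ.ar c.1 : ℝ≥0))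

/-! ### The minimal tensor product -/

/-- `C`, with the `*`-homomorphisms `iA : a ↦ a ⊗ 1` and `iB : b ↦ 1 ⊗ b`, is the minimal tensor
product of `A` and `B`: for some faithful representations of `A` on `H` and of `B` on `K`, it is
faithfully represented on the Hilbert space tensor product `L = H ⊗ K` with `iA a` acting as `a ⊗ 1`
and `iB b` as `1 ⊗ b`, and the products `iA a * iB b` span a dense subspace of `C`. The Hilbert space
tensor product is given by a bilinear map `t` with `⟪t h k, t h' k'⟫ = ⟪h, h'⟫ ⟪k, k'⟫` and total
range. -/
def IsMinTensor {A B C : Type} [CStarAlgebra A] [CStarAlgebra B] [CStarAlgebra C]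
    (iA : A →⋆ₐ[ℂ] C) (iB : B →⋆ₐ[ℂ] C) : Prop :=
  ∃ (H : Type) (_ : NormedAddCommGroup H) (_ : InnerProductSpace ℂ H) (_ : CompleteSpace H)
    (K : Type) (_ : NormedAddCommGroup K) (_ : InnerProductSpace ℂ K) (_ : CompleteSpace K)
    (L : Type) (_ : NormedAddCommGroup L) (_ : InnerProductSpace ℂ L) (_ : CompleteSpace L)
    (t : H →ₗ[ℂ] K →ₗ[ℂ] L)
    (πA : A →⋆ₐ[ℂ] (H →L[ℂ] H)) (πB : B →⋆ₐ[ℂ] (K →L[ℂ] K)) (πC : C →⋆ₐ[ℂ] (L →L[ℂ] L)),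
    (∀ h k h' k', ⟪t h k, t h' k'⟫_ℂ = ⟪h, h'⟫_ℂ * ⟪k, k'⟫_ℂ) ∧
    Dense (Submodule.span ℂ {v : L | ∃ h k, v = t h k} : Set L) ∧
    Function.Injective πA ∧ Function.Injective πB ∧ Function.Injective πC ∧
    (∀ a h k, πC (iA a) (t h k) = t (πA a h) k) ∧
    (∀ b h k, πC (iB b) (t h k) = t h (πB b k)) ∧
    Dense (Submodule.span ℂ {c : C | ∃ a b, c = iA a * iB b} : Set C)

/-! ### Quantum models -/

/-- A quantum model `Q`: a class of unital `C*`-algebras, and for its members the tracial states that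
are admissible as states of the model. -/
structure Model where
  mem : ∀ (B : Type) [CStarAlgebra B], Prop
  trace : ∀ (B : Type) [CStarAlgebra B], TracialState B → Prop

namespace Model

/-- The model of a class of `C*`-algebras in which every tracial state is admissible. -/
def full (P : ∀ (B : Type) [CStarAlgebra B], Prop) : Model where
  mem := P
  trace := fun _ _ _ => True

/-- A min-tensor monoid: a class of nonzero `C*`-algebras that contains `ℂ` and is closed under the
minimal tensor product, the admissible tracial states being closed under products as well. -/
structure IsMinTensorMonoid (Q : Model) : Prop where
  nontrivial : ∀ (B : Type) [CStarAlgebra B], Q.mem B → Nontrivial B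
  mem_complex : Q.mem ℂ
  trace_complex : ∀ τ : TracialState ℂ, Q.trace ℂ τ
  mem_tensor : ∀ (A B C : Type) [CStarAlgebra A] [CStarAlgebra B] [CStarAlgebra C]
    (iA : A →⋆ₐ[ℂ] C) (iB : B →⋆ₐ[ℂ] C), IsMinTensor iA iB → Q.mem A → Q.mem B → Q.mem C
  trace_tensor : ∀ (A B C : Type) [CStarAlgebra A] [CStarAlgebra B] [CStarAlgebra C]
    (iA : A →⋆ₐ[ℂ] C) (iB : B →⋆ₐ[ℂ] C), IsMinTensor iA iB → Q.mem A → Q.mem B →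
    ∀ (φ : TracialState A) (ψ : TracialState B) (χ : TracialState C), Q.trace A φ → Q.trace B ψ →
      (∀ a b, χ.toLin (iA a * iB b) = φ.toLin a * ψ.toLin b) → Q.trace C χ

/-- Inclusion `Q ⊆ Q'` of the classes of `C*`-algebras. -/
def AlgSubset (Q Q' : Model) : Prop := ∀ (B : Type) [CStarAlgebra B], Q.mem B → Q'.mem B

/-- Inclusion `Q ⊆ Q'` of the classes of `C*`-algebras and of their admissible tracial states. -/
def Subset (Q Q' : Model) : Prop :=
  ∀ (B : Type) [CStarAlgebra B], Q.mem B → Q'.mem B ∧ ∀ φ, Q.trace B φ → Q'.trace B φ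

/-- Every algebra of the model has an admissible tracial state. For `full P`, this says that every
algebra in `P` has a tracial state. -/
def IsTracial (Q : Model) : Prop :=
  ∀ (B : Type) [CStarAlgebra B], Q.mem B → ∃ φ : TracialState B, Q.trace B φ

/-- The tracial state `τ` is over `Q`: it is induced by a representation in a `C*`-algebra of `Q` and
an admissible tracial state of that algebra. -/
def Over (Q : Model) {𝒜 : Type} [Ring 𝒜] [StarRing 𝒜] [Algebra ℂ 𝒜] (τ : TracialState 𝒜) : Prop :=
  ∃ (B : Type) (_ : CStarAlgebra B) (π : 𝒜 →⋆ₐ[ℂ] B) (φ : TracialState B),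
    Q.mem B ∧ Q.trace B φ ∧ ∀ a, τ.toLin a = φ.toLin (π a)

end Model

/-! ### The hyperfinite `II₁` factor and its ultrapowers -/

/-- The data of a realisation of the hyperfinite `II₁` factor: a Hilbert space with a unit vector
`vec` and an increasing sequence of unital copies of the matrix algebras `M_{2^n}`, on which the
vector state of `vec` is the normalised trace and for whose union `vec` is cyclic. In other words,
the space is the completion of `⋃ₙ M_{2^n}` in the trace inner product, acted on by left
multiplication; it is unique up to unitary equivalence. -/
structure HyperfiniteII₁ where
  H : Type
  [normed : NormedAddCommGroup H]
  [inner : InnerProductSpace ℂ H]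
  [complete : CompleteSpace H]
  vec : H
  mat : ∀ n : ℕ, Matrix (Fin (2 ^ n)) (Fin (2 ^ n)) ℂ →⋆ₐ[ℂ] (H →L[ℂ] H)
  mono : ∀ n, Set.range (mat n) ⊆ Set.range (mat (n + 1))
  vec_trace : ∀ n a, ⟪vec, mat n a vec⟫_ℂ = Matrix.trace a / 2 ^ n
  cyclic : Dense {v : H | ∃ n a, v = mat n a vec}

attribute [instance] HyperfiniteII₁.normed HyperfiniteII₁.inner HyperfiniteII₁.complete

namespace HyperfiniteII₁

/-- The factor itself, the double commutant of `⋃ₙ M_{2^n}`. -/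
def alg (R : HyperfiniteII₁) : StarSubalgebra ℂ (R.H →L[ℂ] R.H) :=
  StarSubalgebra.centralizer ℂ
    (StarSubalgebra.centralizer ℂ (⋃ n, Set.range (R.mat n)) : Set (R.H →L[ℂ] R.H))

/-- The trace `τ(a) = ⟪vec, a vec⟫` of the factor. -/
def tr (R : HyperfiniteII₁) (a : R.H →L[ℂ] R.H) : ℂ := ⟪R.vec, a R.vec⟫_ℂ

/-- The norm-bounded sequences in the factor. -/
def boundedSeq (R : HyperfiniteII₁) : StarSubalgebra ℂ (ℕ → (R.H →L[ℂ] R.H)) where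
  carrier := {x | (∀ n, x n ∈ R.alg) ∧ ∃ M : ℝ, ∀ n, ‖x n‖ ≤ M}
  mul_mem' := by
    rintro x y ⟨hx, M, hM⟩ ⟨hy, N, hN⟩
    refine ⟨fun n => mul_mem (hx n) (hy n), M * N, fun n => (norm_mul_le _ _).trans ?_⟩
    exact mul_le_mul (hM n) (hN n) (norm_nonneg _) ((norm_nonneg _).trans (hM n))
  add_mem' := by
    rintro x y ⟨hx, M, hM⟩ ⟨hy, N, hN⟩
    exact ⟨fun n => add_mem (hx n) (hy n), M + N,
      fun n => (norm_add_le _ _).trans (add_le_add (hM n) (hN n))⟩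
  algebraMap_mem' := fun r =>
    ⟨fun _ => R.alg.algebraMap_mem r, ‖algebraMap ℂ (R.H →L[ℂ] R.H) r‖, fun _ => le_rfl⟩
  star_mem' := by
    rintro x ⟨hx, M, hM⟩
    exact ⟨fun n => star_mem (hx n), M, fun n => (norm_star (x n)).trans_le (hM n)⟩

/-- Two bounded sequences are identified in the ultrapower if `‖xₙ - yₙ‖_τ → 0` along `ω`, where
`‖a‖_τ = ‖a vec‖`. (As `‖a‖_τ = ‖a*‖_τ` in the factor, the second clause follows from the first.) -/
def ultraRel (R : HyperfiniteII₁) (ω : Ultrafilter ℕ) (x y : R.boundedSeq) : Prop :=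
  Filter.Tendsto (fun n => ‖(x.1 n - y.1 n) R.vec‖) ω (𝓝 0) ∧
    Filter.Tendsto (fun n => ‖star (x.1 n - y.1 n) R.vec‖) ω (𝓝 0)

/-- The ultrapower `R^ω`. -/
def Ultrapower (R : HyperfiniteII₁) (ω : Ultrafilter ℕ) : Type := RingQuot (R.ultraRel ω)

variable (R : HyperfiniteII₁) (ω : Ultrafilter ℕ)

instance : Ring (R.Ultrapower ω) := inferInstanceAs (Ring (RingQuot (R.ultraRel ω)))

instance : Algebra ℂ (R.Ultrapower ω) := inferInstanceAs (Algebra ℂ (RingQuot (R.ultraRel ω)))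

instance : StarRing (R.Ultrapower ω) :=
  RingQuot.starRing (R.ultraRel ω) fun x y h => by
    have e : ∀ n, (star x : R.boundedSeq).1 n - (star y : R.boundedSeq).1 n
        = star (x.1 n - y.1 n) := fun n => (star_sub (x.1 n) (y.1 n)).symm
    refine ⟨?_, ?_⟩
    · simpa only [e] using h.2
    · simpa only [e, star_star] using h.1

/-- The class in `R^ω` of a bounded sequence. -/
def toUltra (x : R.boundedSeq) : R.Ultrapower ω := RingQuot.mkAlgHom ℂ (R.ultraRel ω) x

end HyperfiniteII₁

/-! ### The standard models -/

namespace Model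

/-- Quantum: the algebras `B(ℂ^d)`, `d ≥ 1`. -/
def q : Model :=
  full fun B _ => ∃ d : ℕ, d ≠ 0 ∧ Nonempty (B ≃⋆ₐ[ℂ] Matrix (Fin d) (Fin d) ℂ)

/-- Quantum approximate: the `C*`-algebras that embed into an ultrapower `R^ω` of the hyperfinite
`II₁` factor along a free ultrafilter; admissible are the restrictions along such embeddings of the
trace `τ_ω([xₙ]) = lim_{n → ω} τ(xₙ)`. -/
def qa : Model where
  mem := fun B _ => ∃ (R : HyperfiniteII₁) (ω : Ultrafilter ℕ) (j : B →⋆ₐ[ℂ] R.Ultrapower ω),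
    (∀ n, {n} ∉ ω) ∧ Function.Injective j
  trace := fun B _ φ =>
    ∃ (R : HyperfiniteII₁) (ω : Ultrafilter ℕ) (j : B →⋆ₐ[ℂ] R.Ultrapower ω),
      (∀ n, {n} ∉ ω) ∧ Function.Injective j ∧
      ∀ (b : B) (x : R.boundedSeq), j b = R.toUltra ω x →
        Filter.Tendsto (fun n => R.tr (x.1 n)) ω (𝓝 (φ.toLin b))

/-- Quantum commuting: the `C*`-algebras with a tracial state. -/
def qc : Model := full fun B _ => Nonempty (TracialState B)

/-- The variant of `qc` that asks for a faithful tracial state. -/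
def qcFaithful : Model :=
  full fun B _ => ∃ φ : TracialState B, ∀ b, φ.toLin (star b * b) = 0 → b = 0

/-- All (nonzero, unital) `C*`-algebras. -/
def cstar : Model := full fun B _ => Nontrivial B

end Model

/-! ### Commutativity gadgets -/

section Gadgets

variable [Fintype A]

/-- `(G, x, y)` is a (non-oracular) `Q`-commutativity gadget for `A`. -/
structure IsGadget (Q : Model) (𝔸 : RelStr σ A) (𝔾 : RelStr σ G) (x y : G) : Prop where
  realize : ∀ a b : A, ∃ (B : Type) (_ : CStarAlgebra B) (π : MorPlus 𝔾 𝔸 →⋆ₐ[ℂ] B),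
    Q.mem B ∧ π (PresAlg.gen _ (x, a)) = 1 ∧ π (PresAlg.gen _ (y, b)) = 1
  commute : ∀ (B : Type) [CStarAlgebra B] (π : MorPlus 𝔾 𝔸 →⋆ₐ[ℂ] B), Q.mem B →
    ∀ a b : A, Commute (π (PresAlg.gen _ (x, a))) (π (PresAlg.gen _ (y, b)))

/-- `(G, x, y)` is an oracular `Q`-commutativity gadget for `A`. -/
structure IsOracularGadget (Q : Model) (𝔸 : RelStr σ A) (𝔾 : RelStr σ G) (x y : G) : Prop where
  realize : ∀ a b : A, ∃ (B : Type) (_ : CStarAlgebra B) (π : MorOPlus 𝔾 𝔸 →⋆ₐ[ℂ] B),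
    Q.mem B ∧ π (PresAlg.gen _ (x, a)) = 1 ∧ π (PresAlg.gen _ (y, b)) = 1
  commute : ∀ (B : Type) [CStarAlgebra B] (π : MorOPlus 𝔾 𝔸 →⋆ₐ[ℂ] B), Q.mem B →
    ∀ a b : A, Commute (π (PresAlg.gen _ (x, a))) (π (PresAlg.gen _ (y, b)))

variable [Fintype σ.Sym]

/-- `(G, x, y)` is an `a`-robust `Q`-commutativity gadget for `A`. -/
structure IsARobustGadget [Fintype G] (Q : Model) (𝔸 : RelStr σ A) (𝔾 : RelStr σ G) (x y : G) :
    Prop where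
  gadget : IsGadget Q 𝔸 𝔾 x y
  robust : ∀ ε : ℝ, 0 < ε → ∃ δ : ℝ, 0 < δ ∧ ∀ τ : TracialState (MorA G A), Q.Over τ →
    τ.defect (weightA 𝔾 𝔸) < δ →
    ∑ a : A, ∑ b : A, τ.normSq (MorA.p x a * MorA.p y b - MorA.p y b * MorA.p x a) < ε

/-- `(G, x, y)` is a `c`-`v`-robust `Q`-commutativity gadget for `A`. -/
structure IsCVRobustGadget [Fintype G] (Q : Model) (𝔸 : RelStr σ A) (𝔾 : RelStr σ G) (x y : G) :
    Prop where
  gadget : IsOracularGadget Q 𝔸 𝔾 x y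
  robust : ∀ ε : ℝ, 0 < ε → ∃ δ : ℝ, 0 < δ ∧ ∀ τ : TracialState (MorCV 𝔾 𝔸), Q.Over τ →
    τ.defect (weightCV 𝔾 𝔸) < δ →
    ∑ a : A, ∑ b : A, τ.normSq (MorCV.p 𝔾 𝔸 x a * MorCV.p 𝔾 𝔸 y b
      - MorCV.p 𝔾 𝔸 y b * MorCV.p 𝔾 𝔸 x a) < ε

/-- `A` admits a `Q`-commutativity gadget (a finite structure). -/
def HasGadget (Q : Model) (𝔸 : RelStr σ A) : Prop :=
  ∃ (G : Type) (_ : Fintype G) (𝔾 : RelStr σ G) (x y : G), IsGadget Q 𝔸 𝔾 x y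

/-- `A` admits an oracular `Q`-commutativity gadget. -/
def HasOracularGadget (Q : Model) (𝔸 : RelStr σ A) : Prop :=
  ∃ (G : Type) (_ : Fintype G) (𝔾 : RelStr σ G) (x y : G), IsOracularGadget Q 𝔸 𝔾 x y

/-- `A` admits an `a`-robust `Q`-commutativity gadget. -/
def HasARobustGadget (Q : Model) (𝔸 : RelStr σ A) : Prop :=
  ∃ (G : Type) (_ : Fintype G) (𝔾 : RelStr σ G) (x y : G), IsARobustGadget Q 𝔸 𝔾 x y

/-- `A` admits a `c`-`v`-robust `Q`-commutativity gadget. -/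
def HasCVRobustGadget (Q : Model) (𝔸 : RelStr σ A) : Prop :=
  ∃ (G : Type) (_ : Fintype G) (𝔾 : RelStr σ G) (x y : G), IsCVRobustGadget Q 𝔸 𝔾 x y

end Gadgets

end QuantumCSP

end

/-!
All implications go through one structure: the power `A ^ (A × A)` with its two projections `x'`
and `y'` to `A`, called the canonical gadget (`canStr`, `canFst`, `canSnd`). Its evaluations at the
points of `A × A` are homomorphisms to `A` that realize every pair of values of `(x', y')`
classically, so that only the commutation of `p_{x'a}` and `p_{y'b}` is ever in question.

A representation of `Mor⁺(G, H)` is a quantum homomorphism `G → H` (`IsPlusHom`, `IsOPlusHom`), and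
quantum homomorphisms compose by tensoring. If `(G, x, y)` is a gadget for `A` over `Q'`, then the
realizations of the pairs `(a, b)` that it provides are combined, by tensor products in `Q'`, to a
quantum homomorphism from `G` to the canonical structure that sends `x` to `x'` and `y` to `y'`.
Followed by any representation of the canonical structure over `Q ⊆ Q'`, it yields a representation
of `Mor⁺(G, A)` over `Q'` with the same PVMs at `x, y` as the given one at `x', y'`; these commute,
since `G` is a gadget. Hence the canonical structure is a gadget over `Q` (`IsGadget.canonical`,
`IsOracularGadget.canonical`). It is then an oracular gadget as well, because its classical
realizations are commutative (`IsGadget.isOracularGadget`).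

The same composition, with product traces, controls the defect of the composite by a constant times
the defect of the given representation, which transfers robustness to the canonical structure
(`ARobustBound.canonical`, `CVRobustBound.canonical`). The passage from `a`-robust to
`c`-`v`-robust (`ARobustBound.cvRobustBound`) bounds a forbidden product `p_{z₁b₁} ⋯ p_{zₙbₙ}` by
inserting `1 = ∑ Φ_c`: each `c ∈ R^A` differs from `b` somewhere, and there `p_{zᵢbᵢ}` is orthogonal
to `p_{zᵢcᵢ}`.

Exact gadgets are robust by compactness. If robustness fails, the counterexamples have a limit
trace, along an ultrafilter, with defect `0` and a nonzero commutator. For each of the models in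
question the limit trace is of the form `χ ∘ π` with `π` a `*`-homomorphism to a member of the model
and `χ` a *faithful* trace (`Model.LimitClosed`); then `π` is an exact representation in which the
commutator does not vanish (`IsGadget.aRobustBound`, `IsOracularGadget.cvRobustBound`). For all
`C*`-algebras, and for the models defined by the existence of a (faithful) trace, the GNS
construction of the limit trace provides `π`.

For `qa` the limit is taken in matrices. A tracial state over `qa` on an algebra generated by
finitely many PVMs is a pointwise limit of normalized matrix traces
(`IsPVMAlgebra.approximable_of_over_qa`): elements of the hyperfinite factor are approximated in
`2`-norm by their compressions to matrix subalgebras (`exists_mat_approx`), and almost-PVMs of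
matrices are rounded to PVMs by polynomial estimates on the spectrum (`IsPVM.exists_rounding`,
`exists_pvm_lift`). Conversely, a tracial ultraproduct of matrix algebras is a member of `qa`
(`exists_matrix_ultraproduct`), by (in general non-unital) block embeddings into dyadic matrix
algebras. This gives `Model.limitClosed_qa` and the equivalence of robustness over `q` and over
`qa`. Two facts about the standard objects are needed here: the hyperfinite factor exists
(`HyperfiniteII₁.nonempty`), and its tracial ultrapower is a `C*`-algebra
(`exists_ultrapower_equiv`).
-/

noncomputable section

namespace QuantumCSP

/-! ### The GNS construction for a `*`-algebra -/

/-- A positive functional on a unital `*`-algebra for which left multiplications are bounded. -/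
structure BddPosFunctional (𝒜 : Type) [Ring 𝒜] [StarRing 𝒜] [Algebra ℂ 𝒜] where
  toLin : 𝒜 →ₗ[ℂ] ℂ
  nonneg : ∀ a, 0 ≤ toLin (star a * a)
  bdd : ∀ a, ∃ C : ℝ, 0 ≤ C ∧
    ∀ b, (toLin (star (a * b) * (a * b))).re ≤ C ^ 2 * (toLin (star b * b)).re

section PositiveFunctional

variable {𝒜 : Type} [Ring 𝒜] [StarRing 𝒜] [Algebra ℂ 𝒜] [StarModule ℂ 𝒜]

theorem conj_map_star_mul_of_nonneg (φ : 𝒜 →ₗ[ℂ] ℂ) (hφ : ∀ a, 0 ≤ φ (star a * a)) (a b : 𝒜) :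
    (starRingEnd ℂ) (φ (star b * a)) = φ (star a * b) := by
  have him : ∀ c, (φ (star c * c)).im = 0 := fun c => ((Complex.nonneg_iff.1 (hφ c)).2).symm
  have h1 := him (a + b)
  have h2 := him (a + Complex.I • b)
  simp only [star_add, star_smul, add_mul, mul_add, map_add, smul_mul_assoc, mul_smul_comm,
    map_smul, smul_eq_mul, Complex.add_im, Complex.mul_im, him a, him b, Complex.star_def,
    Complex.conj_I, Complex.neg_re, Complex.neg_im, Complex.I_re, Complex.I_im,
    Complex.mul_re] at h1 h2
  apply Complex.ext
  · simp only [Complex.conj_re]; linarith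
  · simp only [Complex.conj_im]; linarith

end PositiveFunctional

namespace BddPosFunctional

variable {𝒜 : Type} [Ring 𝒜] [StarRing 𝒜] [Algebra ℂ 𝒜] [StarModule ℂ 𝒜]
  (f : BddPosFunctional 𝒜)

/-- The algebra, as a pre-Hilbert space with `⟪a, b⟫ = f (a* b)`. -/
@[nolint unusedArguments]
def PreGNS (_ : BddPosFunctional 𝒜) : Type := 𝒜

instance : AddCommGroup f.PreGNS := inferInstanceAs (AddCommGroup 𝒜)
instance : Module ℂ f.PreGNS := inferInstanceAs (Module ℂ 𝒜)

/-- The identification of the algebra with its pre-Hilbert space. -/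
def toPre : 𝒜 ≃ₗ[ℂ] f.PreGNS := LinearEquiv.refl ℂ _

/-- The semi-inner product of a positive functional. -/
abbrev preCore : PreInnerProductSpace.Core ℂ f.PreGNS where
  inner a b := f.toLin (star (f.toPre.symm a) * f.toPre.symm b)
  conj_inner_symm a b := conj_map_star_mul_of_nonneg f.toLin f.nonneg _ _
  re_inner_nonneg a := (RCLike.nonneg_iff.mp (f.nonneg _)).1
  add_left a b c := by rw [map_add, star_add, add_mul, map_add]
  smul_left a b c := by
    rw [map_smul, star_smul, smul_mul_assoc, map_smul]; rfl

instance : SeminormedAddCommGroup f.PreGNS :=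
  InnerProductSpace.Core.toSeminormedAddCommGroup (c := f.preCore)
instance : InnerProductSpace ℂ f.PreGNS := InnerProductSpace.ofCore f.preCore

theorem pre_inner (a b : 𝒜) : ⟪f.toPre a, f.toPre b⟫_ℂ = f.toLin (star a * b) := rfl

theorem pre_norm_sq (a : 𝒜) : ‖f.toPre a‖ ^ 2 = (f.toLin (star a * a)).re := by
  rw [← f.pre_inner, ← inner_self_eq_norm_sq (𝕜 := ℂ)]; rfl

/-- Left multiplication by `a` on the pre-Hilbert space. -/
def leftMul (a : 𝒜) : f.PreGNS →L[ℂ] f.PreGNS :=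
  LinearMap.mkContinuous
    (f.toPre.toLinearMap ∘ₗ LinearMap.mulLeft ℂ a ∘ₗ f.toPre.symm.toLinearMap)
    (f.bdd a).choose fun x => by
      obtain ⟨h0, h⟩ := (f.bdd a).choose_spec
      refine le_of_sq_le_sq ?_ (by positivity)
      have := h (f.toPre.symm x)
      rw [mul_pow]
      rw [← f.pre_norm_sq, ← f.pre_norm_sq] at this
      exact this
where
  le_of_sq_le_sq {x y : ℝ} (h : x ^ 2 ≤ y ^ 2) (hy : 0 ≤ y) : x ≤ y := abs_le_of_sq_le_sq' h hy |>.2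

theorem leftMul_toPre (a b : 𝒜) : f.leftMul a (f.toPre b) = f.toPre (a * b) := rfl

/-- The GNS Hilbert space. -/
abbrev GNS : Type := UniformSpace.Completion f.PreGNS

theorem completion_ext {T S : f.GNS →L[ℂ] f.GNS}
    (h : ∀ a : 𝒜, T (f.toPre a : f.GNS) = S (f.toPre a : f.GNS)) : T = S := by
  ext c
  induction c using UniformSpace.Completion.induction_on with
  | hp => exact isClosed_eq T.continuous S.continuous
  | ih c => exact h c

theorem leftMul_completion (a b : 𝒜) :
    (f.leftMul a).completion (f.toPre b : f.GNS) = (f.toPre (a * b) : f.GNS) := by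
  rw [ContinuousLinearMap.completion_apply_coe, leftMul_toPre]

/-- The GNS representation. -/
def gns : 𝒜 →⋆ₐ[ℂ] (f.GNS →L[ℂ] f.GNS) where
  toFun a := (f.leftMul a).completion
  map_one' := f.completion_ext fun a => by
    simp only [leftMul_completion, one_mul, one_apply_eq_self]
  map_mul' a b := f.completion_ext fun c => by
    simp only [mul_apply_eq_comp, leftMul_completion, mul_assoc]
  map_zero' := f.completion_ext fun a => by
    simp only [leftMul_completion, zero_mul, map_zero, UniformSpace.Completion.coe_zero,
      zero_apply]
  map_add' a b := f.completion_ext fun c => by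
    simp only [leftMul_completion, add_mul, map_add, UniformSpace.Completion.coe_add,
      add_apply]
  commutes' r := f.completion_ext fun c => by
    simp only [leftMul_completion, Algebra.algebraMap_eq_smul_one, smul_mul_assoc, one_mul,
      map_smul,
      UniformSpace.Completion.coe_smul, smul_apply, one_apply_eq_self]
  map_star' a := by
    refine (ContinuousLinearMap.eq_adjoint_iff _ _).mpr fun x y => ?_
    induction x, y using UniformSpace.Completion.induction_on₂ with
    | hp => apply isClosed_eq <;> fun_prop
    | ih x y =>
      obtain ⟨x, rfl⟩ := f.toPre.surjective x
      obtain ⟨y, rfl⟩ := f.toPre.surjective y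
      simp only [leftMul_completion, UniformSpace.Completion.inner_coe, pre_inner, star_mul,
        star_star, mul_assoc]

/-- The cyclic vector. -/
def gnsVec : f.GNS := (f.toPre 1 : f.GNS)

theorem gns_vec (a : 𝒜) : f.gns a f.gnsVec = (f.toPre a : f.GNS) := by
  change (f.leftMul a).completion (f.toPre 1 : f.GNS) = _
  rw [leftMul_completion, mul_one]

theorem inner_gns_vec (a b : 𝒜) :
    ⟪f.gns a f.gnsVec, f.gns b f.gnsVec⟫_ℂ = f.toLin (star a * b) := by
  rw [gns_vec, gns_vec, UniformSpace.Completion.inner_coe, pre_inner]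

theorem inner_vec_gns_vec (a : 𝒜) : ⟪f.gnsVec, f.gns a f.gnsVec⟫_ℂ = f.toLin a := by
  simpa using f.inner_gns_vec 1 a

theorem dense_gns_vec : Dense (Set.range fun a => f.gns a f.gnsVec) := by
  have : (fun a => f.gns a f.gnsVec) = (fun x : f.PreGNS => (x : f.GNS)) ∘ f.toPre := by
    funext a; exact f.gns_vec a
  rw [this, f.toPre.surjective.range_comp]
  exact UniformSpace.Completion.denseRange_coe

theorem gns_eq_zero_iff (a : 𝒜) :
    f.gns a = 0 ↔ ∀ b, f.toLin (star (a * b) * (a * b)) = 0 := by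
  constructor
  · intro h b
    rw [← f.inner_gns_vec, map_mul, h]
    simp
  · intro h
    refine f.completion_ext fun b => ?_
    rw [← f.gns_vec b, ← mul_apply_eq_comp, ← map_mul]
    rw [zero_apply, ← inner_self_eq_zero (𝕜 := ℂ), inner_gns_vec, h b]

end BddPosFunctional

/-! ### Positive functionals on `C*`-algebras and the universal representation -/

section CStar

variable {B : Type} [CStarAlgebra B]

theorem re_map_star_mul_le (φ : B →ₗ[ℂ] ℂ) (hφ : ∀ a, 0 ≤ φ (star a * a)) (a b : B) :
    (φ (star (a * b) * (a * b))).re ≤ ‖a‖ ^ 2 * (φ (star b * b)).re := by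
  let _ := CStarAlgebra.spectralOrder B
  have := CStarAlgebra.spectralOrderedRing B
  have h : star b * (star a * a) * b ≤ ‖star a * a‖ • (star b * b) :=
    CStarAlgebra.star_left_conjugate_le_norm_smul
  rw [← sub_nonneg, StarOrderedRing.nonneg_iff] at h
  have key : ∀ x ∈ AddSubmonoid.closure (Set.range fun s : B => star s * s), 0 ≤ φ x := by
    intro x hx
    induction hx using AddSubmonoid.closure_induction with
    | mem x hx => obtain ⟨s, rfl⟩ := hx; exact hφ s
    | zero => simp
    | add x y _ _ hx hy => rw [map_add]; exact add_nonneg hx hy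
  have h2 := (Complex.nonneg_iff.1 (key _ h)).1
  rw [map_sub, CStarRing.norm_star_mul_self, ← Complex.coe_smul, map_smul] at h2
  have e : star (a * b) * (a * b) = star b * (star a * a) * b := by
    simp only [star_mul, mul_assoc]
  rw [e, sq]
  simp only [Complex.sub_re, smul_eq_mul, Complex.mul_re, Complex.ofReal_re, Complex.ofReal_im,
    zero_mul, sub_zero] at h2
  linarith

/-- A positive functional on a `C*`-algebra, with the boundedness that positivity implies. -/
def BddPosFunctional.ofCStar (φ : B →ₗ[ℂ] ℂ) (hφ : ∀ a, 0 ≤ φ (star a * a)) :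
    BddPosFunctional B where
  toLin := φ
  nonneg := hφ
  bdd a := ⟨‖a‖, norm_nonneg a, re_map_star_mul_le φ hφ a⟩

theorem im_eq_zero_of_isSelfAdjoint (g : StrongDual ℂ B) (hg : ‖g‖ ≤ 1) (h1 : g 1 = 1) {h : B}
    (hh : IsSelfAdjoint h) : (g h).im = 0 := by
  have key : ∀ t : ℝ, 2 * (g h).im * t ≤ ‖h‖ ^ 2 := by
    intro t
    let x : B := h + algebraMap ℂ B (Complex.I * t)
    have e1 : star x * x = h * h + algebraMap ℂ B ((t : ℂ) ^ 2) := by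
      have : star x = h - algebraMap ℂ B (Complex.I * t) := by
        simp only [x, star_add, hh.star_eq, ← algebraMap_star_comm, star_mul', Complex.star_def,
          Complex.conj_I, Complex.conj_ofReal, neg_mul, map_neg, sub_eq_add_neg]
      rw [this, show x = h + algebraMap ℂ B (Complex.I * t) from rfl, sub_mul, mul_add, mul_add,
        Algebra.commutes (Complex.I * t : ℂ) h, ← map_mul,
        show (Complex.I * t * (Complex.I * t) : ℂ) = -(t : ℂ) ^ 2 by
          ring_nf; simp, map_neg]
      abel
    have e2 : ‖x‖ ^ 2 ≤ ‖h‖ ^ 2 + t ^ 2 := by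
      rw [sq, ← CStarRing.norm_star_mul_self, e1]
      refine (norm_add_le _ _).trans (add_le_add ((norm_mul_le _ _).trans (sq ‖h‖).ge) ?_)
      refine (norm_algebraMap _ _).le.trans ?_
      by_cases hn : Nontrivial B
      · simp
      · have : (1 : B) = 0 := by
          rw [not_nontrivial_iff_subsingleton] at hn; exact Subsingleton.elim _ _
        rw [this]; simp; positivity
    have e3 : ‖g x‖ ^ 2 ≤ ‖x‖ ^ 2 := by
      have : ‖g x‖ ≤ ‖x‖ := (g.le_opNorm x).trans (mul_le_of_le_one_left (norm_nonneg _) hg)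
      gcongr
    have e4 : g x = g h + Complex.I * t := by
      simp only [x, map_add, Algebra.algebraMap_eq_smul_one, map_smul, h1, smul_eq_mul, mul_one]
    rw [e4, Complex.sq_norm, Complex.normSq_apply] at e3
    simp only [Complex.add_re, Complex.add_im, Complex.mul_re, Complex.mul_im, Complex.I_re,
      Complex.I_im, Complex.ofReal_re, Complex.ofReal_im] at e3
    nlinarith [sq_nonneg (g h).re, sq_nonneg (g h).im]
  by_contra hne
  have h2 := key ((‖h‖ ^ 2 + 1) / (2 * (g h).im))
  rw [mul_div_cancel₀ _ (by simpa using hne)] at h2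
  linarith

/-- A unital functional of norm at most one on a `C*`-algebra is positive. -/
theorem nonneg_of_norm_le_one (g : StrongDual ℂ B) (hg : ‖g‖ ≤ 1) (h1 : g 1 = 1) (a : B) :
    0 ≤ g (star a * a) := by
  let _ := CStarAlgebra.spectralOrder B
  have := CStarAlgebra.spectralOrderedRing B
  set c := star a * a with hc
  have hsa : IsSelfAdjoint c := IsSelfAdjoint.star_mul_self a
  rw [Complex.nonneg_iff]
  refine ⟨?_, (im_eq_zero_of_isSelfAdjoint g hg h1 hsa).symm⟩
  have h0 : 0 ≤ c := star_mul_self_nonneg a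
  have hle : c ≤ algebraMap ℝ B ‖c‖ := hsa.le_algebraMap_norm_self
  have hn : ‖algebraMap ℝ B ‖c‖ - c‖ ≤ ‖c‖ := by
    rw [CStarAlgebra.norm_le_iff_le_algebraMap _ (norm_nonneg _) (sub_nonneg.2 hle)]
    exact sub_le_self _ h0
  have h2 : ‖g (algebraMap ℝ B ‖c‖ - c)‖ ≤ ‖c‖ :=
    (g.le_opNorm _).trans ((mul_le_of_le_one_left (norm_nonneg _) hg).trans hn)
  have h3 : g (algebraMap ℝ B ‖c‖ - c) = ‖c‖ - g c := by
    rw [map_sub, Algebra.algebraMap_eq_smul_one, ← Complex.coe_smul, map_smul, h1]; simp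
  have h4 := (Complex.re_le_norm _).trans h2
  rw [h3] at h4
  simp only [Complex.sub_re, Complex.ofReal_re] at h4
  linarith

open WeakDual in
/-- Positive functionals detect nonzero elements: a character of the commutative `C*`-algebra
generated by `a* a` that attains the norm extends, by Hahn–Banach, to a state. -/
theorem exists_nonneg_map_ne_zero {a : B} (ha : a ≠ 0) :
    ∃ φ : B →ₗ[ℂ] ℂ, (∀ b, 0 ≤ φ (star b * b)) ∧ φ (star a * a) ≠ 0 := by
  have : Nontrivial B := ⟨⟨a, 0, ha⟩⟩
  set c := star a * a with hc
  have hsa : IsSelfAdjoint c := IsSelfAdjoint.star_mul_self a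
  have : IsStarNormal c := hsa.isStarNormal
  have hc0 : c ≠ 0 := by rwa [hc, Ne, CStarRing.star_mul_self_eq_zero_iff]
  let E := StarAlgebra.elemental ℂ c
  let c' : E := ⟨c, StarAlgebra.elemental.self_mem ℂ c⟩
  have hE : gelfandTransform ℂ E c' ≠ 0 := by
    intro h
    have := (gelfandTransform_isometry E).norm_map_of_map_zero (map_zero _) c'
    rw [h, norm_zero] at this
    exact hc0 (congrArg Subtype.val (norm_eq_zero.1 this.symm))
  obtain ⟨χ, hχ⟩ : ∃ χ : WeakDual.characterSpace ℂ E, χ c' ≠ 0 := by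
    by_contra! h
    exact hE (ContinuousMap.ext h)
  let χ' : StrongDual ℂ E := WeakDual.toStrongDual (χ : WeakDual ℂ E)
  have hχ' : ‖χ'‖ ≤ 1 := by
    refine ContinuousLinearMap.opNorm_le_bound _ zero_le_one fun x => ?_
    rw [one_mul]
    exact spectrum.norm_le_norm_of_mem (AlgHom.apply_mem_spectrum χ x)
  obtain ⟨g, hg, hgn⟩ := exists_extension_norm_eq (𝕜 := ℂ) (E := B)
    (Subalgebra.toSubmodule E.toSubalgebra) χ'
  refine ⟨g.toLinearMap, ?_, ?_⟩
  · refine nonneg_of_norm_le_one g (hgn.le.trans hχ') ?_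
    have := hg (1 : E)
    refine this.trans ?_
    exact map_one χ
  · have := hg c'
    change g c ≠ 0
    rw [show g c = χ c' from this]
    exact hχ

end CStar

section DirectSum

variable {ι : Type} {H : ι → Type} [∀ i, NormedAddCommGroup (H i)] [∀ i, InnerProductSpace ℂ (H i)]

/-- The direct sum of a uniformly bounded family of operators. -/
def lpDiag (T : ∀ i, H i →L[ℂ] H i) (C : ℝ) (hC : ∀ i, ‖T i‖ ≤ C) : lp H 2 →L[ℂ] lp H 2 :=
  LinearMap.mkContinuous
    { toFun := fun x => ⟨fun i => T i (x i), by
        refine Memℓp.mono' (F := H) ((lp.memℓp x).const_smul (C : ℂ)) fun i => ?_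
        refine ((T i).le_opNorm _).trans ?_
        rw [Pi.smul_apply, norm_smul, Complex.norm_real]
        exact mul_le_mul_of_nonneg_right ((hC i).trans (le_abs_self C)) (norm_nonneg _)⟩
      map_add' := fun x y => by
        apply lp.ext; funext i; exact map_add (T i) _ _
      map_smul' := fun c x => by
        apply lp.ext; funext i; simp }
    |C| fun x => by
      have e : |C| * ‖x‖ = ‖(C : ℂ) • x‖ := by
        rw [norm_smul, Complex.norm_real, Real.norm_eq_abs]
      rw [e]
      refine lp.norm_mono (p := 2) two_ne_zero fun i => ?_
      change ‖T i (x i)‖ ≤ ‖(C : ℂ) • x i‖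
      refine ((T i).le_opNorm _).trans ?_
      rw [norm_smul, Complex.norm_real]
      exact mul_le_mul_of_nonneg_right ((hC i).trans (le_abs_self C)) (norm_nonneg _)

theorem lpDiag_apply (T : ∀ i, H i →L[ℂ] H i) (C : ℝ) (hC : ∀ i, ‖T i‖ ≤ C) (x : lp H 2) (i : ι) :
    lpDiag T C hC x i = T i (x i) := rfl

end DirectSum

/-- The universal representation of a `C*`-algebra: it is faithful and every positive functional
is a vector functional of it. -/
theorem exists_universal_representation (B : Type) [CStarAlgebra B] :
    ∃ (H : Type) (_ : NormedAddCommGroup H) (_ : InnerProductSpace ℂ H) (_ : CompleteSpace H)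
      (π : B →⋆ₐ[ℂ] (H →L[ℂ] H)), Function.Injective π ∧
      ∀ φ : B →ₗ[ℂ] ℂ, (∀ b, 0 ≤ φ (star b * b)) → ∃ v : H, ∀ b, φ b = ⟪v, π b v⟫_ℂ := by
  classical
  have hn : ∀ (b : B) (f : BddPosFunctional B), ‖f.gns b‖ ≤ ‖b‖ := fun b f =>
    NonUnitalStarAlgHom.norm_apply_le f.gns b
  let π : B →⋆ₐ[ℂ] (lp (fun f : BddPosFunctional B => f.GNS) 2 →L[ℂ]
      lp (fun f : BddPosFunctional B => f.GNS) 2) :=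
    { toFun := fun b => lpDiag (fun f => f.gns b) ‖b‖ (hn b)
      map_one' := by
        ext x : 1; apply lp.ext; funext i
        rw [lpDiag_apply, map_one]; rfl
      map_mul' := fun a b => by
        ext x : 1; apply lp.ext; funext i
        rw [lpDiag_apply, map_mul]; rfl
      map_zero' := by
        ext x : 1; apply lp.ext; funext i
        rw [lpDiag_apply, map_zero]; rfl
      map_add' := fun a b => by
        ext x : 1; apply lp.ext; funext i
        rw [lpDiag_apply, map_add]; rfl
      commutes' := fun r => by
        ext x : 1; apply lp.ext; funext i
        rw [lpDiag_apply, AlgHomClass.commutes]; rfl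
      map_star' := fun a => by
        refine (ContinuousLinearMap.eq_adjoint_iff _ _).mpr fun x y => ?_
        rw [lp.inner_eq_tsum, lp.inner_eq_tsum]
        refine tsum_congr fun f => ?_
        rw [lpDiag_apply, lpDiag_apply, map_star, ContinuousLinearMap.star_eq_adjoint,
          ContinuousLinearMap.adjoint_inner_left] }
  have hvec : ∀ (f : BddPosFunctional B) (b : B),
      f.toLin b = ⟪lp.single 2 f f.gnsVec, π b (lp.single 2 f f.gnsVec)⟫_ℂ := fun f b => by
    rw [lp.inner_single_left]
    change _ = ⟪f.gnsVec, f.gns b (lp.single 2 f f.gnsVec f)⟫_ℂ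
    rw [lp.single_apply_self, f.inner_vec_gns_vec]
  refine ⟨_, _, _, inferInstance, π, ?_, fun φ hφ => ?_⟩
  · rw [injective_iff_map_eq_zero]
    intro a ha
    by_contra hne
    obtain ⟨φ, hφ, hne'⟩ := exists_nonneg_map_ne_zero hne
    apply hne'
    have := hvec (BddPosFunctional.ofCStar φ hφ) (star a * a)
    rw [map_mul π, ha, mul_zero, zero_apply, inner_zero_right] at this
    exact this
  · exact ⟨_, hvec (BddPosFunctional.ofCStar φ hφ)⟩

/-! ### The minimal tensor product -/

theorem complex_inner_self_nonneg {V : Type} [SeminormedAddCommGroup V] [InnerProductSpace ℂ V]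
    (x : V) : 0 ≤ ⟪x, x⟫_ℂ := by
  rw [inner_self_eq_norm_sq_to_K (𝕜 := ℂ)]
  have h := Complex.zero_le_real.2 (sq_nonneg ‖x‖)
  rw [Complex.ofReal_pow] at h
  exact h

section Completion

open UniformSpace

variable {A V : Type} [CStarAlgebra A] [NormedAddCommGroup V] [InnerProductSpace ℂ V]
  (ρ : A →ₐ[ℂ] Module.End ℂ V) (hρ : ∀ a x y, ⟪ρ a x, y⟫_ℂ = ⟪x, ρ (star a) y⟫_ℂ)

include hρ in
/-- A `*`-representation of a `C*`-algebra on a pre-Hilbert space is contractive, since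
`‖a‖ ^ 2 - a* a` is of the form `s* s`. -/
theorem norm_rep_le (a : A) (x : V) : ‖ρ a x‖ ≤ ‖a‖ * ‖x‖ := by
  let φ : A →ₗ[ℂ] ℂ :=
    { toFun := fun a => ⟪x, ρ a x⟫_ℂ
      map_add' := fun a b => by rw [map_add, LinearMap.add_apply, inner_add_right]
      map_smul' := fun c a => by
        rw [map_smul, LinearMap.smul_apply, inner_smul_right]; rfl }
  have h1 : ∀ b, φ (star b * b) = ((‖ρ b x‖ ^ 2 : ℝ) : ℂ) := fun b => by
    change ⟪x, ρ (star b * b) x⟫_ℂ = _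
    rw [map_mul, Module.End.mul_apply, ← hρ, inner_self_eq_norm_sq_to_K]; simp
  have h2 := re_map_star_mul_le φ (fun b => by
    rw [h1]; exact Complex.zero_le_real.2 (sq_nonneg _)) a 1
  rw [h1, mul_one, h1, map_one, Module.End.one_apply, Complex.ofReal_re, Complex.ofReal_re,
    ← mul_pow] at h2
  exact (abs_le_of_sq_le_sq' h2 (by positivity)).2

/-- The extension of a `*`-representation on a pre-Hilbert space to the completion. -/
def completionRep : A →⋆ₐ[ℂ] (Completion V →L[ℂ] Completion V) :=
  let T : A → V →L[ℂ] V := fun a => (ρ a).mkContinuous ‖a‖ (norm_rep_le ρ hρ a)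
  have hT : ∀ a v, T a v = ρ a v := fun a v => rfl
  have ext : ∀ {R S : Completion V →L[ℂ] Completion V}, (∀ v : V, R v = S v) → R = S := by
    intro R S h
    ext c
    induction c using UniformSpace.Completion.induction_on with
    | hp => exact isClosed_eq R.continuous S.continuous
    | ih c => exact h c
  { toFun := fun a => (T a).completion
    map_one' := ext fun v => by
      rw [ContinuousLinearMap.completion_apply_coe, hT, map_one]; rfl
    map_mul' := fun a b => ext fun v => by
      simp only [mul_apply_eq_comp, ContinuousLinearMap.completion_apply_coe, hT, map_mul,
        Module.End.mul_apply]
    map_zero' := ext fun v => by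
      simp only [ContinuousLinearMap.completion_apply_coe, hT, map_zero, zero_apply,
        LinearMap.zero_apply, Completion.coe_zero]
    map_add' := fun a b => ext fun v => by
      simp only [ContinuousLinearMap.completion_apply_coe, hT, map_add, add_apply,
        LinearMap.add_apply, Completion.coe_add]
    commutes' := fun r => ext fun v => by
      rw [ContinuousLinearMap.completion_apply_coe, hT, AlgHomClass.commutes,
        Algebra.algebraMap_eq_smul_one, Algebra.algebraMap_eq_smul_one]
      exact Completion.coe_smul r v
    map_star' := fun a => by
      refine (ContinuousLinearMap.eq_adjoint_iff _ _).mpr fun x y => ?_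
      induction x, y using UniformSpace.Completion.induction_on₂ with
      | hp => apply isClosed_eq <;> fun_prop
      | ih x y =>
        simp only [ContinuousLinearMap.completion_apply_coe, hT, Completion.inner_coe, hρ,
          star_star] }

theorem completionRep_coe (a : A) (v : V) :
    completionRep ρ hρ a (v : Completion V) = (ρ a v : Completion V) := by
  change (ContinuousLinearMap.completion _) (v : Completion V) = _
  rw [ContinuousLinearMap.completion_apply_coe]; rfl

end Completion

section Tensor

open UniformSpace TensorProduct

variable {A B : Type} [CStarAlgebra A] [CStarAlgebra B]

/-- The `*`-algebra spanned by the products of two commuting represented algebras. -/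
def prodSpan {D : Type} [CStarAlgebra D] (f : A →⋆ₐ[ℂ] D) (g : B →⋆ₐ[ℂ] D)
    (h : ∀ a b, Commute (f a) (g b)) : StarSubalgebra ℂ D where
  carrier := Submodule.span ℂ {c : D | ∃ a b, c = f a * g b}
  mul_mem' := by
    intro x y hx hy
    simp only [SetLike.mem_coe] at hx hy ⊢
    induction hx, hy using Submodule.span_induction₂ with
    | mem_mem x y hx hy =>
      obtain ⟨a, b, rfl⟩ := hx
      obtain ⟨a', b', rfl⟩ := hy
      refine Submodule.subset_span ⟨a * a', b * b', ?_⟩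
      rw [map_mul, map_mul, mul_assoc, ← mul_assoc (g b), ← (h a' b).eq]; simp only [mul_assoc]
    | zero_left y hy => rw [zero_mul]; exact zero_mem _
    | zero_right x hx => rw [mul_zero]; exact zero_mem _
    | add_left x y z _ _ _ h1 h2 => rw [add_mul]; exact add_mem h1 h2
    | add_right x y z _ _ _ h1 h2 => rw [mul_add]; exact add_mem h1 h2
    | smul_left r x y _ _ h => rw [smul_mul_assoc]; exact Submodule.smul_mem _ _ h
    | smul_right r x y _ _ h => rw [mul_smul_comm]; exact Submodule.smul_mem _ _ h
  add_mem' := fun hx hy => add_mem hx hy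
  algebraMap_mem' r := by
    rw [Algebra.algebraMap_eq_smul_one]
    exact Submodule.smul_mem _ _ (Submodule.subset_span ⟨1, 1, by simp⟩)
  star_mem' := by
    intro x hx
    simp only [SetLike.mem_coe] at hx ⊢
    induction hx using Submodule.span_induction with
    | mem x hx =>
      obtain ⟨a, b, rfl⟩ := hx
      refine Submodule.subset_span ⟨star a, star b, ?_⟩
      rw [star_mul, ← map_star, ← map_star, (h _ _).eq]
    | zero => rw [star_zero]; exact zero_mem _
    | add x y _ _ h1 h2 => rw [star_add]; exact add_mem h1 h2
    | smul r x _ h => rw [star_smul]; exact Submodule.smul_mem _ _ h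

/-- Bounded operators as linear maps. -/
def toEnd (H : Type) [NormedAddCommGroup H] [InnerProductSpace ℂ H] :
    (H →L[ℂ] H) →ₐ[ℂ] Module.End ℂ H :=
  { ContinuousLinearMap.toLinearMapRingHom with commutes' := fun _ => rfl }

/-- The tensor product of two representations, on the Hilbert space tensor product. -/
theorem exists_tensor_rep {H K : Type} [NormedAddCommGroup H] [InnerProductSpace ℂ H]
    [CompleteSpace H] [NormedAddCommGroup K] [InnerProductSpace ℂ K] [CompleteSpace K]
    (πA : A →⋆ₐ[ℂ] (H →L[ℂ] H)) (πB : B →⋆ₐ[ℂ] (K →L[ℂ] K)) :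
    ∃ (L : Type) (_ : NormedAddCommGroup L) (_ : InnerProductSpace ℂ L) (_ : CompleteSpace L)
      (t : H →ₗ[ℂ] K →ₗ[ℂ] L) (f : A →⋆ₐ[ℂ] (L →L[ℂ] L)) (g : B →⋆ₐ[ℂ] (L →L[ℂ] L)),
      (∀ h k h' k', ⟪t h k, t h' k'⟫_ℂ = ⟪h, h'⟫_ℂ * ⟪k, k'⟫_ℂ) ∧
      Dense (Submodule.span ℂ {v : L | ∃ h k, v = t h k} : Set L) ∧
      (∀ a h k, f a (t h k) = t (πA a h) k) ∧ (∀ b h k, g b (t h k) = t h (πB b k)) ∧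
      ∀ a b, Commute (f a) (g b) := by
  let ρA : A →ₐ[ℂ] Module.End ℂ (H ⊗[ℂ] K) :=
    (Module.End.rTensorAlgHom ℂ H K).comp
      ((toEnd H).comp πA.toAlgHom)
  let ρB : B →ₐ[ℂ] Module.End ℂ (H ⊗[ℂ] K) :=
    (Module.End.lTensorAlgHom ℂ K H).comp
      ((toEnd K).comp πB.toAlgHom)
  have hρA' : ∀ a h k, ρA a (h ⊗ₜ k) = πA a h ⊗ₜ k := fun a h k => rfl
  have hρB' : ∀ b h k, ρB b (h ⊗ₜ k) = h ⊗ₜ πB b k := fun b h k => rfl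
  have hρA : ∀ a x y, ⟪ρA a x, y⟫_ℂ = ⟪x, ρA (star a) y⟫_ℂ := by
    intro a x y
    induction x using TensorProduct.induction_on with
    | zero => simp
    | add x x' h1 h2 => simp only [map_add, inner_add_left, h1, h2]
    | tmul h k =>
      induction y using TensorProduct.induction_on with
      | zero => simp
      | add x x' h1 h2 => simp only [map_add, inner_add_right, h1, h2]
      | tmul h' k' =>
        rw [hρA', hρA', inner_tmul, inner_tmul, map_star, ContinuousLinearMap.star_eq_adjoint,
          ContinuousLinearMap.adjoint_inner_right]
  have hρB : ∀ a x y, ⟪ρB a x, y⟫_ℂ = ⟪x, ρB (star a) y⟫_ℂ := by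
    intro a x y
    induction x using TensorProduct.induction_on with
    | zero => simp
    | add x x' h1 h2 => simp only [map_add, inner_add_left, h1, h2]
    | tmul h k =>
      induction y using TensorProduct.induction_on with
      | zero => simp
      | add x x' h1 h2 => simp only [map_add, inner_add_right, h1, h2]
      | tmul h' k' =>
        rw [hρB', hρB', inner_tmul, inner_tmul, map_star, ContinuousLinearMap.star_eq_adjoint,
          ContinuousLinearMap.adjoint_inner_right]
  let L := Completion (H ⊗[ℂ] K)
  let f := completionRep ρA hρA
  let g := completionRep ρB hρB
  have hf : ∀ a h k, f a ((h ⊗ₜ[ℂ] k : H ⊗[ℂ] K) : L) = ((πA a h ⊗ₜ[ℂ] k : H ⊗[ℂ] K) : L) :=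
    fun a h k => by rw [completionRep_coe, hρA']
  have hg : ∀ b h k, g b ((h ⊗ₜ[ℂ] k : H ⊗[ℂ] K) : L) = ((h ⊗ₜ[ℂ] πB b k : H ⊗[ℂ] K) : L) :=
    fun a h k => by rw [completionRep_coe, hρB']
  have hfg : ∀ a b, Commute (f a) (g b) := by
    intro a b
    ext c
    induction c using UniformSpace.Completion.induction_on with
    | hp => exact isClosed_eq (f a * g b).continuous (g b * f a).continuous
    | ih x =>
      induction x using TensorProduct.induction_on with
      | zero => simp only [Completion.coe_zero, map_zero]
      | add x y h1 h2 => simp only [Completion.coe_add, map_add, h1, h2]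
      | tmul h k => simp only [mul_apply_eq_comp, hf, hg]
  let t : H →ₗ[ℂ] K →ₗ[ℂ] L :=
    (TensorProduct.mk ℂ H K).compr₂ (Completion.toComplL (𝕜 := ℂ) (E := H ⊗[ℂ] K)).toLinearMap
  have ht : ∀ h k, t h k = ((h ⊗ₜ[ℂ] k : H ⊗[ℂ] K) : L) := fun h k => rfl
  refine ⟨L, _, _, inferInstance, t, f, g, ?_, ?_, hf, hg, hfg⟩
  · intro h k h' k'
    rw [ht, ht, Completion.inner_coe, inner_tmul]
  · have hd : DenseRange ((↑) : H ⊗[ℂ] K → L) := Completion.denseRange_coe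
    refine hd.mono ?_
    rintro _ ⟨x, rfl⟩
    simp only [SetLike.mem_coe]
    induction x using TensorProduct.induction_on with
    | zero => rw [Completion.coe_zero]; exact zero_mem _
    | add x y h1 h2 => rw [Completion.coe_add]; exact add_mem h1 h2
    | tmul h k => exact Submodule.subset_span ⟨h, k, rfl⟩

/-- The minimal tensor product exists, contains its factors, and carries the products of tracial
states. -/
theorem exists_minTensor (A B : Type) [CStarAlgebra A] [CStarAlgebra B] :
    ∃ (C : Type) (_ : CStarAlgebra C) (iA : A →⋆ₐ[ℂ] C) (iB : B →⋆ₐ[ℂ] C), IsMinTensor iA iB ∧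
      (∀ a b, Commute (iA a) (iB b)) ∧
      ∀ (φ : TracialState A) (ψ : TracialState B), ∃ χ : TracialState C,
        ∀ a b, χ.toLin (iA a * iB b) = φ.toLin a * ψ.toLin b := by
  obtain ⟨H, _, _, _, πA, hπA, hA⟩ := exists_universal_representation A
  obtain ⟨K, _, _, _, πB, hπB, hB⟩ := exists_universal_representation B
  obtain ⟨L, _, _, _, t, f, g, ht, htd, hf, hg, hfg⟩ := exists_tensor_rep πA πB
  let S := prodSpan f g hfg
  have hS : ∀ a b, f a * g b ∈ S := fun a b => Submodule.subset_span ⟨a, b, rfl⟩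
  have hcl : IsClosed (S.topologicalClosure : Set (L →L[ℂ] L)) := S.isClosed_topologicalClosure
  let iA : A →⋆ₐ[ℂ] S.topologicalClosure := f.codRestrict _ fun a =>
    S.le_topologicalClosure (by simpa using hS a 1)
  let iB : B →⋆ₐ[ℂ] S.topologicalClosure := g.codRestrict _ fun b =>
    S.le_topologicalClosure (by simpa using hS 1 b)
  refine ⟨S.topologicalClosure, inferInstance, iA, iB, ⟨H, _, _, inferInstance, K, _, _,
    inferInstance, L, _, _, inferInstance, t, πA, πB, S.topologicalClosure.subtype, ht, htd, hπA,
    hπB, Subtype.val_injective, ?_, ?_, ?_⟩, ?_, ?_⟩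
  · intro a h k; exact hf a h k
  · intro b h k; exact hg b h k
  · rw [Topology.IsInducing.subtypeVal.dense_iff]
    intro x
    have h1 : (x : L →L[ℂ] L) ∈ closure (S : Set (L →L[ℂ] L)) := by
      rw [← StarSubalgebra.topologicalClosure_coe]; exact x.2
    refine closure_mono ?_ h1
    intro y hy
    change y ∈ Submodule.span ℂ _ at hy
    have e : {c : L →L[ℂ] L | ∃ a b, c = f a * g b} =
        S.topologicalClosure.subtype.toAlgHom.toLinearMap ''
          {c | ∃ a b, c = iA a * iB b} := by
      ext c
      constructor
      · rintro ⟨a, b, rfl⟩; exact ⟨_, ⟨a, b, rfl⟩, rfl⟩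
      · rintro ⟨_, ⟨a, b, rfl⟩, rfl⟩; exact ⟨a, b, rfl⟩
    rw [e, Submodule.span_image] at hy
    exact hy
  · intro a b
    exact Subtype.ext (hfg a b)
  · intro φ ψ
    obtain ⟨v, hv⟩ := hA φ.toLin φ.nonneg
    obtain ⟨w, hw⟩ := hB ψ.toLin ψ.nonneg
    have key : ∀ a b, ⟪t v w, (f a * g b) (t v w)⟫_ℂ = φ.toLin a * ψ.toLin b := fun a b => by
      rw [mul_apply_eq_comp, hg, hf, ht, hv, hw]
    have htr : ∀ x ∈ S, ∀ y ∈ S, ⟪t v w, (x * y) (t v w)⟫_ℂ = ⟪t v w, (y * x) (t v w)⟫_ℂ := by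
      intro x hx y hy
      change x ∈ Submodule.span ℂ _ at hx
      change y ∈ Submodule.span ℂ _ at hy
      induction hx, hy using Submodule.span_induction₂ with
      | mem_mem x y hx hy =>
        obtain ⟨a, b, rfl⟩ := hx
        obtain ⟨a', b', rfl⟩ := hy
        have e : ∀ a b a' b', f a * g b * (f a' * g b') = f (a * a') * g (b * b') := by
          intro a b a' b'
          rw [map_mul, map_mul, mul_assoc, ← mul_assoc (g b), ← (hfg a' b).eq]
          simp only [mul_assoc]
        rw [e, e, key, key, φ.tracial, ψ.tracial]
      | zero_left y hy => simp
      | zero_right x hx => simp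
      | add_left x y z _ _ _ h1 h2 =>
        simp only [add_mul, mul_add, add_apply, inner_add_right, h1, h2]
      | add_right x y z _ _ _ h1 h2 =>
        simp only [add_mul, mul_add, add_apply, inner_add_right, h1, h2]
      | smul_left r x y _ _ h =>
        simp only [smul_mul_assoc, mul_smul_comm, smul_apply, inner_smul_right, h]
      | smul_right r x y _ _ h =>
        simp only [smul_mul_assoc, mul_smul_comm, smul_apply, inner_smul_right, h]
    have htr2 : ∀ x ∈ closure (S : Set (L →L[ℂ] L)), ∀ y ∈ closure (S : Set (L →L[ℂ] L)),
        ⟪t v w, (x * y) (t v w)⟫_ℂ = ⟪t v w, (y * x) (t v w)⟫_ℂ := by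
      intro x hx
      refine closure_minimal (fun y hy => ?_) (isClosed_eq (by fun_prop) (by fun_prop))
      revert x
      refine closure_minimal (fun x hx => htr x hx y hy) (isClosed_eq (by fun_prop) (by fun_prop))
    refine ⟨⟨{ toFun := fun c => ⟪t v w, (c : L →L[ℂ] L) (t v w)⟫_ℂ
               map_add' := fun c d => by
                 rw [AddMemClass.coe_add, add_apply, inner_add_right]
               map_smul' := fun r c => by
                 change ⟪t v w, (r • (c : L →L[ℂ] L)) (t v w)⟫_ℂ = _
                 rw [smul_apply, inner_smul_right]; rfl }, ?_, ?_, ?_⟩, ?_⟩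
    · have := key 1 1
      rw [map_one, map_one, φ.map_one, ψ.map_one, mul_one, mul_one] at this
      exact this
    · intro c
      change 0 ≤ ⟪t v w, (star (c : L →L[ℂ] L) * (c : L →L[ℂ] L)) (t v w)⟫_ℂ
      rw [mul_apply_eq_comp, ContinuousLinearMap.star_eq_adjoint,
        ContinuousLinearMap.adjoint_inner_right]
      exact complex_inner_self_nonneg _
    · intro c d
      refine htr2 _ ?_ _ ?_
      · rw [← StarSubalgebra.topologicalClosure_coe]; exact c.2
      · rw [← StarSubalgebra.topologicalClosure_coe]; exact d.2
    · exact key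

theorem IsMinTensor.injective_left {A B C : Type} [CStarAlgebra A] [CStarAlgebra B] [CStarAlgebra C]
    [Nontrivial B] {iA : A →⋆ₐ[ℂ] C} {iB : B →⋆ₐ[ℂ] C} (h : IsMinTensor iA iB) :
    Function.Injective iA := by
  obtain ⟨H, _, _, _, K, _, _, _, L, _, _, _, t, πA, πB, πC, ht, -, hA, hB, -, h1, -, -⟩ := h
  rw [injective_iff_map_eq_zero]
  intro a ha
  have hK : ∃ k : K, k ≠ 0 := by
    by_contra! hk
    have : (1 : K →L[ℂ] K) = 0 := by ext k; simp [hk k]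
    exact one_ne_zero (hB (by rw [map_one, this, map_zero]) : (1 : B) = 0)
  obtain ⟨k, hk⟩ := hK
  refine hA ?_
  rw [map_zero]
  ext x
  have h2 := h1 a x k
  rw [ha, map_zero, zero_apply] at h2
  have h3 := ht (πA a x) k (πA a x) k
  rw [← h2, inner_zero_left, eq_comm, mul_eq_zero, inner_self_eq_zero, inner_self_eq_zero] at h3
  simpa [hk] using h3

theorem IsMinTensor.injective_right {A B C : Type} [CStarAlgebra A] [CStarAlgebra B]
    [CStarAlgebra C] [Nontrivial A] {iA : A →⋆ₐ[ℂ] C} {iB : B →⋆ₐ[ℂ] C} (h : IsMinTensor iA iB) :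
    Function.Injective iB := by
  obtain ⟨H, _, _, _, K, _, _, _, L, _, _, _, t, πA, πB, πC, ht, -, hA, hB, -, -, h1, -⟩ := h
  rw [injective_iff_map_eq_zero]
  intro b hb
  have hH : ∃ h : H, h ≠ 0 := by
    by_contra! hh
    have : (1 : H →L[ℂ] H) = 0 := by ext k; simp [hh k]
    exact one_ne_zero (hA (by rw [map_one, this, map_zero]) : (1 : A) = 0)
  obtain ⟨h, hh⟩ := hH
  refine hB ?_
  rw [map_zero]
  ext x
  have h2 := h1 b h x
  rw [hb, map_zero, zero_apply] at h2
  have h3 := ht h (πB b x) h (πB b x)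
  rw [← h2, inner_zero_left, eq_comm, mul_eq_zero, inner_self_eq_zero, inner_self_eq_zero] at h3
  simpa [hh] using h3

end Tensor

/-! ### Universal properties of the presented algebras -/

namespace FreeStarAlg

variable {X D : Type} [Ring D] [Algebra ℂ D]

/-- The homomorphism determined by the images of the generators. -/
def lift (f : X → D) : FreeStarAlg X →ₐ[ℂ] D :=
  MonoidAlgebra.lift ℂ D (FreeMonoid X) (FreeMonoid.lift f)

theorem lift_monomial (f : X → D) (w : FreeMonoid X) (r : ℂ) :
    lift f (monomial w r) = r • FreeMonoid.lift f w :=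
  MonoidAlgebra.lift_single _ _ _

theorem lift_of (f : X → D) (x : X) : lift f (of x) = f x := by
  rw [of, lift_monomial, one_smul, FreeMonoid.lift_eval_of]

theorem star_monomial (w : FreeMonoid X) (r : ℂ) :
    star (monomial w r) = monomial (star w) (star r) := starHom_monomial w r

theorem star_of (x : X) : star (of x) = of x := by
  rw [of, star_monomial, star_one, FreeMonoid.star_of]

theorem lift_star [StarRing D] [StarModule ℂ D] (f : X → D) (hf : ∀ x, IsSelfAdjoint (f x))
    (a : FreeStarAlg X) : lift f (star a) = star (lift f a) := by
  induction a using induction with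
  | zero => simp
  | add a b ha hb => simp only [star_add, map_add, ha, hb]
  | mono w r =>
    rw [star_monomial, lift_monomial, lift_monomial, star_smul]
    congr 1
    induction w using FreeMonoid.recOn with
    | one => simp
    | of_mul x xs h =>
      rw [star_mul, map_mul, map_mul, star_mul, h, FreeMonoid.star_of, FreeMonoid.lift_eval_of,
        (hf x).star_eq]

theorem mem_adjoin_of (a : FreeStarAlg X) : a ∈ Algebra.adjoin ℂ (Set.range (of (X := X))) := by
  induction a using induction with
  | zero => exact zero_mem _
  | add a b ha hb => exact add_mem ha hb
  | mono w r =>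
    induction w using FreeMonoid.recOn generalizing r with
    | one =>
      have : monomial (1 : FreeMonoid X) r = r • (1 : FreeStarAlg X) := by
        rw [show (1 : FreeStarAlg X) = monomial 1 1 from rfl, smul_monomial, mul_one]
      rw [this]
      exact Subalgebra.smul_mem _ (one_mem _) r
    | of_mul x xs h =>
      have : monomial (FreeMonoid.of x * xs) r = of x * monomial xs r := by
        rw [of, monomial_mul, one_mul]
      rw [this]
      exact mul_mem (Algebra.subset_adjoin ⟨x, rfl⟩) (h r)

end FreeStarAlg

namespace PresAlg

variable {X : Type} (rels : Set (FreeStarAlg X))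

/-- The quotient map. -/
def mk : FreeStarAlg X →ₐ[ℂ] PresAlg rels := RingQuot.mkAlgHom ℂ (presRel rels)

theorem mk_surjective : Function.Surjective (mk rels) := RingQuot.mkAlgHom_surjective ℂ _

theorem mk_of (x : X) : mk rels (FreeStarAlg.of x) = gen rels x := rfl

theorem mk_star (a : FreeStarAlg X) : mk rels (star a) = star (mk rels a) := by
  have h : ∀ b, mk rels b = RingQuot.mkRingHom (presRel rels) b := fun b => by
    rw [← RingQuot.mkAlgHom_coe ℂ]; rfl
  rw [h, h]
  simp only [RingQuot.mkRingHom_def]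
  rfl

variable {rels} in
theorem mk_eq_zero {r : FreeStarAlg X} (hr : r ∈ rels) : mk rels r = 0 := by
  have := RingQuot.mkAlgHom_rel ℂ (s := presRel rels) (x := r) (y := 0) ⟨Or.inl hr, rfl⟩
  rw [map_zero] at this
  exact this

instance : StarModule ℂ (PresAlg rels) where
  star_smul c x := by
    obtain ⟨a, rfl⟩ := mk_surjective rels x
    rw [← map_smul, ← mk_star, star_smul, map_smul, mk_star]

theorem gen_isSelfAdjoint (x : X) : IsSelfAdjoint (gen rels x) := by
  rw [isSelfAdjoint_iff, ← mk_of, ← mk_star, FreeStarAlg.star_of]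

theorem adjoin_gen : Algebra.adjoin ℂ (Set.range (gen rels)) = ⊤ := by
  rw [eq_top_iff]
  rintro a -
  obtain ⟨a, rfl⟩ := mk_surjective rels a
  have h := FreeStarAlg.mem_adjoin_of a
  have h2 : mk rels a ∈ (Algebra.adjoin ℂ (Set.range (FreeStarAlg.of (X := X)))).map (mk rels) :=
    ⟨a, h, rfl⟩
  rw [AlgHom.map_adjoin, ← Set.range_comp] at h2
  exact h2

variable {rels} {D : Type} [Ring D] [StarRing D] [Algebra ℂ D] [StarModule ℂ D]

/-- The universal property of the presented algebra. -/
def lift (f : X → D) (hf : ∀ x, IsSelfAdjoint (f x)) (hr : ∀ r ∈ rels, FreeStarAlg.lift f r = 0) :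
    PresAlg rels →⋆ₐ[ℂ] D :=
  let F : PresAlg rels →ₐ[ℂ] D := RingQuot.liftAlgHom ℂ ⟨FreeStarAlg.lift f, by
    rintro a b ⟨h | h, rfl⟩
    · rw [hr a h, map_zero]
    · rw [map_zero, ← star_eq_zero, ← FreeStarAlg.lift_star f hf, hr _ h]⟩
  have hF : ∀ a, F (mk rels a) = FreeStarAlg.lift f a := fun a =>
    RingQuot.liftAlgHom_mkAlgHom_apply ℂ _ _ a
  { F with
    map_star' := fun x => by
      obtain ⟨a, rfl⟩ := mk_surjective rels x
      change F _ = star (F _)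
      rw [← mk_star, hF, hF, FreeStarAlg.lift_star f hf] }

theorem lift_gen (f : X → D) (hf : ∀ x, IsSelfAdjoint (f x))
    (hr : ∀ r ∈ rels, FreeStarAlg.lift f r = 0) (x : X) : lift f hf hr (gen rels x) = f x :=
  (RingQuot.liftAlgHom_mkAlgHom_apply ℂ _ _ _).trans (FreeStarAlg.lift_of f x)

end PresAlg

/-! ### Projection-valued measures -/

/-- `p` is a projection-valued measure. -/
structure IsPVM {D S : Type} [Ring D] [StarRing D] [Fintype S] (p : S → D) : Prop where
  sa : ∀ s, IsSelfAdjoint (p s)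
  idem : ∀ s, p s * p s = p s
  orth : ∀ s t, s ≠ t → p s * p t = 0
  sum : ∑ s, p s = 1

namespace IsPVM

variable {D E S : Type} [Ring D] [StarRing D] [Algebra ℂ D] [Ring E] [StarRing E] [Algebra ℂ E]
  [Fintype S]

theorem map {p : S → D} (h : IsPVM p) (π : D →⋆ₐ[ℂ] E) : IsPVM fun s => π (p s) where
  sa s := (h.sa s).map π
  idem s := by rw [← map_mul, h.idem]
  orth s t hst := by rw [← map_mul, h.orth s t hst, map_zero]
  sum := by rw [← map_sum, h.sum, map_one]

theorem norm_le_one {B : Type} [CStarAlgebra B] {p : S → B} (h : IsPVM p) (s : S) : ‖p s‖ ≤ 1 := by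
  have h1 : ‖p s‖ * ‖p s‖ = ‖p s‖ := by
    rw [← CStarRing.norm_star_mul_self, (h.sa s).star_eq, h.idem]
  nlinarith [norm_nonneg (p s)]

theorem lift_eq_zero {X : Type} [StarModule ℂ D] {f : X → D} {e : S → X}
    (h : IsPVM fun s => f (e s)) {r : FreeStarAlg X}
    (hr : r ∈ pvmRels fun s => FreeStarAlg.of (e s)) : FreeStarAlg.lift f r = 0 := by
  rcases hr with ⟨s, rfl⟩ | ⟨s, t, hst, rfl⟩ | rfl
  · rw [map_sub, map_mul, FreeStarAlg.lift_of, h.idem, sub_self]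
  · rw [map_mul, FreeStarAlg.lift_of, FreeStarAlg.lift_of, h.orth s t hst]
  · simp only [map_sub, map_sum, FreeStarAlg.lift_of, map_one, h.sum, sub_self]

theorem of_rels {X : Type} {rels : Set (FreeStarAlg X)} {e : S → X}
    (h : (pvmRels fun s => FreeStarAlg.of (e s)) ⊆ rels) :
    IsPVM fun s => PresAlg.gen rels (e s) where
  sa s := PresAlg.gen_isSelfAdjoint rels _
  idem s := by
    have := PresAlg.mk_eq_zero (h (Or.inl ⟨s, rfl⟩))
    rwa [map_sub, map_mul, sub_eq_zero] at this
  orth s t hst := by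
    have := PresAlg.mk_eq_zero (h (Or.inr (Or.inl ⟨s, t, hst, rfl⟩)))
    rwa [map_mul] at this
  sum := by
    have := PresAlg.mk_eq_zero (h (Or.inr (Or.inr rfl)))
    rwa [map_sub, map_sum, map_one, sub_eq_zero] at this

end IsPVM

/-- `𝒜` is the `*`-algebra freely generated by finitely many finite projection-valued measures. -/
def IsPVMAlgebra (𝒜 : Type) [Ring 𝒜] [StarRing 𝒜] [Algebra ℂ 𝒜] : Prop :=
  ∃ (ι : Type) (_ : Finite ι) (S : ι → Type) (_ : ∀ i, Fintype (S i)) (e : ∀ i, S i → 𝒜),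
    (∀ i, IsPVM (e i)) ∧ Algebra.adjoin ℂ {a | ∃ i s, a = e i s} = ⊤ ∧
    ∀ (D : Type) [Ring D] [StarRing D] [Algebra ℂ D] [StarModule ℂ D] (P : ∀ i, S i → D),
      (∀ i, IsPVM (P i)) → ∃ ρ : 𝒜 →⋆ₐ[ℂ] D, ∀ i s, ρ (e i s) = P i s

section Lifts

variable {σ : Signature} {G A : Type} [Fintype A] {𝔾 : RelStr σ G} {𝔸 : RelStr σ A}
  {D : Type} [Ring D] [StarRing D] [Algebra ℂ D] [StarModule ℂ D]

omit [Fintype A] [StarRing D] [StarModule ℂ D] in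
theorem lift_prodGen (f : G × A → D) {n : ℕ} (z : Fin n → G) (b : Fin n → A) :
    FreeStarAlg.lift f (prodGen freeP z b) = prodGen (fun x a => f (x, a)) z b := by
  simp only [prodGen, map_list_prod, List.map_ofFn, Function.comp_def, freeP, FreeStarAlg.lift_of]

omit [Fintype A] in
theorem map_prodGen {ℱ ℱ' : Type} [Ring ℱ] [Ring ℱ'] [Algebra ℂ ℱ] [Algebra ℂ ℱ'] [Star ℱ] [Star ℱ']
    (π : ℱ →⋆ₐ[ℂ] ℱ') (p : G → A → ℱ) {n : ℕ} (z : Fin n → G) (b : Fin n → A) :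
    π (prodGen p z b) = prodGen (fun x a => π (p x a)) z b := by
  simp only [prodGen, map_list_prod, List.map_ofFn, Function.comp_def]

theorem isPVM_morA (x : G) : IsPVM (MorA.p (A := A) x) :=
  IsPVM.of_rels (e := fun a => (x, a))
    (Set.subset_iUnion (fun x : G => pvmRels fun a : A => freeP x a) x)

theorem isPVM_morPlus (x : G) : IsPVM fun a : A => PresAlg.gen (plusRels 𝔾 𝔸) (x, a) :=
  IsPVM.of_rels (e := fun a => (x, a))
    ((Set.subset_iUnion (fun x : G => pvmRels fun a : A => freeP x a) x).trans
      Set.subset_union_left)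

theorem isPVM_morOPlus (x : G) : IsPVM fun a : A => PresAlg.gen (oPlusRels 𝔾 𝔸) (x, a) :=
  IsPVM.of_rels (e := fun a => (x, a))
    (((Set.subset_iUnion (fun x : G => pvmRels fun a : A => freeP x a) x).trans
      Set.subset_union_left).trans Set.subset_union_left)

theorem isPVM_morCV_p (x : G) : IsPVM (MorCV.p 𝔾 𝔸 x) :=
  IsPVM.of_rels (e := fun a => (Sum.inr (x, a) : CVGen 𝔾 𝔸))
    ((Set.subset_iUnion (fun x : G => pvmRels fun a : A =>
      FreeStarAlg.of (Sum.inr (x, a) : CVGen 𝔾 𝔸)) x).trans Set.subset_union_right)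

theorem isPVM_morCV_phi (c : Constraint 𝔾) : IsPVM (MorCV.phi 𝔾 𝔸 c) :=
  IsPVM.of_rels (e := fun b => (Sum.inl ⟨c, b⟩ : CVGen 𝔾 𝔸))
    ((Set.subset_iUnion (fun c : Constraint 𝔾 => pvmRels fun b : Sat 𝔸 c.1 =>
      FreeStarAlg.of (Sum.inl ⟨c, b⟩ : CVGen 𝔾 𝔸)) c).trans Set.subset_union_left)

theorem exists_lift_morA (p : G → A → D) (hp : ∀ x, IsPVM (p x)) :
    ∃ ρ : MorA G A →⋆ₐ[ℂ] D, ∀ x a, ρ (MorA.p x a) = p x a := by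
  refine ⟨PresAlg.lift (fun g => p g.1 g.2) (fun g => (hp g.1).sa g.2) ?_, fun x a =>
    PresAlg.lift_gen _ _ _ _⟩
  intro r hr
  obtain ⟨x, hx⟩ := Set.mem_iUnion.1 hr
  exact (hp x).lift_eq_zero (f := fun g : G × A => p g.1 g.2) (e := fun a => (x, a)) hx

theorem exists_lift_morPlus (p : G → A → D) (hp : ∀ x, IsPVM (p x))
    (h : ∀ R, ∀ z ∈ 𝔾.rel R, ∀ b, b ∉ 𝔸.rel R → prodGen p z b = 0) :
    ∃ ρ : MorPlus 𝔾 𝔸 →⋆ₐ[ℂ] D, ∀ x a, ρ (PresAlg.gen _ (x, a)) = p x a := by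
  refine ⟨PresAlg.lift (fun g => p g.1 g.2) (fun g => (hp g.1).sa g.2) ?_, fun x a =>
    PresAlg.lift_gen _ _ _ _⟩
  rintro r (hr | ⟨R, z, hz, b, hb, rfl⟩)
  · obtain ⟨x, hx⟩ := Set.mem_iUnion.1 hr
    exact (hp x).lift_eq_zero (f := fun g : G × A => p g.1 g.2) (e := fun a => (x, a)) hx
  · rw [lift_prodGen]; exact h R z hz b hb

theorem exists_lift_morOPlus (p : G → A → D) (hp : ∀ x, IsPVM (p x))
    (h : ∀ R, ∀ z ∈ 𝔾.rel R, ∀ b, b ∉ 𝔸.rel R → prodGen p z b = 0)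
    (hc : ∀ R, ∀ z ∈ 𝔾.rel R, ∀ i j b b', Commute (p (z i) b) (p (z j) b')) :
    ∃ ρ : MorOPlus 𝔾 𝔸 →⋆ₐ[ℂ] D, ∀ x a, ρ (PresAlg.gen _ (x, a)) = p x a := by
  refine ⟨PresAlg.lift (fun g => p g.1 g.2) (fun g => (hp g.1).sa g.2) ?_, fun x a =>
    PresAlg.lift_gen _ _ _ _⟩
  rintro r ((hr | ⟨R, z, hz, b, hb, rfl⟩) | ⟨R, z, hz, i, j, b, b', rfl⟩)
  · obtain ⟨x, hx⟩ := Set.mem_iUnion.1 hr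
    exact (hp x).lift_eq_zero (f := fun g : G × A => p g.1 g.2) (e := fun a => (x, a)) hx
  · rw [lift_prodGen]; exact h R z hz b hb
  · simp only [map_sub, map_mul, freeP, FreeStarAlg.lift_of]
    exact sub_eq_zero.2 (hc R z hz i j b b').eq

theorem exists_lift_morCV (Φ : ∀ c : Constraint 𝔾, Sat 𝔸 c.1 → D) (p : G → A → D)
    (hΦ : ∀ c, IsPVM (Φ c)) (hp : ∀ x, IsPVM (p x)) :
    ∃ ρ : MorCV 𝔾 𝔸 →⋆ₐ[ℂ] D, (∀ c b, ρ (MorCV.phi 𝔾 𝔸 c b) = Φ c b) ∧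
      ∀ x a, ρ (MorCV.p 𝔾 𝔸 x a) = p x a := by
  let f : CVGen 𝔾 𝔸 → D := Sum.elim (fun cb => Φ cb.1 cb.2) (fun g => p g.1 g.2)
  refine ⟨PresAlg.lift f ?_ ?_, fun c b => PresAlg.lift_gen _ _ _ _,
    fun x a => PresAlg.lift_gen _ _ _ _⟩
  · rintro (⟨c, b⟩ | ⟨x, a⟩)
    · exact (hΦ c).sa b
    · exact (hp x).sa a
  · rintro r (hr | hr)
    · obtain ⟨c, hc⟩ := Set.mem_iUnion.1 hr
      exact (hΦ c).lift_eq_zero (f := f) (e := fun b => Sum.inl ⟨c, b⟩) hc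
    · obtain ⟨x, hx⟩ := Set.mem_iUnion.1 hr
      exact (hp x).lift_eq_zero (f := f) (e := fun a => Sum.inr (x, a)) hx

theorem morPlus_prodGen (R : σ.Sym) {z : Fin (σ.ar R) → G} (hz : z ∈ 𝔾.rel R)
    {b : Fin (σ.ar R) → A} (hb : b ∉ 𝔸.rel R) :
    prodGen (fun x a => PresAlg.gen (plusRels 𝔾 𝔸) (x, a)) z b = 0 := by
  have h : prodGen freeP z b ∈ plusRels 𝔾 𝔸 := Or.inr ⟨R, z, hz, b, hb, rfl⟩
  have := PresAlg.mk_eq_zero h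
  simpa only [prodGen, map_list_prod, List.map_ofFn, Function.comp_def, freeP, PresAlg.mk_of]
    using this

theorem morOPlus_prodGen (R : σ.Sym) {z : Fin (σ.ar R) → G} (hz : z ∈ 𝔾.rel R)
    {b : Fin (σ.ar R) → A} (hb : b ∉ 𝔸.rel R) :
    prodGen (fun x a => PresAlg.gen (oPlusRels 𝔾 𝔸) (x, a)) z b = 0 := by
  have h : prodGen freeP z b ∈ oPlusRels 𝔾 𝔸 := Or.inl (Or.inr ⟨R, z, hz, b, hb, rfl⟩)
  have := PresAlg.mk_eq_zero h
  simpa only [prodGen, map_list_prod, List.map_ofFn, Function.comp_def, freeP, PresAlg.mk_of]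
    using this

theorem morOPlus_commute (R : σ.Sym) {z : Fin (σ.ar R) → G} (hz : z ∈ 𝔾.rel R) (i j) (b b' : A) :
    Commute (PresAlg.gen (oPlusRels 𝔾 𝔸) (z i, b)) (PresAlg.gen (oPlusRels 𝔾 𝔸) (z j, b')) := by
  have := PresAlg.mk_eq_zero (rels := oPlusRels 𝔾 𝔸) (Or.inr ⟨R, z, hz, i, j, b, b', rfl⟩)
  rw [commute_iff_eq]
  simpa only [map_sub, map_mul, freeP, PresAlg.mk_of, sub_eq_zero] using this

theorem isPVMAlgebra_morA [Finite G] : IsPVMAlgebra (MorA G A) := by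
  refine ⟨G, inferInstance, fun _ => A, fun _ => inferInstance, MorA.p, isPVM_morA, ?_, ?_⟩
  · rw [← PresAlg.adjoin_gen (assignRels G A)]
    congr 1
    ext a
    constructor
    · rintro ⟨i, s, rfl⟩; exact ⟨(i, s), rfl⟩
    · rintro ⟨⟨i, s⟩, rfl⟩; exact ⟨i, s, rfl⟩
  · intro D _ _ _ _ P hP
    exact exists_lift_morA P hP

theorem isPVMAlgebra_morCV [Fintype G] [Fintype σ.Sym] : IsPVMAlgebra (MorCV 𝔾 𝔸) := by
  refine ⟨Constraint 𝔾 ⊕ G, inferInstance, Sum.elim (fun c => Sat 𝔸 c.1) (fun _ => A),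
    fun i => match i with
      | Sum.inl c => (inferInstance : Fintype (Sat 𝔸 c.1))
      | Sum.inr _ => ‹Fintype A›,
    fun i => match i with
      | Sum.inl c => MorCV.phi 𝔾 𝔸 c
      | Sum.inr x => MorCV.p 𝔾 𝔸 x, ?_, ?_, ?_⟩
  · rintro (c | x)
    · exact (isPVM_morCV_phi c : IsPVM (MorCV.phi 𝔾 𝔸 c))
    · exact (isPVM_morCV_p x : IsPVM (MorCV.p 𝔾 𝔸 x))
  · rw [← PresAlg.adjoin_gen (cvRels 𝔾 𝔸)]
    congr 1
    ext a
    constructor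
    · rintro ⟨c | x, s, rfl⟩
      · exact ⟨Sum.inl ⟨c, s⟩, rfl⟩
      · exact ⟨Sum.inr (x, s), rfl⟩
    · rintro ⟨⟨c, s⟩ | ⟨x, s⟩, rfl⟩
      · exact ⟨Sum.inl c, s, rfl⟩
      · exact ⟨Sum.inr x, s, rfl⟩
  · intro D _ _ _ _ P hP
    obtain ⟨ρ, h1, h2⟩ := exists_lift_morCV (𝔾 := 𝔾) (𝔸 := 𝔸) (fun c => P (Sum.inl c))
      (fun x => P (Sum.inr x)) (fun c => hP (Sum.inl c)) (fun x => hP (Sum.inr x))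
    refine ⟨ρ, ?_⟩
    rintro (c | x) s
    · exact h1 c s
    · exact h2 x s

end Lifts

namespace IsPVMAlgebra

variable {𝒜 : Type} [Ring 𝒜] [StarRing 𝒜] [Algebra ℂ 𝒜]

/-- Every element of such an algebra is bounded uniformly over all representations. -/
theorem exists_bound (h : IsPVMAlgebra 𝒜) (a : 𝒜) :
    ∃ C : ℝ, 0 ≤ C ∧ ∀ (B : Type) [CStarAlgebra B] (π : 𝒜 →⋆ₐ[ℂ] B), ‖π a‖ ≤ C := by
  obtain ⟨ι, _, S, _, e, he, hadj, -⟩ := h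
  have ha : a ∈ Algebra.adjoin ℂ {a | ∃ i s, a = e i s} := hadj ▸ Algebra.mem_top
  induction ha using Algebra.adjoin_induction with
  | mem x hx =>
    obtain ⟨i, s, rfl⟩ := hx
    exact ⟨1, zero_le_one, fun B _ π => ((he i).map π).norm_le_one s⟩
  | algebraMap r =>
    refine ⟨‖r‖, norm_nonneg _, fun B _ π => ?_⟩
    rw [AlgHomClass.commutes]
    refine (norm_algebraMap _ _).le.trans ?_
    by_cases hn : Nontrivial B
    · simp
    · have : (1 : B) = 0 := by
        rw [not_nontrivial_iff_subsingleton] at hn; exact Subsingleton.elim _ _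
      rw [this]; simp
  | add x y _ _ hx hy =>
    obtain ⟨C, hC, hx⟩ := hx
    obtain ⟨C', hC', hy⟩ := hy
    refine ⟨C + C', by positivity, fun B _ π => ?_⟩
    rw [map_add]
    exact (norm_add_le _ _).trans (add_le_add (hx B π) (hy B π))
  | mul x y _ _ hx hy =>
    obtain ⟨C, hC, hx⟩ := hx
    obtain ⟨C', hC', hy⟩ := hy
    refine ⟨C * C', by positivity, fun B _ π => ?_⟩
    rw [map_mul]
    exact (norm_mul_le _ _).trans (mul_le_mul (hx B π) (hy B π) (norm_nonneg _) hC)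

/-- Such an algebra is spanned by a sequence. -/
theorem exists_seq_span (h : IsPVMAlgebra 𝒜) :
    ∃ w : ℕ → 𝒜, Submodule.span ℂ (Set.range w) = ⊤ := by
  obtain ⟨ι, _, S, _, e, he, hadj, -⟩ := h
  let g : (Σ i, S i) → 𝒜 := fun x => e x.1 x.2
  have : Countable (Σ i, S i) := inferInstance
  have : Countable (List (Σ i, S i)) := inferInstance
  obtain ⟨f, hf⟩ := exists_surjective_nat (List (Σ i, S i))
  refine ⟨fun n => ((f n).map g).prod, ?_⟩
  rw [eq_top_iff, ← Algebra.top_toSubmodule, ← hadj, Algebra.adjoin_eq_span]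
  refine Submodule.span_mono ?_
  intro x hx
  obtain ⟨l, hl, rfl⟩ := Submonoid.exists_list_of_mem_closure hx
  have : ∃ l' : List (Σ i, S i), l'.map g = l := by
    clear hx
    induction l with
    | nil => exact ⟨[], rfl⟩
    | cons a l ih =>
      obtain ⟨l', hl'⟩ := ih fun y hy => hl y (List.mem_cons_of_mem a hy)
      obtain ⟨i, s, ha⟩ := hl a List.mem_cons_self
      exact ⟨⟨i, s⟩ :: l', by simp [g, hl', ha]⟩
  obtain ⟨l', rfl⟩ := this
  obtain ⟨n, rfl⟩ := hf l'
  exact ⟨n, rfl⟩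

end IsPVMAlgebra

/-! ### Tracial seminorms -/

namespace TracialState

section General

variable {𝒜 B : Type} [Ring 𝒜] [StarRing 𝒜] [Algebra ℂ 𝒜] [Ring B] [StarRing B] [Algebra ℂ B]

/-- The pullback of a tracial state along a `*`-homomorphism. -/
def comp (φ : TracialState B) (π : 𝒜 →⋆ₐ[ℂ] B) : TracialState 𝒜 where
  toLin := φ.toLin ∘ₗ π.toAlgHom.toLinearMap
  map_one := by
    change φ.toLin (π 1) = 1
    rw [_root_.map_one π, φ.map_one]
  nonneg a := by
    change 0 ≤ φ.toLin (π (star a * a))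
    rw [map_mul, map_star]; exact φ.nonneg _
  tracial a b := by
    change φ.toLin (π (a * b)) = φ.toLin (π (b * a))
    rw [map_mul π, map_mul π]; exact φ.tracial _ _

theorem comp_apply (φ : TracialState B) (π : 𝒜 →⋆ₐ[ℂ] B) (a : 𝒜) :
    (φ.comp π).toLin a = φ.toLin (π a) := rfl

theorem normSq_of_eq {τ : TracialState 𝒜} {φ : TracialState B} {π : 𝒜 →⋆ₐ[ℂ] B}
    (h : ∀ a, τ.toLin a = φ.toLin (π a)) (a : 𝒜) : τ.normSq a = φ.normSq (π a) := by
  rw [normSq, normSq, h, map_mul, map_star]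

theorem normSq_nonneg (τ : TracialState 𝒜) (a : 𝒜) : 0 ≤ τ.normSq a :=
  (Complex.nonneg_iff.1 (τ.nonneg a)).1

theorem toLin_star_mul_self (τ : TracialState 𝒜) (a : 𝒜) :
    τ.toLin (star a * a) = (τ.normSq a : ℂ) := by
  apply Complex.ext
  · rfl
  · exact (Complex.nonneg_iff.1 (τ.nonneg a)).2.symm

theorem normSq_star (τ : TracialState 𝒜) (a : 𝒜) : τ.normSq (star a) = τ.normSq a := by
  rw [normSq, normSq, star_star, τ.tracial]

theorem normSq_zero (τ : TracialState 𝒜) : τ.normSq 0 = 0 := by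
  simp [normSq]

end General

section CStar

variable {B : Type} [CStarAlgebra B] (φ : TracialState B)

/-- A tracial state as a positive functional. -/
def func : BddPosFunctional B := BddPosFunctional.ofCStar φ.toLin φ.nonneg

/-- The vector of the GNS space given by an element of the algebra. -/
def vec : B →ₗ[ℂ] φ.func.GNS where
  toFun b := φ.func.gns b φ.func.gnsVec
  map_add' a b := by rw [map_add, add_apply]
  map_smul' c a := by rw [map_smul, smul_apply]; rfl

theorem normSq_eq (b : B) : φ.normSq b = ‖φ.vec b‖ ^ 2 := by
  have h := φ.func.inner_gns_vec b b
  have h2 : φ.toLin (star b * b) = ((‖φ.vec b‖ ^ 2 : ℝ) : ℂ) := by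
    rw [← show _ = φ.toLin (star b * b) from h, inner_self_eq_norm_sq_to_K]
    simp [vec]
  rw [normSq, h2, Complex.ofReal_re]

theorem vec_mul (a b : B) : φ.vec (a * b) = φ.func.gns a (φ.vec b) := by
  change φ.func.gns (a * b) _ = _
  rw [map_mul]; rfl

theorem norm_vec_mul_le (a b : B) : ‖φ.vec (a * b)‖ ≤ ‖a‖ * ‖φ.vec b‖ := by
  rw [vec_mul]
  refine ((φ.func.gns a).le_opNorm _).trans ?_
  gcongr
  exact NonUnitalStarAlgHom.norm_apply_le φ.func.gns a

theorem normSq_mul_le {a : B} (ha : ‖a‖ ≤ 1) (b : B) : φ.normSq (a * b) ≤ φ.normSq b := by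
  rw [normSq_eq, normSq_eq]
  have := (φ.norm_vec_mul_le a b).trans (mul_le_of_le_one_left (norm_nonneg _) ha)
  gcongr

theorem normSq_sum_le {ι : Type} (s : Finset ι) (f : ι → B) :
    φ.normSq (∑ i ∈ s, f i) ≤ s.card * ∑ i ∈ s, φ.normSq (f i) := by
  simp only [normSq_eq, map_sum]
  calc ‖∑ i ∈ s, φ.vec (f i)‖ ^ 2 ≤ (∑ i ∈ s, ‖φ.vec (f i)‖) ^ 2 := by
        gcongr; exact norm_sum_le _ _
    _ ≤ _ := sq_sum_le_card_mul_sum_sq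

end CStar

end TracialState

/-- A tracial state is faithful if it vanishes on no nonzero positive element. -/
def TracialState.Faithful {B : Type} [CStarAlgebra B] (φ : TracialState B) : Prop :=
  ∀ b, φ.toLin (star b * b) = 0 → b = 0

theorem TracialState.Faithful.eq_zero {B : Type} [CStarAlgebra B] {φ : TracialState B}
    (h : φ.Faithful) {b : B} (hb : φ.normSq b = 0) : b = 0 :=
  h b (by rw [φ.toLin_star_mul_self, hb, Complex.ofReal_zero])

/-! ### Quantum homomorphisms -/

section PVM

variable {D S T : Type} [Ring D] [StarRing D] [Fintype S] [Fintype T]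

theorem IsPVM.reindex {p : S → D} (h : IsPVM p) (e : T ≃ S) : IsPVM fun t => p (e t) where
  sa t := h.sa _
  idem t := h.idem _
  orth s t hst := h.orth _ _ (e.injective.ne hst)
  sum := by rw [Equiv.sum_comp e p, h.sum]

theorem IsPVM.mul {p : S → D} {q : T → D} (hp : IsPVM p) (hq : IsPVM q)
    (h : ∀ s t, Commute (p s) (q t)) : IsPVM fun x : S × T => p x.1 * q x.2 where
  sa x := by
    rw [isSelfAdjoint_iff, star_mul, (hp.sa _).star_eq, (hq.sa _).star_eq, (h _ _).eq]
  idem x := by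
    rw [mul_assoc, ← mul_assoc (q _), ← (h _ _).eq, mul_assoc, hq.idem, ← mul_assoc, hp.idem]
  orth x y hxy := by
    rw [mul_assoc, ← mul_assoc (q _), ← (h _ _).eq]
    by_cases h1 : x.1 = y.1
    · have h2 : x.2 ≠ y.2 := fun h2 => hxy (Prod.ext h1 h2)
      rw [mul_assoc, hq.orth _ _ h2, mul_zero, mul_zero]
    · rw [mul_assoc, ← mul_assoc, hp.orth _ _ h1, zero_mul]
  sum := by
    rw [Fintype.sum_prod_type]
    simp only [← Finset.mul_sum, hq.sum, mul_one, hp.sum]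

theorem IsPVM.commute {p : S → D} (h : IsPVM p) (s t : S) : Commute (p s) (p t) := by
  by_cases hst : s = t
  · rw [hst]
  · rw [commute_iff_eq, h.orth s t hst, h.orth t s (Ne.symm hst)]

theorem IsPVM.subtype {p : S → D} (h : IsPVM p) (P : S → Prop) [Fintype {s // P s}]
    (hP : ∀ s, ¬ P s → p s = 0) : IsPVM fun s : {s // P s} => p s.1 where
  sa s := h.sa _
  idem s := h.idem _
  orth s t hst := h.orth _ _ (Subtype.val_injective.ne hst)
  sum := by
    classical
    rw [← h.sum, ← Finset.sum_filter_of_ne (p := P)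
      (fun s _ hs => by_contra fun hn => hs (hP s hn))]
    exact (Finset.sum_subtype _ (by simp) p).symm

/-- The joint measurement of finitely many commuting projection-valued measures. -/
theorem IsPVM.list_prod {n : ℕ} {q : Fin n → S → D} (h : ∀ i, IsPVM (q i))
    (hc : ∀ i j s t, Commute (q i s) (q j t)) :
    IsPVM fun b : Fin n → S => (List.ofFn fun i => q i (b i)).prod := by
  induction n with
  | zero =>
    refine ⟨fun s => ?_, fun s => ?_, fun s t hst => (hst (Subsingleton.elim _ _)).elim, ?_⟩
    · simp
    · simp
    · simp
  | succ n ih =>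
    have h2 := (h 0).mul (ih (fun i => h i.succ) (fun i j => hc i.succ j.succ)) (by
      intro s t
      refine Commute.list_prod_right _ _ fun x hx => ?_
      obtain ⟨i, rfl⟩ := (List.mem_ofFn' _ _).1 hx
      exact hc _ _ _ _)
    have h3 := h2.reindex (Fin.consEquiv fun _ => S).symm
    have e : (fun b : Fin (n + 1) → S => (List.ofFn fun i => q i (b i)).prod) = fun b =>
        q 0 ((Fin.consEquiv fun _ => S).symm b).1 *
          (List.ofFn fun i => q i.succ (((Fin.consEquiv fun _ => S).symm b).2 i)).prod := by
      funext b
      rw [List.ofFn_succ, List.prod_cons]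
      rfl
    rw [e]
    exact h3

theorem list_prod_mul_eq {n : ℕ} {q : Fin n → S → D} (h : ∀ i, IsPVM (q i))
    (hc : ∀ i j s t, Commute (q i s) (q j t)) (b : Fin n → S) (i : Fin n) :
    (List.ofFn fun i => q i (b i)).prod * q i (b i) = (List.ofFn fun i => q i (b i)).prod := by
  induction n with
  | zero => exact i.elim0
  | succ n ih =>
    rw [List.ofFn_succ, List.prod_cons]
    refine Fin.cases ?_ (fun j => ?_) i
    · have : Commute (List.ofFn fun i : Fin n => q i.succ (b i.succ)).prod (q 0 (b 0)) := by
        refine Commute.list_prod_left _ _ fun x hx => ?_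
        obtain ⟨i, rfl⟩ := (List.mem_ofFn' _ _).1 hx
        exact hc _ _ _ _
      rw [mul_assoc, this.eq, ← mul_assoc, (h 0).idem]
    · rw [mul_assoc, ih (fun i => h i.succ) (fun i j => hc i.succ j.succ) (fun i => b i.succ) j]

open Classical in
omit [StarRing D] [Fintype S] in
theorem list_prod_mul_ite {n : ℕ} {q : Fin n → S → D} {X : D} {c : Fin n → S}
    (h : ∀ i a, q i a * X = if a = c i then X else 0) (b : Fin n → S) :
    (List.ofFn fun i => q i (b i)).prod * X = if b = c then X else 0 := by
  induction n with
  | zero => simp [Subsingleton.elim b c]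
  | succ n ih =>
    rw [List.ofFn_succ, List.prod_cons, mul_assoc,
      ih (c := fun i => c i.succ) (fun i => h i.succ) (fun i => b i.succ)]
    by_cases h0 : b 0 = c 0
    · by_cases h1 : (fun i : Fin n => b i.succ) = fun i => c i.succ
      · have : b = c := by
          funext i
          refine Fin.cases h0 (fun j => congrFun h1 j) i
        rw [if_pos h1, if_pos this, h, if_pos h0]
      · have : b ≠ c := fun e => h1 (by rw [e])
        rw [if_neg h1, if_neg this, mul_zero]
    · have : b ≠ c := fun e => h0 (by rw [e])
      rw [if_neg this]
      split_ifs
      · rw [h, if_neg h0]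
      · rw [mul_zero]

end PVM

section Hom

variable {σ : Signature} {G H A D : Type} [Ring D] [StarRing D]

/-- A quantum homomorphism `G → H` with values in `D`: a representation of `Mor⁺(G, H)`, given by
the images of the generators. -/
structure IsPlusHom [Fintype H] (𝔾 : RelStr σ G) (ℍ : RelStr σ H) (q : G → H → D) : Prop where
  pvm : ∀ x, IsPVM (q x)
  rel : ∀ R, ∀ z ∈ 𝔾.rel R, ∀ b, b ∉ ℍ.rel R → prodGen q z b = 0

/-- An oracular quantum homomorphism: a representation of `Mor°⁺(G, H)`. -/
structure IsOPlusHom [Fintype H] (𝔾 : RelStr σ G) (ℍ : RelStr σ H) (q : G → H → D) : Prop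
    extends IsPlusHom 𝔾 ℍ q where
  comm : ∀ R, ∀ z ∈ 𝔾.rel R, ∀ i j b b', Commute (q (z i) b) (q (z j) b')

/-- An oracular quantum homomorphism with its joint measurements: `Φ c` measures the values of all
variables of the constraint `c` at once. -/
structure IsJointHom [Fintype H] (𝔾 : RelStr σ G) (ℍ : RelStr σ H)
    (Φ : ∀ c : Constraint 𝔾, Sat ℍ c.1 → D) (q : G → H → D) : Prop where
  pvm : ∀ x, IsPVM (q x)
  joint : ∀ c, IsPVM (Φ c)
  consistent : ∀ c b i, Φ c b * (1 - q (c.2.1 i) (b.1 i)) = 0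

variable [Fintype H] {𝔾 : RelStr σ G} {ℍ : RelStr σ H}

theorem IsOPlusHom.joint {q : G → H → D} (h : IsOPlusHom 𝔾 ℍ q) :
    IsJointHom 𝔾 ℍ (fun c b => prodGen q c.2.1 b.1) q := by
  refine ⟨h.pvm, fun c => ?_, fun c b i => ?_⟩
  · have h1 := IsPVM.list_prod (q := fun i => q (c.2.1 i)) (fun i => h.pvm _)
      (fun i j => h.comm c.1 _ c.2.2 i j)
    exact h1.subtype _ fun b hb => h.rel c.1 _ c.2.2 b hb
  · have h1 := list_prod_mul_eq (q := fun i => q (c.2.1 i)) (fun i => h.pvm _)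
      (fun i j => h.comm c.1 _ c.2.2 i j) b.1 i
    rw [mul_sub, mul_one, sub_eq_zero]
    exact h1.symm

open Classical in
theorem IsJointHom.mul_phi {Φ : ∀ c : Constraint 𝔾, Sat ℍ c.1 → D} {q : G → H → D}
    (h : IsJointHom 𝔾 ℍ Φ q) (c : Constraint 𝔾) (b : Sat ℍ c.1) (i) (a : H) :
    q (c.2.1 i) a * Φ c b = if a = b.1 i then Φ c b else 0 := by
  have h1 : q (c.2.1 i) (b.1 i) * Φ c b = Φ c b := by
    have := congrArg star (h.consistent c b i)
    rw [star_mul, star_sub, star_one, star_zero, ((h.pvm _).sa _).star_eq,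
      ((h.joint _).sa _).star_eq, sub_mul, one_mul, sub_eq_zero] at this
    exact this.symm
  split_ifs with hab
  · rw [hab, h1]
  · rw [← h1, ← mul_assoc, (h.pvm _).orth _ _ hab, zero_mul]

theorem IsJointHom.isOPlusHom {Φ : ∀ c : Constraint 𝔾, Sat ℍ c.1 → D} {q : G → H → D}
    (h : IsJointHom 𝔾 ℍ Φ q) : IsOPlusHom 𝔾 ℍ q := by
  classical
  refine ⟨⟨h.pvm, fun R z hz b hb => ?_⟩, fun R z hz i j b b' => ?_⟩
  · let c : Constraint 𝔾 := ⟨R, z, hz⟩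
    rw [← mul_one (prodGen q z b), ← (h.joint c).sum, Finset.mul_sum]
    refine Finset.sum_eq_zero fun s _ => ?_
    have := list_prod_mul_ite (q := fun i => q (z i)) (X := Φ c s) (c := s.1)
      (fun i a => h.mul_phi c s i a) b
    refine this.trans (if_neg ?_)
    rintro rfl
    exact hb s.2
  · let c : Constraint 𝔾 := ⟨R, z, hz⟩
    have e : ∀ i b, q (z i) b = ∑ s : Sat ℍ R, if b = s.1 i then Φ c s else 0 := by
      intro i b
      rw [← mul_one (q (z i) b), ← (h.joint c).sum, Finset.mul_sum]
      exact Finset.sum_congr rfl fun s _ => h.mul_phi c s i b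
    rw [e i, e j]
    refine Commute.sum_left _ _ _ fun s _ => Commute.sum_right _ _ _ fun t _ => ?_
    split_ifs
    · exact (h.joint c).commute s t
    · exact Commute.zero_right _
    · exact Commute.zero_left _
    · exact Commute.zero_left _

end Hom

/-! ### Gadgets in terms of quantum homomorphisms -/

section Gadget

variable {σ : Signature} {G A : Type} [Fintype A] {Q : Model} {𝔸 : RelStr σ A} {𝔾 : RelStr σ G}
  {x y : G}

theorem isGadget_iff : IsGadget Q 𝔸 𝔾 x y ↔
    (∀ a b : A, ∃ (B : Type) (_ : CStarAlgebra B) (p : G → A → B), Q.mem B ∧ IsPlusHom 𝔾 𝔸 p ∧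
      p x a = 1 ∧ p y b = 1) ∧
    ∀ (B : Type) [CStarAlgebra B], Q.mem B → ∀ p : G → A → B, IsPlusHom 𝔾 𝔸 p →
      ∀ a b, Commute (p x a) (p y b) := by
  have hom : ∀ (B : Type) [CStarAlgebra B] (π : MorPlus 𝔾 𝔸 →⋆ₐ[ℂ] B),
      IsPlusHom 𝔾 𝔸 fun x a => π (PresAlg.gen _ (x, a)) := fun B _ π =>
    ⟨fun x => (isPVM_morPlus x).map π, fun R z hz b hb => by
      have := map_prodGen π (fun x a => PresAlg.gen (plusRels 𝔾 𝔸) (x, a)) z b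
      rw [morPlus_prodGen R hz hb, map_zero] at this
      exact this.symm⟩
  constructor
  · rintro ⟨h1, h2⟩
    refine ⟨fun a b => ?_, fun B _ hB p hp a b => ?_⟩
    · obtain ⟨B, _, π, hB, ha, hb⟩ := h1 a b
      exact ⟨B, _, _, hB, hom B π, ha, hb⟩
    · obtain ⟨ρ, hρ⟩ := exists_lift_morPlus p hp.pvm hp.rel
      simpa only [hρ] using h2 B ρ hB a b
  · rintro ⟨h1, h2⟩
    refine ⟨fun a b => ?_, fun B _ π hB => h2 B hB _ (hom B π)⟩
    obtain ⟨B, _, p, hB, hp, ha, hb⟩ := h1 a b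
    obtain ⟨ρ, hρ⟩ := exists_lift_morPlus p hp.pvm hp.rel
    exact ⟨B, _, ρ, hB, by rw [hρ, ha], by rw [hρ, hb]⟩

theorem isOracularGadget_iff : IsOracularGadget Q 𝔸 𝔾 x y ↔
    (∀ a b : A, ∃ (B : Type) (_ : CStarAlgebra B) (p : G → A → B), Q.mem B ∧ IsOPlusHom 𝔾 𝔸 p ∧
      p x a = 1 ∧ p y b = 1) ∧
    ∀ (B : Type) [CStarAlgebra B], Q.mem B → ∀ p : G → A → B, IsOPlusHom 𝔾 𝔸 p →
      ∀ a b, Commute (p x a) (p y b) := by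
  have hom : ∀ (B : Type) [CStarAlgebra B] (π : MorOPlus 𝔾 𝔸 →⋆ₐ[ℂ] B),
      IsOPlusHom 𝔾 𝔸 fun x a => π (PresAlg.gen _ (x, a)) := fun B _ π =>
    ⟨⟨fun x => (isPVM_morOPlus x).map π, fun R z hz b hb => by
      have := map_prodGen π (fun x a => PresAlg.gen (oPlusRels 𝔾 𝔸) (x, a)) z b
      rw [morOPlus_prodGen R hz hb, map_zero] at this
      exact this.symm⟩, fun R z hz i j b b' => (morOPlus_commute R hz i j b b').map π⟩
  constructor
  · rintro ⟨h1, h2⟩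
    refine ⟨fun a b => ?_, fun B _ hB p hp a b => ?_⟩
    · obtain ⟨B, _, π, hB, ha, hb⟩ := h1 a b
      exact ⟨B, _, _, hB, hom B π, ha, hb⟩
    · obtain ⟨ρ, hρ⟩ := exists_lift_morOPlus p hp.pvm hp.rel hp.comm
      simpa only [hρ] using h2 B ρ hB a b
  · rintro ⟨h1, h2⟩
    refine ⟨fun a b => ?_, fun B _ π hB => h2 B hB _ (hom B π)⟩
    obtain ⟨B, _, p, hB, hp, ha, hb⟩ := h1 a b
    obtain ⟨ρ, hρ⟩ := exists_lift_morOPlus p hp.pvm hp.rel hp.comm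
    exact ⟨B, _, ρ, hB, by rw [hρ, ha], by rw [hρ, hb]⟩

/-- The commutator defect `∑ ‖[pₐ, q_b]‖²` of two families. -/
def commSq {𝒜 : Type} [Ring 𝒜] [StarRing 𝒜] [Algebra ℂ 𝒜] (φ : TracialState 𝒜) (p q : A → 𝒜) : ℝ :=
  ∑ a, ∑ b, φ.normSq (p a * q b - q b * p a)

theorem commSq_nonneg {𝒜 : Type} [Ring 𝒜] [StarRing 𝒜] [Algebra ℂ 𝒜] (φ : TracialState 𝒜)
    (p q : A → 𝒜) : 0 ≤ commSq φ p q :=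
  Finset.sum_nonneg fun _ _ => Finset.sum_nonneg fun _ _ => φ.normSq_nonneg _

variable [Fintype σ.Sym] [Fintype G]

/-- The total violation of the constraints, without normalisation. -/
def violA {𝒜 : Type} [Ring 𝒜] [StarRing 𝒜] [Algebra ℂ 𝒜] (𝔾 : RelStr σ G) (𝔸 : RelStr σ A)
    (φ : TracialState 𝒜) (p : G → A → 𝒜) : ℝ :=
  ∑ c : Constraint 𝔾, ∑ b : Unsat 𝔸 c.1, φ.normSq (prodGen p c.2.1 b.1)

/-- The total inconsistency of constraint and variable measurements, without normalisation. -/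
def violCV {𝒜 : Type} [Ring 𝒜] [StarRing 𝒜] [Algebra ℂ 𝒜] (𝔾 : RelStr σ G) (𝔸 : RelStr σ A)
    (φ : TracialState 𝒜) (Φ : ∀ c : Constraint 𝔾, Sat 𝔸 c.1 → 𝒜) (p : G → A → 𝒜) : ℝ :=
  ∑ c : Constraint 𝔾, ∑ b : Sat 𝔸 c.1, ∑ i : Fin (σ.ar c.1),
    φ.normSq (Φ c b * (1 - p (c.2.1 i) (b.1 i)))

theorem violA_nonneg {𝒜 : Type} [Ring 𝒜] [StarRing 𝒜] [Algebra ℂ 𝒜] (φ : TracialState 𝒜)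
    (p : G → A → 𝒜) : 0 ≤ violA 𝔾 𝔸 φ p :=
  Finset.sum_nonneg fun _ _ => Finset.sum_nonneg fun _ _ => φ.normSq_nonneg _

theorem violCV_nonneg {𝒜 : Type} [Ring 𝒜] [StarRing 𝒜] [Algebra ℂ 𝒜] (φ : TracialState 𝒜)
    (Φ : ∀ c : Constraint 𝔾, Sat 𝔸 c.1 → 𝒜) (p : G → A → 𝒜) : 0 ≤ violCV 𝔾 𝔸 φ Φ p :=
  Finset.sum_nonneg fun _ _ => Finset.sum_nonneg fun _ _ => Finset.sum_nonneg fun _ _ =>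
    φ.normSq_nonneg _

theorem TracialState.defect_sum_single {𝒜 ι : Type} [Ring 𝒜] [StarRing 𝒜] [Algebra ℂ 𝒜]
    (τ : TracialState 𝒜) (s : Finset ι) (μ : ι → 𝒜 →₀ ℝ≥0) :
    τ.defect (∑ i ∈ s, μ i) = ∑ i ∈ s, τ.defect (μ i) :=
  (Finsupp.sum_finsetSum_index (by simp) (by intro a b c; push_cast; ring)).symm

theorem TracialState.defect_single {𝒜 : Type} [Ring 𝒜] [StarRing 𝒜] [Algebra ℂ 𝒜]
    (τ : TracialState 𝒜) (a : 𝒜) (w : ℝ≥0) :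
    τ.defect (Finsupp.single a w) = w * τ.normSq a := by
  rw [TracialState.defect, Finsupp.sum_single_index (by simp)]

theorem defect_weightA (τ : TracialState (MorA G A)) :
    τ.defect (weightA 𝔾 𝔸) = (Fintype.card (Constraint 𝔾) : ℝ)⁻¹ * violA 𝔾 𝔸 τ MorA.p := by
  simp only [weightA, violA, TracialState.defect_sum_single, TracialState.defect_single,
    Finset.mul_sum]
  push_cast
  rfl

theorem defect_weightCV (τ : TracialState (MorCV 𝔾 𝔸)) :
    τ.defect (weightCV 𝔾 𝔸) = ∑ c : Constraint 𝔾, ∑ b : Sat 𝔸 c.1, ∑ i : Fin (σ.ar c.1),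
      ((Fintype.card (Constraint 𝔾) : ℝ)⁻¹ / (σ.ar c.1 : ℝ)) *
        τ.normSq (MorCV.phi 𝔾 𝔸 c b * (1 - MorCV.p 𝔾 𝔸 (c.2.1 i) (b.1 i))) := by
  simp only [weightCV, TracialState.defect_sum_single, TracialState.defect_single]
  push_cast
  rfl

/-- The robustness estimate of an `a`-robust gadget, in terms of families of PVMs in the algebras of
the model. -/
def ARobustBound (Q : Model) (𝔸 : RelStr σ A) (𝔾 : RelStr σ G) (x y : G) : Prop :=
  ∀ ε : ℝ, 0 < ε → ∃ δ : ℝ, 0 < δ ∧ ∀ (B : Type) [CStarAlgebra B], Q.mem B →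
    ∀ φ : TracialState B, Q.trace B φ → ∀ p : G → A → B, (∀ x, IsPVM (p x)) →
      violA 𝔾 𝔸 φ p < δ → commSq φ (p x) (p y) < ε

/-- The robustness estimate of a `c`-`v`-robust gadget, in terms of families of PVMs in the algebras
of the model. -/
def CVRobustBound (Q : Model) (𝔸 : RelStr σ A) (𝔾 : RelStr σ G) (x y : G) : Prop :=
  ∀ ε : ℝ, 0 < ε → ∃ δ : ℝ, 0 < δ ∧ ∀ (B : Type) [CStarAlgebra B], Q.mem B →
    ∀ φ : TracialState B, Q.trace B φ → ∀ (Φ : ∀ c : Constraint 𝔾, Sat 𝔸 c.1 → B) (p : G → A → B),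
      (∀ c, IsPVM (Φ c)) → (∀ x, IsPVM (p x)) →
      violCV 𝔾 𝔸 φ Φ p < δ → commSq φ (p x) (p y) < ε

section Transfer

variable {𝒜 B : Type} [Ring 𝒜] [StarRing 𝒜] [Algebra ℂ 𝒜] [Ring B] [StarRing B] [Algebra ℂ B]
  {τ : TracialState 𝒜} {φ : TracialState B} {π : 𝒜 →⋆ₐ[ℂ] B}

theorem commSq_of_eq (h : ∀ a, τ.toLin a = φ.toLin (π a)) (p q : A → 𝒜) :
    commSq τ p q = commSq φ (fun a => π (p a)) (fun a => π (q a)) := by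
  simp only [commSq, TracialState.normSq_of_eq h, map_sub, map_mul]

theorem violA_of_eq (h : ∀ a, τ.toLin a = φ.toLin (π a)) (p : G → A → 𝒜) :
    violA 𝔾 𝔸 τ p = violA 𝔾 𝔸 φ (fun x a => π (p x a)) := by
  simp only [violA, TracialState.normSq_of_eq h, map_prodGen]

theorem violCV_of_eq (h : ∀ a, τ.toLin a = φ.toLin (π a))
    (Φ : ∀ c : Constraint 𝔾, Sat 𝔸 c.1 → 𝒜) (p : G → A → 𝒜) :
    violCV 𝔾 𝔸 τ Φ p = violCV 𝔾 𝔸 φ (fun c b => π (Φ c b)) (fun x a => π (p x a)) := by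
  simp only [violCV, TracialState.normSq_of_eq h, map_mul, map_sub, map_one]

end Transfer

theorem isARobustGadget_iff :
    IsARobustGadget Q 𝔸 𝔾 x y ↔ IsGadget Q 𝔸 𝔾 x y ∧ ARobustBound Q 𝔸 𝔾 x y := by
  have hm : (Fintype.card (Constraint 𝔾) : ℝ)⁻¹ ≤ 1 := by
    rcases Nat.eq_zero_or_pos (Fintype.card (Constraint 𝔾)) with h | h
    · rw [h]; simp
    · exact inv_le_one_of_one_le₀ (by exact_mod_cast h)
  constructor
  · rintro ⟨h1, h2⟩
    refine ⟨h1, fun ε hε => ?_⟩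
    obtain ⟨δ, hδ, h⟩ := h2 ε hε
    refine ⟨δ, hδ, fun B _ hB φ hφ p hp hv => ?_⟩
    obtain ⟨ρ, hρ⟩ := exists_lift_morA p hp
    have hτ : ∀ a, (φ.comp ρ).toLin a = φ.toLin (ρ a) := fun a => rfl
    have h3 := h (φ.comp ρ) ⟨B, _, ρ, φ, hB, hφ, hτ⟩ (by
      rw [defect_weightA, violA_of_eq hτ]
      simp only [hρ]
      exact (mul_le_of_le_one_left (violA_nonneg _ _) hm).trans_lt hv)
    have h4 := commSq_of_eq hτ (MorA.p (A := A) x) (MorA.p y)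
    simp only [hρ] at h4
    rw [← h4]
    exact h3
  · rintro ⟨h1, h2⟩
    refine ⟨h1, fun ε hε => ?_⟩
    obtain ⟨δ, hδ, h⟩ := h2 ε hε
    refine ⟨δ / (Fintype.card (Constraint 𝔾) + 1), by positivity, fun τ hτ hd => ?_⟩
    obtain ⟨B, _, π, φ, hB, hφ, hτ⟩ := hτ
    have h3 := h B hB φ hφ (fun x a => π (MorA.p x a)) (fun x => (isPVM_morA x).map π) (by
      rw [← violA_of_eq hτ]
      rw [defect_weightA] at hd
      rcases Nat.eq_zero_or_pos (Fintype.card (Constraint 𝔾)) with h | h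
      · have : IsEmpty (Constraint 𝔾) := Fintype.card_eq_zero_iff.1 h
        rw [violA, Finset.univ_eq_empty, Finset.sum_empty]
        exact hδ
      · have h' : (0 : ℝ) < Fintype.card (Constraint 𝔾) := by exact_mod_cast h
        rw [inv_mul_lt_iff₀ h', mul_div_assoc', lt_div_iff₀ (by positivity)] at hd
        have h0 := violA_nonneg (𝔾 := 𝔾) (𝔸 := 𝔸) τ MorA.p
        nlinarith)
    rw [← commSq_of_eq hτ] at h3
    exact h3

theorem isCVRobustGadget_iff :
    IsCVRobustGadget Q 𝔸 𝔾 x y ↔ IsOracularGadget Q 𝔸 𝔾 x y ∧ CVRobustBound Q 𝔸 𝔾 x y := by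
  constructor
  · rintro ⟨h1, h2⟩
    refine ⟨h1, fun ε hε => ?_⟩
    obtain ⟨δ, hδ, h⟩ := h2 ε hε
    refine ⟨δ, hδ, fun B _ hB φ hφ Φ p hΦ hp hv => ?_⟩
    obtain ⟨ρ, hρ, hρ'⟩ := exists_lift_morCV (𝔸 := 𝔸) Φ p hΦ hp
    have hτ : ∀ a, (φ.comp ρ).toLin a = φ.toLin (ρ a) := fun a => rfl
    have h3 := h (φ.comp ρ) ⟨B, _, ρ, φ, hB, hφ, hτ⟩ (by
      refine lt_of_le_of_lt ?_ hv
      have e := violCV_of_eq hτ (MorCV.phi 𝔾 𝔸) (MorCV.p 𝔾 𝔸)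
      simp only [hρ, hρ'] at e
      rw [defect_weightCV, ← e, violCV]
      refine Finset.sum_le_sum fun c _ => Finset.sum_le_sum fun b _ =>
        Finset.sum_le_sum fun i _ => ?_
      refine mul_le_of_le_one_left (TracialState.normSq_nonneg _ _) ?_
      have hm : (1 : ℝ) ≤ Fintype.card (Constraint 𝔾) := by
        exact_mod_cast Fintype.card_pos_iff.2 ⟨c⟩
      have ha : (1 : ℝ) ≤ σ.ar c.1 := by exact_mod_cast i.pos
      rw [div_eq_mul_inv]
      exact mul_le_one₀ (inv_le_one_of_one_le₀ hm) (by positivity) (inv_le_one_of_one_le₀ ha))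
    have h4 := commSq_of_eq hτ (MorCV.p 𝔾 𝔸 x) (MorCV.p 𝔾 𝔸 y)
    simp only [hρ'] at h4
    rw [← h4]
    exact h3
  · rintro ⟨h1, h2⟩
    refine ⟨h1, fun ε hε => ?_⟩
    obtain ⟨δ, hδ, h⟩ := h2 ε hε
    let K : ℝ := ∑ c : Constraint 𝔾, (Fintype.card (Constraint 𝔾) * σ.ar c.1 : ℝ)
    have hK : 0 ≤ K := Finset.sum_nonneg fun _ _ => by positivity
    refine ⟨δ / (K + 1), by positivity, fun τ hτ hd => ?_⟩
    obtain ⟨B, _, π, φ, hB, hφ, hτ⟩ := hτ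
    have h3 := h B hB φ hφ (fun c b => π (MorCV.phi 𝔾 𝔸 c b)) (fun x a => π (MorCV.p 𝔾 𝔸 x a))
      (fun c => (isPVM_morCV_phi c).map π) (fun x => (isPVM_morCV_p x).map π) (by
        rw [← violCV_of_eq hτ]
        rw [lt_div_iff₀ (by positivity)] at hd
        refine lt_of_le_of_lt ?_ hd
        rw [defect_weightCV, violCV, Finset.sum_mul]
        refine Finset.sum_le_sum fun c _ => ?_
        rw [Finset.sum_mul]
        refine Finset.sum_le_sum fun b _ => ?_
        rw [Finset.sum_mul]
        refine Finset.sum_le_sum fun i _ => ?_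
        rw [mul_right_comm]
        refine le_mul_of_one_le_left (TracialState.normSq_nonneg _ _) ?_
        have hm : (0 : ℝ) < Fintype.card (Constraint 𝔾) := by
          exact_mod_cast Fintype.card_pos_iff.2 ⟨c⟩
        have ha : (0 : ℝ) < σ.ar c.1 := by exact_mod_cast i.pos
        have hle : (Fintype.card (Constraint 𝔾) * σ.ar c.1 : ℝ) ≤ K :=
          Finset.single_le_sum (f := fun c : Constraint 𝔾 =>
            (Fintype.card (Constraint 𝔾) * σ.ar c.1 : ℝ)) (fun _ _ => by positivity)
            (Finset.mem_univ c)
        rw [inv_eq_one_div, div_div, div_mul_eq_mul_div, one_mul, one_le_div (by positivity)]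
        linarith)
    rw [← commSq_of_eq hτ] at h3
    exact h3

end Gadget

/-! ### Composition of quantum homomorphisms -/

section Ring

variable {D S T : Type} [Ring D] [StarRing D] [Fintype S] [Fintype T]

theorem IsPVM.comp {q : S → D} {p : S → T → D} (hq : IsPVM q) (hp : ∀ s, IsPVM (p s))
    (h : ∀ s s' t, Commute (q s) (p s' t)) : IsPVM fun t => ∑ s, q s * p s t := by
  classical
  have mul : ∀ t t', (∑ s, q s * p s t) * ∑ s, q s * p s t' = ∑ s, q s * (p s t * p s t') := by
    intro t t'
    rw [Finset.sum_mul]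
    refine Finset.sum_congr rfl fun s _ => ?_
    rw [Finset.mul_sum, Finset.sum_eq_single s]
    · rw [mul_assoc, ← mul_assoc (p s t), ← (h s s t).eq, mul_assoc, ← mul_assoc, hq.idem]
    · intro s' _ hs
      rw [mul_assoc, ← mul_assoc (p s t), ← (h s' s t).eq, mul_assoc, ← mul_assoc,
        hq.orth s s' (Ne.symm hs), zero_mul]
    · simp
  refine ⟨fun t => ?_, fun t => ?_, fun t t' ht => ?_, ?_⟩
  · rw [isSelfAdjoint_iff, star_sum]
    refine Finset.sum_congr rfl fun s _ => ?_
    rw [star_mul, (hq.sa _).star_eq, ((hp s).sa _).star_eq, (h s s t).eq]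
  · rw [mul]; simp only [(hp _).idem]
  · rw [mul]; simp only [(hp _).orth t t' ht, mul_zero, Finset.sum_const_zero]
  · rw [Finset.sum_comm]
    simp only [← Finset.mul_sum, (hp _).sum, mul_one, hq.sum]

omit [Fintype T] in
theorem IsPVM.comp_of_eq_one {q : S → D} (hq : IsPVM q) (p : S → T → D) {s : S} (hs : q s = 1)
    (t : T) : ∑ s, q s * p s t = p s t := by
  classical
  rw [Finset.sum_eq_single s, hs, one_mul]
  · intro s' _ hs'
    have := hq.orth s' s hs'
    rw [hs, mul_one] at this
    rw [this, zero_mul]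
  · simp

omit [StarRing D] in
theorem list_prod_mul_distrib {n : ℕ} (a b : Fin n → D) (h : ∀ i j, Commute (a i) (b j)) :
    (List.ofFn fun i => a i * b i).prod = (List.ofFn a).prod * (List.ofFn b).prod := by
  induction n with
  | zero => simp
  | succ n ih =>
    rw [List.ofFn_succ, List.ofFn_succ, List.ofFn_succ, List.prod_cons, List.prod_cons,
      List.prod_cons, ih (fun i => a i.succ) (fun i => b i.succ) (fun i j => h i.succ j.succ)]
    have : Commute (b 0) (List.ofFn fun i : Fin n => a i.succ).prod := by
      refine Commute.list_prod_right _ _ fun x hx => ?_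
      obtain ⟨i, rfl⟩ := (List.mem_ofFn' _ _).1 hx
      exact (h _ _).symm
    rw [mul_assoc, ← mul_assoc (b 0), this.eq]
    simp only [mul_assoc]

omit [StarRing D] in
theorem list_prod_sum {n : ℕ} (a : Fin n → S → D) :
    (List.ofFn fun i => ∑ s, a i s).prod = ∑ F : Fin n → S,
      (List.ofFn fun i => a i (F i)).prod := by
  classical
  induction n with
  | zero => simp
  | succ n ih =>
    rw [List.ofFn_succ, List.prod_cons, ih (fun i => a i.succ), Finset.sum_mul]
    rw [← Equiv.sum_comp (Fin.consEquiv fun _ => S), Fintype.sum_prod_type]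
    refine Finset.sum_congr rfl fun s _ => ?_
    rw [Finset.mul_sum]
    refine Finset.sum_congr rfl fun F _ => ?_
    rw [List.ofFn_succ, List.prod_cons]
    rfl

end Ring

section Comp

variable {σ : Signature} {G H A D : Type} [Ring D] [StarRing D] [Fintype H] [Fintype A]
  {𝔾 : RelStr σ G} {ℍ : RelStr σ H} {𝔸 : RelStr σ A}

/-- The composition of two quantum homomorphisms with commuting values. -/
def homComp (q : G → H → D) (p : H → A → D) (x : G) (a : A) : D := ∑ f, q x f * p f a

omit [Fintype A] [StarRing D] in
theorem prodGen_homComp {q : G → H → D} {p : H → A → D} (h : ∀ x f f' a, Commute (q x f) (p f' a))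
    {n : ℕ} (z : Fin n → G) (b : Fin n → A) :
    prodGen (homComp q p) z b = ∑ F : Fin n → H, prodGen q z F * prodGen p F b := by
  simp only [prodGen, homComp, list_prod_sum]
  refine Finset.sum_congr rfl fun F _ => ?_
  exact list_prod_mul_distrib _ _ fun i j => h _ _ _ _

theorem isPVM_homComp {q : G → H → D} {p : H → A → D} (hq : ∀ x, IsPVM (q x))
    (hp : ∀ f, IsPVM (p f))
    (h : ∀ x f f' a, Commute (q x f) (p f' a)) (x : G) : IsPVM (homComp q p x) :=
  (hq x).comp hp (h x)

omit [Fintype A] in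
theorem homComp_of_eq_one {q : G → H → D} {x : G} (hq : IsPVM (q x)) {f : H} (h : q x f = 1)
    (p : H → A → D) (a : A) : homComp q p x a = p f a :=
  hq.comp_of_eq_one p h a

theorem IsPlusHom.comp {q : G → H → D} {p : H → A → D} (hq : IsPlusHom 𝔾 ℍ q) (hp : IsPlusHom ℍ 𝔸 p)
    (h : ∀ x f f' a, Commute (q x f) (p f' a)) : IsPlusHom 𝔾 𝔸 (homComp q p) := by
  refine ⟨isPVM_homComp hq.pvm hp.pvm h, fun R z hz b hb => ?_⟩
  rw [prodGen_homComp h]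
  refine Finset.sum_eq_zero fun F _ => ?_
  by_cases hF : F ∈ ℍ.rel R
  · rw [hp.rel R F hF b hb, mul_zero]
  · rw [hq.rel R z hz F hF, zero_mul]

/-- The joint measurements of a composition. -/
def jointComp (Φ : ∀ c : Constraint 𝔾, Sat ℍ c.1 → D) (Ψ : ∀ c : Constraint ℍ, Sat 𝔸 c.1 → D)
    (c : Constraint 𝔾) (b : Sat 𝔸 c.1) : D :=
  ∑ F : Sat ℍ c.1, Φ c F * Ψ ⟨c.1, F⟩ b

theorem isPVM_jointComp {Φ : ∀ c : Constraint 𝔾, Sat ℍ c.1 → D}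
    {Ψ : ∀ c : Constraint ℍ, Sat 𝔸 c.1 → D} (hΦ : ∀ c, IsPVM (Φ c)) (hΨ : ∀ c, IsPVM (Ψ c))
    (hΦΨ : ∀ c F c' b, Commute (Φ c F) (Ψ c' b)) (c : Constraint 𝔾) : IsPVM (jointComp Φ Ψ c) :=
  IsPVM.comp (q := Φ c) (p := fun (F : Sat ℍ c.1) (b : Sat 𝔸 c.1) => Ψ ⟨c.1, F⟩ b)
    (hΦ c) (fun F => hΨ ⟨c.1, F⟩) fun F F' b => hΦΨ c F ⟨c.1, F'⟩ b

omit [Fintype A] in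
theorem IsJointHom.phi_mul_homComp {Φ : ∀ c : Constraint 𝔾, Sat ℍ c.1 → D} {q : G → H → D}
    (h : IsJointHom 𝔾 ℍ Φ q) (p : H → A → D) (c : Constraint 𝔾) (F : Sat ℍ c.1) (i) (a : A) :
    Φ c F * homComp q p (c.2.1 i) a = Φ c F * p (F.1 i) a := by
  classical
  have h1 : ∀ f, Φ c F * q (c.2.1 i) f = if f = F.1 i then Φ c F else 0 := by
    intro f
    have := congrArg star (h.mul_phi c F i f)
    rw [star_mul, ((h.pvm _).sa _).star_eq, ((h.joint _).sa _).star_eq] at this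
    rw [this]
    split_ifs
    · exact ((h.joint _).sa _).star_eq
    · exact star_zero _
  rw [homComp, Finset.mul_sum, Finset.sum_eq_single (F.1 i)]
  · rw [← mul_assoc, h1, if_pos rfl]
  · intro f _ hf
    rw [← mul_assoc, h1, if_neg hf, zero_mul]
  · simp

omit [Fintype A] in
theorem jointComp_mul_one_sub {Φ : ∀ c : Constraint 𝔾, Sat ℍ c.1 → D} {q : G → H → D}
    {Ψ : ∀ c : Constraint ℍ, Sat 𝔸 c.1 → D} {p : H → A → D} (h : IsJointHom 𝔾 ℍ Φ q)
    (hΦΨ : ∀ c F c' b, Commute (Φ c F) (Ψ c' b)) (c : Constraint 𝔾)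
    (b : Sat 𝔸 c.1) (i) :
    jointComp Φ Ψ c b * (1 - homComp q p (c.2.1 i) (b.1 i)) =
      ∑ F : Sat ℍ c.1, Φ c F * (Ψ ⟨c.1, F⟩ b * (1 - p (F.1 i) (b.1 i))) := by
  rw [jointComp, Finset.sum_mul]
  refine Finset.sum_congr rfl fun F _ => ?_
  have h1 : Commute (Φ c F) (Ψ ⟨c.1, F⟩ b) := hΦΨ c F ⟨c.1, F⟩ b
  have h2 := h.phi_mul_homComp p c F i (b.1 i)
  generalize Ψ ⟨c.1, F⟩ b = ψ at h1 ⊢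
  rw [mul_sub, mul_sub, mul_sub, mul_one, mul_one]
  congr 1
  rw [h1.eq, mul_assoc, h2, ← mul_assoc, ← h1.eq, mul_assoc]

theorem IsJointHom.comp {Φ : ∀ c : Constraint 𝔾, Sat ℍ c.1 → D} {q : G → H → D}
    {Ψ : ∀ c : Constraint ℍ, Sat 𝔸 c.1 → D} {p : H → A → D} (hq : IsJointHom 𝔾 ℍ Φ q)
    (hp : IsJointHom ℍ 𝔸 Ψ p) (hqp : ∀ x f f' a, Commute (q x f) (p f' a))
    (hΦΨ : ∀ c F c' b, Commute (Φ c F) (Ψ c' b)) :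
    IsJointHom 𝔾 𝔸 (jointComp Φ Ψ) (homComp q p) := by
  refine ⟨isPVM_homComp hq.pvm hp.pvm hqp, fun c => ?_, fun c b i => ?_⟩
  · exact isPVM_jointComp hq.joint hp.joint hΦΨ c
  · rw [jointComp_mul_one_sub hq hΦΨ]
    refine Finset.sum_eq_zero fun F _ => ?_
    rw [hp.consistent ⟨c.1, F⟩ b i, mul_zero]

end Comp

/-! ### Powers of the target structure -/

section Pow

variable {σ : Signature} {G A D : Type} [Ring D] [StarRing D] [Fintype A]

/-- The power `A ^ n`, with coordinatewise relations. -/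
def powStr (𝔸 : RelStr σ A) (n : ℕ) : RelStr σ (Fin n → A) where
  rel R := {F | ∀ i, (fun k => F k i) ∈ 𝔸.rel R}

variable {𝔾 : RelStr σ G} {𝔸 : RelStr σ A}

/-- The quantum homomorphism to `A ^ (n + 1)` with given coordinates in `A` and `A ^ n`. -/
def homCons {n : ℕ} (p : G → A → D) (q : G → (Fin n → A) → D) (x : G) (f : Fin (n + 1) → A) : D :=
  p x (f 0) * q x (Fin.tail f)

theorem IsPlusHom.cons {n : ℕ} {p : G → A → D} {q : G → (Fin n → A) → D} (hp : IsPlusHom 𝔾 𝔸 p)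
    (hq : IsPlusHom 𝔾 (powStr 𝔸 n) q) (h : ∀ x a x' f, Commute (p x a) (q x' f)) :
    IsPlusHom 𝔾 (powStr 𝔸 (n + 1)) (homCons p q) := by
  refine ⟨fun x => ?_, fun R z hz b hb => ?_⟩
  · exact ((hp.pvm x).mul (hq.pvm x) fun a f => h x a x f).reindex (Fin.consEquiv fun _ => A).symm
  · have e : prodGen (homCons p q) z b =
        prodGen p z (fun k => b k 0) * prodGen q z (fun k => Fin.tail (b k)) :=
      list_prod_mul_distrib _ _ fun i j => h _ _ _ _
    rw [e]
    by_cases h0 : (fun k => b k 0) ∈ 𝔸.rel R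
    · have h1 : (fun k => Fin.tail (b k)) ∉ (powStr 𝔸 n).rel R := fun h1 =>
        hb fun i => Fin.cases h0 (fun j => h1 j) i
      rw [hq.rel R z hz _ h1, mul_zero]
    · rw [hp.rel R z hz _ h0, zero_mul]

theorem IsOPlusHom.cons {n : ℕ} {p : G → A → D} {q : G → (Fin n → A) → D} (hp : IsOPlusHom 𝔾 𝔸 p)
    (hq : IsOPlusHom 𝔾 (powStr 𝔸 n) q) (h : ∀ x a x' f, Commute (p x a) (q x' f)) :
    IsOPlusHom 𝔾 (powStr 𝔸 (n + 1)) (homCons p q) := by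
  refine ⟨hp.toIsPlusHom.cons hq.toIsPlusHom h, fun R z hz i j b b' => ?_⟩
  exact ((hp.comm R z hz i j _ _).mul_left (h _ _ _ _).symm).mul_right
    ((h _ _ _ _).mul_left (hq.comm R z hz i j _ _))

theorem isOPlusHom_pow_zero : IsOPlusHom 𝔾 (powStr 𝔸 0) (fun _ _ => (1 : D)) := by
  refine ⟨⟨fun x => ⟨fun s => ?_, fun s => ?_, fun s t hst => (hst (Subsingleton.elim _ _)).elim,
    ?_⟩, fun R z hz b hb => (hb fun i => i.elim0).elim⟩, fun R z hz i j b b' => ?_⟩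
  · exact IsSelfAdjoint.one _
  · exact mul_one 1
  · simp
  · exact Commute.one_left _

open Classical in
/-- Coordinates are classical homomorphisms from the power. -/
theorem isOPlusHom_coordinate (n : ℕ) (i : Fin n) :
    IsOPlusHom (powStr 𝔸 n) 𝔸 fun f a => if f i = a then (1 : D) else 0 := by
  refine ⟨⟨fun f => ⟨fun s => ?_, fun s => ?_, fun s t hst => ?_, ?_⟩, fun R z hz b hb => ?_⟩,
    fun R z hz k l b b' => ?_⟩
  · split_ifs
    · exact IsSelfAdjoint.one _
    · exact IsSelfAdjoint.zero _
  · split_ifs <;> simp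
  · rcases eq_or_ne (f i) s with rfl | h
    · rw [if_neg hst, mul_zero]
    · rw [if_neg h, zero_mul]
  · simp
  · have := list_prod_mul_ite (q := fun k a => if z k i = a then (1 : D) else 0) (X := 1)
      (c := fun k => z k i) (fun k a => by simp only [mul_one, eq_comm]) b
    rw [mul_one] at this
    refine this.trans (if_neg ?_)
    rintro rfl
    exact hb (hz i)
  · split_ifs
    · exact Commute.one_left _
    · exact Commute.zero_right _
    · exact Commute.zero_left _
    · exact Commute.zero_left _

end Pow

/-! ### The canonical gadget -/

/-- A model closed under a weak form of tensor products: two representations of PVM algebras can be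
replaced by commuting ones with the same kernels. -/
def Model.TensorClosed (Q : Model) : Prop :=
  ∀ (𝒜₁ 𝒜₂ : Type) [Ring 𝒜₁] [StarRing 𝒜₁] [Algebra ℂ 𝒜₁] [Ring 𝒜₂] [StarRing 𝒜₂] [Algebra ℂ 𝒜₂],
    IsPVMAlgebra 𝒜₁ → IsPVMAlgebra 𝒜₂ → ∀ (B₁ B₂ : Type) [CStarAlgebra B₁] [CStarAlgebra B₂]
    (π₁ : 𝒜₁ →⋆ₐ[ℂ] B₁) (π₂ : 𝒜₂ →⋆ₐ[ℂ] B₂), Q.mem B₁ → Q.mem B₂ →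
    ∃ (C : Type) (_ : CStarAlgebra C) (ρ₁ : 𝒜₁ →⋆ₐ[ℂ] C) (ρ₂ : 𝒜₂ →⋆ₐ[ℂ] C), Q.mem C ∧
      (∀ a b, Commute (ρ₁ a) (ρ₂ b)) ∧ (∀ a, ρ₁ a = 0 ↔ π₁ a = 0) ∧ (∀ a, ρ₂ a = 0 ↔ π₂ a = 0)

/-- The tracial version of the weak tensor products: the second representation comes from a model
`Q₀`, and the trace on it is preserved. -/
def Model.TraceTensor (Q₀ Q : Model) : Prop :=
  ∀ (𝒜₁ 𝒜₂ : Type) [Ring 𝒜₁] [StarRing 𝒜₁] [Algebra ℂ 𝒜₁] [Ring 𝒜₂] [StarRing 𝒜₂] [Algebra ℂ 𝒜₂],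
    IsPVMAlgebra 𝒜₁ → IsPVMAlgebra 𝒜₂ → ∀ (B₁ B₂ : Type) [CStarAlgebra B₁] [CStarAlgebra B₂]
    (π₁ : 𝒜₁ →⋆ₐ[ℂ] B₁) (π₂ : 𝒜₂ →⋆ₐ[ℂ] B₂), Q.mem B₁ → Q₀.mem B₂ →
    ∀ φ : TracialState B₂, Q₀.trace B₂ φ →
    ∃ (C : Type) (_ : CStarAlgebra C) (ρ₁ : 𝒜₁ →⋆ₐ[ℂ] C) (ρ₂ : 𝒜₂ →⋆ₐ[ℂ] C) (χ : TracialState C),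
      Q.mem C ∧ Q.trace C χ ∧ (∀ a b, Commute (ρ₁ a) (ρ₂ b)) ∧ (∀ a, π₁ a = 0 → ρ₁ a = 0) ∧
      ∀ a, φ.toLin (π₂ a) = χ.toLin (ρ₂ a)

section Kernel

variable {σ : Signature} {G H : Type} [Fintype H] {𝔾 : RelStr σ G} {ℍ : RelStr σ H}
  {B C : Type} [CStarAlgebra B] [CStarAlgebra C] {π : MorA G H →⋆ₐ[ℂ] B} {ρ : MorA G H →⋆ₐ[ℂ] C}

theorem IsPlusHom.of_ker {p : G → H → B} (hp : IsPlusHom 𝔾 ℍ p) (hπ : ∀ x a, π (MorA.p x a) = p x a)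
    (h : ∀ a, π a = 0 → ρ a = 0) : IsPlusHom 𝔾 ℍ fun x a => ρ (MorA.p x a) := by
  refine ⟨fun x => (isPVM_morA x).map ρ, fun R z hz b hb => ?_⟩
  rw [← map_prodGen]
  refine h _ ?_
  rw [map_prodGen]
  simp only [hπ]
  exact hp.rel R z hz b hb

theorem IsOPlusHom.of_ker {p : G → H → B} (hp : IsOPlusHom 𝔾 ℍ p)
    (hπ : ∀ x a, π (MorA.p x a) = p x a) (h : ∀ a, π a = 0 → ρ a = 0) :
    IsOPlusHom 𝔾 ℍ fun x a => ρ (MorA.p x a) := by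
  refine ⟨hp.toIsPlusHom.of_ker hπ h, fun R z hz i j b b' => ?_⟩
  rw [commute_iff_eq, ← map_mul, ← map_mul, ← sub_eq_zero, ← map_sub]
  refine h _ ?_
  rw [map_sub, map_mul, map_mul, hπ, hπ, sub_eq_zero]
  exact hp.comm R z hz i j b b'

theorem eq_one_of_ker {p : G → H → B} (hπ : ∀ x a, π (MorA.p x a) = p x a)
    (h : ∀ a, π a = 0 → ρ a = 0) {x : G} {a : H} (ha : p x a = 1) : ρ (MorA.p x a) = 1 := by
  rw [← sub_eq_zero, ← map_one ρ, ← map_sub]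
  refine h _ ?_
  rw [map_sub, map_one, hπ, ha, sub_self]

end Kernel

section Canonical

variable {σ : Signature} {G A : Type} [Fintype A] [Fintype G] {𝔾 : RelStr σ G} {𝔸 : RelStr σ A}
  {Q Q' : Model} {x y : G}

/-- Realizations of prescribed values combine into a quantum homomorphism to a power. -/
theorem exists_isPlusHom_pow (hC : Q.mem ℂ) (hT : Q.TensorClosed) {n : ℕ} (u v : Fin n → A)
    (h : ∀ a b : A, ∃ (B : Type) (_ : CStarAlgebra B) (p : G → A → B), Q.mem B ∧
      IsPlusHom 𝔾 𝔸 p ∧ p x a = 1 ∧ p y b = 1) :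
    ∃ (B : Type) (_ : CStarAlgebra B) (q : G → (Fin n → A) → B), Q.mem B ∧
      IsPlusHom 𝔾 (powStr 𝔸 n) q ∧ q x u = 1 ∧ q y v = 1 := by
  induction n with
  | zero => exact ⟨ℂ, inferInstance, _, hC, isOPlusHom_pow_zero.toIsPlusHom, rfl, rfl⟩
  | succ n ih =>
    obtain ⟨B₁, _, p, hB₁, hp, hpx, hpy⟩ := h (u 0) (v 0)
    obtain ⟨B₂, _, q, hB₂, hq, hqx, hqy⟩ := ih (Fin.tail u) (Fin.tail v)
    obtain ⟨π₁, hπ₁⟩ := exists_lift_morA p hp.pvm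
    obtain ⟨π₂, hπ₂⟩ := exists_lift_morA q hq.pvm
    obtain ⟨C, _, ρ₁, ρ₂, hC', hc, h1, h2⟩ := hT _ _ isPVMAlgebra_morA isPVMAlgebra_morA B₁ B₂ π₁ π₂
      hB₁ hB₂
    refine ⟨C, _, _, hC', (hp.of_ker hπ₁ fun a => (h1 a).2).cons (hq.of_ker hπ₂ fun a => (h2 a).2)
      fun _ _ _ _ => hc _ _, ?_, ?_⟩
    · rw [homCons, eq_one_of_ker hπ₁ (fun a => (h1 a).2) hpx,
        eq_one_of_ker hπ₂ (fun a => (h2 a).2) hqx, one_mul]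
    · rw [homCons, eq_one_of_ker hπ₁ (fun a => (h1 a).2) hpy,
        eq_one_of_ker hπ₂ (fun a => (h2 a).2) hqy, one_mul]

theorem exists_isOPlusHom_pow (hC : Q.mem ℂ) (hT : Q.TensorClosed) {n : ℕ} (u v : Fin n → A)
    (h : ∀ a b : A, ∃ (B : Type) (_ : CStarAlgebra B) (p : G → A → B), Q.mem B ∧
      IsOPlusHom 𝔾 𝔸 p ∧ p x a = 1 ∧ p y b = 1) :
    ∃ (B : Type) (_ : CStarAlgebra B) (q : G → (Fin n → A) → B), Q.mem B ∧
      IsOPlusHom 𝔾 (powStr 𝔸 n) q ∧ q x u = 1 ∧ q y v = 1 := by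
  induction n with
  | zero => exact ⟨ℂ, inferInstance, _, hC, isOPlusHom_pow_zero, rfl, rfl⟩
  | succ n ih =>
    obtain ⟨B₁, _, p, hB₁, hp, hpx, hpy⟩ := h (u 0) (v 0)
    obtain ⟨B₂, _, q, hB₂, hq, hqx, hqy⟩ := ih (Fin.tail u) (Fin.tail v)
    obtain ⟨π₁, hπ₁⟩ := exists_lift_morA p hp.pvm
    obtain ⟨π₂, hπ₂⟩ := exists_lift_morA q hq.pvm
    obtain ⟨C, _, ρ₁, ρ₂, hC', hc, h1, h2⟩ := hT _ _ isPVMAlgebra_morA isPVMAlgebra_morA B₁ B₂ π₁ π₂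
      hB₁ hB₂
    refine ⟨C, _, _, hC', (hp.of_ker hπ₁ fun a => (h1 a).2).cons (hq.of_ker hπ₂ fun a => (h2 a).2)
      fun _ _ _ _ => hc _ _, ?_, ?_⟩
    · rw [homCons, eq_one_of_ker hπ₁ (fun a => (h1 a).2) hpx,
        eq_one_of_ker hπ₂ (fun a => (h2 a).2) hqx, one_mul]
    · rw [homCons, eq_one_of_ker hπ₁ (fun a => (h1 a).2) hpy,
        eq_one_of_ker hπ₂ (fun a => (h2 a).2) hqy, one_mul]

variable (A) in
/-- The elements `x` and `y` of the canonical gadget: the two projections `A × A → A`, the power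
`A ^ (A × A)` being indexed by an enumeration of `A × A`. -/
def canFst : Fin (Fintype.card (A × A)) → A := fun i => ((Fintype.equivFin (A × A)).symm i).1

variable (A) in
/-- The second projection; see `canFst`. -/
def canSnd : Fin (Fintype.card (A × A)) → A := fun i => ((Fintype.equivFin (A × A)).symm i).2

variable (𝔸) in
/-- The structure of the canonical gadget, the power `A ^ (A × A)`. -/
abbrev canStr : RelStr σ (Fin (Fintype.card (A × A)) → A) := powStr 𝔸 (Fintype.card (A × A))

omit [Fintype G] in
/-- The canonical gadget takes any two values classically. -/
theorem exists_canonical_realization (hC : Q.mem ℂ) (a b : A) :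
    ∃ (B : Type) (_ : CStarAlgebra B) (p : (Fin (Fintype.card (A × A)) → A) → A → B), Q.mem B ∧
      IsOPlusHom (canStr 𝔸) 𝔸 p ∧ p (canFst A) a = 1 ∧ p (canSnd A) b = 1 := by
  classical
  refine ⟨ℂ, inferInstance, _, hC, isOPlusHom_coordinate _ (Fintype.equivFin (A × A) (a, b)),
    ?_, ?_⟩
  · exact if_pos (by simp [canFst])
  · exact if_pos (by simp [canSnd])

/-- If a gadget exists, then the canonical one is a gadget, even for submodels. -/
theorem IsGadget.canonical (hC' : Q'.mem ℂ) (hT : Q'.TensorClosed) (hC : Q.mem ℂ)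
    (hQ : Q.AlgSubset Q') (h : IsGadget Q' 𝔸 𝔾 x y) :
    IsGadget Q 𝔸 (canStr 𝔸) (canFst A) (canSnd A) := by
  rw [isGadget_iff] at h ⊢
  refine ⟨fun a b => ?_, fun B _ hB p hp a b => ?_⟩
  · obtain ⟨B, _, p, hB, hp, h1, h2⟩ := exists_canonical_realization (𝔸 := 𝔸) hC a b
    exact ⟨B, _, p, hB, hp.toIsPlusHom, h1, h2⟩
  obtain ⟨B₁, _, q, hB₁, hq, hqx, hqy⟩ := exists_isPlusHom_pow hC' hT (canFst A) (canSnd A) h.1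
  obtain ⟨π₁, hπ₁⟩ := exists_lift_morA q hq.pvm
  obtain ⟨π₂, hπ₂⟩ := exists_lift_morA p hp.pvm
  obtain ⟨C, _, ρ₁, ρ₂, hC', hc, h1, h2⟩ := hT _ _ isPVMAlgebra_morA isPVMAlgebra_morA B₁ B π₁ π₂
    hB₁ (hQ B hB)
  have hq' := hq.of_ker hπ₁ fun a => (h1 a).2
  have hr := hq'.comp (hp.of_ker hπ₂ fun a => (h2 a).2) fun _ _ _ _ => hc _ _
  have key := h.2 C hC' _ hr a b
  rw [homComp_of_eq_one (q := fun x f => ρ₁ (MorA.p x f)) (hq'.pvm x)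
      (eq_one_of_ker hπ₁ (fun a => (h1 a).2) hqx) (fun f a => ρ₂ (MorA.p f a)) a,
    homComp_of_eq_one (q := fun x f => ρ₁ (MorA.p x f)) (hq'.pvm y)
      (eq_one_of_ker hπ₁ (fun a => (h1 a).2) hqy) (fun f a => ρ₂ (MorA.p f a)) b, commute_iff_eq,
    ← map_mul, ← map_mul, ← sub_eq_zero, ← map_sub, h2, map_sub, map_mul, map_mul, hπ₂, hπ₂,
    sub_eq_zero] at key
  exact key

theorem IsOracularGadget.canonical (hC' : Q'.mem ℂ) (hT : Q'.TensorClosed) (hC : Q.mem ℂ)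
    (hQ : Q.AlgSubset Q') (h : IsOracularGadget Q' 𝔸 𝔾 x y) :
    IsOracularGadget Q 𝔸 (canStr 𝔸) (canFst A) (canSnd A) := by
  rw [isOracularGadget_iff] at h ⊢
  refine ⟨fun a b => exists_canonical_realization hC a b, fun B _ hB p hp a b => ?_⟩
  obtain ⟨B₁, _, q, hB₁, hq, hqx, hqy⟩ := exists_isOPlusHom_pow hC' hT (canFst A) (canSnd A) h.1
  obtain ⟨π₁, hπ₁⟩ := exists_lift_morA q hq.pvm
  obtain ⟨π₂, hπ₂⟩ := exists_lift_morA p hp.pvm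
  obtain ⟨C, _, ρ₁, ρ₂, hC', hc, h1, h2⟩ := hT _ _ isPVMAlgebra_morA isPVMAlgebra_morA B₁ B π₁ π₂
    hB₁ (hQ B hB)
  have hq' := hq.of_ker hπ₁ fun a => (h1 a).2
  have hp' := hp.of_ker hπ₂ fun a => (h2 a).2
  have hr : IsOPlusHom 𝔾 𝔸 (homComp (fun x f => ρ₁ (MorA.p x f)) fun f a => ρ₂ (MorA.p f a)) := by
    refine (hq'.joint.comp hp'.joint (fun _ _ _ _ => hc _ _) fun _ _ _ _ => ?_).isOPlusHom
    rw [← map_prodGen, ← map_prodGen]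
    exact hc _ _
  have key := h.2 C hC' _ hr a b
  rw [homComp_of_eq_one (q := fun x f => ρ₁ (MorA.p x f)) (hq'.pvm x)
      (eq_one_of_ker hπ₁ (fun a => (h1 a).2) hqx) (fun f a => ρ₂ (MorA.p f a)) a,
    homComp_of_eq_one (q := fun x f => ρ₁ (MorA.p x f)) (hq'.pvm y)
      (eq_one_of_ker hπ₁ (fun a => (h1 a).2) hqy) (fun f a => ρ₂ (MorA.p f a)) b, commute_iff_eq,
    ← map_mul, ← map_mul, ← sub_eq_zero, ← map_sub, h2, map_sub, map_mul, map_mul, hπ₂, hπ₂,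
    sub_eq_zero] at key
  exact key

end Canonical

/-! ### Transfer of robustness -/

section Violation

variable {σ : Signature} {G H A C : Type} [CStarAlgebra C] [Fintype A]
  {𝔾 : RelStr σ G} {ℍ : RelStr σ H} {𝔸 : RelStr σ A} (χ : TracialState C)

theorem norm_prodGen_le_one {p : G → A → C} (hp : ∀ x, IsPVM (p x)) {n : ℕ} (z : Fin n → G)
    (b : Fin n → A) : ‖prodGen p z b‖ ≤ 1 := by
  induction n with
  | zero =>
    rcases subsingleton_or_nontrivial C with h | h
    · rw [Subsingleton.elim (prodGen p z b) 0, norm_zero]; exact zero_le_one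
    · simp [prodGen]
  | succ n ih =>
    rw [prodGen, List.ofFn_succ, List.prod_cons]
    exact (norm_mul_le _ _).trans (mul_le_one₀ ((hp _).norm_le_one _) (norm_nonneg _)
      (ih (fun i => z i.succ) fun i => b i.succ))

variable [Fintype σ.Sym] [Fintype G] [Fintype H]

omit [Fintype H] in
theorem normSq_prodGen_le_violA (p : G → A → C) (c : Constraint 𝔾) (b : Unsat 𝔸 c.1) :
    χ.normSq (prodGen p c.2.1 b.1) ≤ violA 𝔾 𝔸 χ p :=
  (Finset.single_le_sum (f := fun b : Unsat 𝔸 c.1 => χ.normSq (prodGen p c.2.1 b.1))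
    (fun _ _ => χ.normSq_nonneg _) (Finset.mem_univ b)).trans
    (Finset.single_le_sum (f := fun c : Constraint 𝔾 =>
      ∑ b : Unsat 𝔸 c.1, χ.normSq (prodGen p c.2.1 b.1))
      (fun _ _ => Finset.sum_nonneg fun _ _ => χ.normSq_nonneg _) (Finset.mem_univ c))

omit [Fintype H] in
theorem sum_normSq_le_violCV (Φ : ∀ c : Constraint 𝔾, Sat 𝔸 c.1 → C) (p : G → A → C)
    (c : Constraint 𝔾) (b : Sat 𝔸 c.1) :
    ∑ i : Fin (σ.ar c.1), χ.normSq (Φ c b * (1 - p (c.2.1 i) (b.1 i))) ≤ violCV 𝔾 𝔸 χ Φ p :=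
  (Finset.single_le_sum (f := fun b : Sat 𝔸 c.1 => ∑ i : Fin (σ.ar c.1),
    χ.normSq (Φ c b * (1 - p (c.2.1 i) (b.1 i))))
    (fun _ _ => Finset.sum_nonneg fun _ _ => χ.normSq_nonneg _) (Finset.mem_univ b)).trans
    (Finset.single_le_sum (f := fun c : Constraint 𝔾 => ∑ b : Sat 𝔸 c.1, ∑ i : Fin (σ.ar c.1),
      χ.normSq (Φ c b * (1 - p (c.2.1 i) (b.1 i))))
      (fun _ _ => Finset.sum_nonneg fun _ _ => Finset.sum_nonneg fun _ _ => χ.normSq_nonneg _)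
      (Finset.mem_univ c))

omit [Fintype H] in
theorem normSq_le_violCV (Φ : ∀ c : Constraint 𝔾, Sat 𝔸 c.1 → C) (p : G → A → C)
    (c : Constraint 𝔾) (b : Sat 𝔸 c.1) (i : Fin (σ.ar c.1)) :
    χ.normSq (Φ c b * (1 - p (c.2.1 i) (b.1 i))) ≤ violCV 𝔾 𝔸 χ Φ p :=
  (Finset.single_le_sum (f := fun i : Fin (σ.ar c.1) =>
    χ.normSq (Φ c b * (1 - p (c.2.1 i) (b.1 i))))
    (fun _ _ => χ.normSq_nonneg _) (Finset.mem_univ i)).trans (sum_normSq_le_violCV χ Φ p c b)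

/-- Composing with an exact quantum homomorphism multiplies the violation at most by a constant. -/
theorem violA_homComp_le {q : G → H → C} {p : H → A → C} (hq : IsPlusHom 𝔾 ℍ q)
    (h : ∀ x f f' a, Commute (q x f) (p f' a)) :
    violA 𝔾 𝔸 χ (homComp q p) ≤
      (∑ c : Constraint 𝔾, ∑ _b : Unsat 𝔸 c.1, (Fintype.card (Fin (σ.ar c.1) → H) : ℝ) ^ 2) *
        violA ℍ 𝔸 χ p := by
  rw [violA, Finset.sum_mul]
  refine Finset.sum_le_sum fun c _ => ?_
  rw [Finset.sum_mul]
  refine Finset.sum_le_sum fun b _ => ?_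
  rw [prodGen_homComp h]
  refine (χ.normSq_sum_le _ _).trans ?_
  rw [sq, mul_assoc]
  refine mul_le_mul_of_nonneg_left ?_ (Nat.cast_nonneg _)
  rw [← nsmul_eq_mul]
  refine Finset.sum_le_card_nsmul _ _ _ fun F _ => ?_
  by_cases hF : F ∈ ℍ.rel c.1
  · refine (χ.normSq_mul_le (norm_prodGen_le_one hq.pvm _ _) _).trans ?_
    exact normSq_prodGen_le_violA χ p ⟨c.1, F, hF⟩ b
  · rw [hq.rel _ _ c.2.2 F hF, zero_mul, χ.normSq_zero]
    exact violA_nonneg _ _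

theorem violCV_comp_le {Φ : ∀ c : Constraint 𝔾, Sat ℍ c.1 → C} {q : G → H → C}
    {Ψ : ∀ c : Constraint ℍ, Sat 𝔸 c.1 → C} {p : H → A → C} (hq : IsJointHom 𝔾 ℍ Φ q)
    (hΦΨ : ∀ c F c' b, Commute (Φ c F) (Ψ c' b)) :
    violCV 𝔾 𝔸 χ (jointComp Φ Ψ) (homComp q p) ≤
      (∑ c : Constraint 𝔾, ∑ _b : Sat 𝔸 c.1, ∑ _i : Fin (σ.ar c.1),
        (Fintype.card (Sat ℍ c.1) : ℝ) ^ 2) * violCV ℍ 𝔸 χ Ψ p := by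
  rw [violCV, Finset.sum_mul]
  refine Finset.sum_le_sum fun c _ => ?_
  rw [Finset.sum_mul]
  refine Finset.sum_le_sum fun b _ => ?_
  rw [Finset.sum_mul]
  refine Finset.sum_le_sum fun i _ => ?_
  rw [jointComp_mul_one_sub hq hΦΨ]
  refine (χ.normSq_sum_le _ _).trans ?_
  rw [sq, mul_assoc]
  refine mul_le_mul_of_nonneg_left ?_ (Nat.cast_nonneg _)
  rw [← nsmul_eq_mul]
  refine Finset.sum_le_card_nsmul _ _ _ fun F _ => ?_
  refine (χ.normSq_mul_le ((hq.joint c).norm_le_one F) _).trans ?_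
  exact normSq_le_violCV χ Ψ p ⟨c.1, F⟩ b i

omit [Fintype σ.Sym] [Fintype G] in
open Classical in
/-- If `X` is nearly fixed by the projections `p (z i) (c i)`, then `prodGen p z b` nearly fixes `X`
for `b = c` and nearly kills it for `b ≠ c`. -/
theorem norm_vec_prodGen_mul_sub_le {p : G → A → C} (hp : ∀ x, IsPVM (p x)) (X : C) {n : ℕ}
    (z : Fin n → G) (b c : Fin n → A) :
    ‖χ.vec (prodGen p z b * X - if b = c then X else 0)‖ ≤
      ∑ i, ‖χ.vec ((1 - p (z i) (c i)) * X)‖ := by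
  induction n with
  | zero => simp [prodGen, Subsingleton.elim b c]
  | succ n ih =>
    have ih := ih (fun i => z i.succ) (Fin.tail b) (Fin.tail c)
    rw [Fin.sum_univ_succ, add_comm (‖χ.vec ((1 - p (z 0) (c 0)) * X)‖)]
    have key : ‖χ.vec (p (z 0) (b 0) * X - if b 0 = c 0 then X else 0)‖ ≤
        ‖χ.vec ((1 - p (z 0) (c 0)) * X)‖ := by
      split_ifs with h0
      · rw [h0, ← norm_neg, ← map_neg, neg_sub, sub_mul, one_mul]
      · have e : p (z 0) (b 0) * X - 0 = p (z 0) (b 0) * ((1 - p (z 0) (c 0)) * X) := by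
          rw [sub_zero, sub_mul, one_mul, mul_sub, ← mul_assoc _ (p (z 0) (c 0)),
            (hp _).orth _ _ h0, zero_mul, sub_zero]
        rw [e]
        exact (χ.norm_vec_mul_le _ _).trans
          (mul_le_of_le_one_left (norm_nonneg _) ((hp _).norm_le_one _))
    have e : prodGen p z b * X - (if b = c then X else 0) =
        p (z 0) (b 0) * (prodGen p (fun i => z i.succ) (Fin.tail b) * X -
          if Fin.tail b = Fin.tail c then X else 0) +
        if Fin.tail b = Fin.tail c then p (z 0) (b 0) * X - (if b 0 = c 0 then X else 0)
        else 0 := by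
      have e1 : prodGen p z b = p (z 0) (b 0) * prodGen p (fun i => z i.succ) (Fin.tail b) := by
        rw [prodGen, List.ofFn_succ, List.prod_cons]; rfl
      have e2 : b = c ↔ b 0 = c 0 ∧ Fin.tail b = Fin.tail c := by
        refine ⟨fun h => by rw [h]; exact ⟨rfl, rfl⟩, fun h => ?_⟩
        rw [← Fin.cons_self_tail b, ← Fin.cons_self_tail c, h.1, h.2]
      rw [e1]
      by_cases h0 : b 0 = c 0 <;> by_cases h1 : Fin.tail b = Fin.tail c <;>
        simp only [e2, h0, h1, if_true, if_false, and_self, and_true, and_false,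
          mul_sub, mul_assoc, sub_zero, add_zero] <;> abel
    rw [e, map_add]
    refine (norm_add_le _ _).trans (add_le_add ?_ ?_)
    · exact (χ.norm_vec_mul_le _ _).trans
        ((mul_le_of_le_one_left (norm_nonneg _) ((hp _).norm_le_one _)).trans ih)
    · split_ifs at key ⊢
      · exact key
      · exact key
      · rw [map_zero, norm_zero]; exact norm_nonneg _
      · rw [map_zero, norm_zero]; exact norm_nonneg _

theorem violA_le_violCV {Φ : ∀ c : Constraint 𝔾, Sat 𝔸 c.1 → C} {p : G → A → C}
    (hΦ : ∀ c, IsPVM (Φ c)) (hp : ∀ x, IsPVM (p x)) :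
    violA 𝔾 𝔸 χ p ≤ (∑ c : Constraint 𝔾, ∑ _b : Unsat 𝔸 c.1,
      (Fintype.card (Sat 𝔸 c.1) * (σ.ar c.1 * (Fintype.card (Sat 𝔸 c.1))) : ℝ)) *
        violCV 𝔾 𝔸 χ Φ p := by
  rw [violA, Finset.sum_mul]
  refine Finset.sum_le_sum fun c _ => ?_
  rw [Finset.sum_mul]
  refine Finset.sum_le_sum fun b _ => ?_
  rw [← mul_one (prodGen p c.2.1 b.1), ← (hΦ c).sum, Finset.mul_sum]
  refine (χ.normSq_sum_le _ _).trans ?_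
  rw [mul_assoc]
  refine mul_le_mul_of_nonneg_left ?_ (Nat.cast_nonneg _)
  rw [mul_right_comm, mul_comm _ (Fintype.card (Sat 𝔸 c.1) : ℝ), ← nsmul_eq_mul]
  refine Finset.sum_le_card_nsmul _ _ _ fun s _ => ?_
  have h1 := norm_vec_prodGen_mul_sub_le χ hp (Φ c s) c.2.1 b.1 s.1
  have hbs : b.1 ≠ s.1 := fun e => b.2 (e ▸ s.2)
  rw [if_neg hbs, sub_zero] at h1
  have h2 : ∑ i : Fin (σ.ar c.1), χ.normSq ((1 - p (c.2.1 i) (s.1 i)) * Φ c s) ≤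
      violCV 𝔾 𝔸 χ Φ p := by
    refine le_trans (le_of_eq ?_) (sum_normSq_le_violCV χ Φ p c s)
    refine Finset.sum_congr rfl fun i _ => ?_
    rw [← χ.normSq_star, star_mul, star_sub, star_one, ((hp _).sa _).star_eq,
      ((hΦ c).sa s).star_eq]
  calc χ.normSq (prodGen p c.2.1 b.1 * Φ c s)
      ≤ (∑ i, ‖χ.vec ((1 - p (c.2.1 i) (s.1 i)) * Φ c s)‖) ^ 2 := by
        rw [χ.normSq_eq]; gcongr
    _ ≤ (Finset.univ : Finset (Fin (σ.ar c.1))).card *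
        ∑ i, ‖χ.vec ((1 - p (c.2.1 i) (s.1 i)) * Φ c s)‖ ^ 2 := sq_sum_le_card_mul_sum_sq
    _ ≤ σ.ar c.1 * violCV 𝔾 𝔸 χ Φ p := by
        rw [Finset.card_fin]
        simp only [← χ.normSq_eq]
        gcongr

end Violation

section Bounds

variable {σ : Signature} {G H A : Type} [Fintype A] [Fintype G] [Fintype H] [Fintype σ.Sym]
  {𝔾 : RelStr σ G} {ℍ : RelStr σ H} {𝔸 : RelStr σ A} {Q Q' : Model} {x y : G} {u v : H}

theorem ARobustBound.cvRobustBound (h : ARobustBound Q 𝔸 𝔾 x y) : CVRobustBound Q 𝔸 𝔾 x y := by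
  intro ε hε
  obtain ⟨δ, hδ, h⟩ := h ε hε
  set K : ℝ := ∑ c : Constraint 𝔾, ∑ _b : Unsat 𝔸 c.1,
    (Fintype.card (Sat 𝔸 c.1) * (σ.ar c.1 * (Fintype.card (Sat 𝔸 c.1))) : ℝ) with hK
  have hK0 : 0 ≤ K := Finset.sum_nonneg fun _ _ => Finset.sum_nonneg fun _ _ => by positivity
  refine ⟨δ / (K + 1), by positivity, fun B _ hB φ hφ Φ p hΦ hp hv => h B hB φ hφ p hp ?_⟩
  refine (violA_le_violCV φ hΦ hp).trans_lt ?_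
  rw [lt_div_iff₀ (by positivity)] at hv
  have := violCV_nonneg (𝔾 := 𝔾) (𝔸 := 𝔸) φ Φ p
  rw [← hK]
  linarith

/-- Robustness passes to every structure that receives an exact quantum homomorphism. -/
theorem ARobustBound.of_isPlusHom (hTT : Q.TraceTensor Q') (h : ARobustBound Q' 𝔸 𝔾 x y)
    {B₁ : Type} [CStarAlgebra B₁] {q : G → H → B₁} (hB₁ : Q'.mem B₁) (hq : IsPlusHom 𝔾 ℍ q)
    (hqx : q x u = 1) (hqy : q y v = 1) : ARobustBound Q 𝔸 ℍ u v := by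
  intro ε hε
  obtain ⟨δ, hδ, h⟩ := h ε hε
  set K : ℝ := ∑ c : Constraint 𝔾, ∑ _b : Unsat 𝔸 c.1,
    (Fintype.card (Fin (σ.ar c.1) → H) : ℝ) ^ 2 with hK
  have hK0 : 0 ≤ K := Finset.sum_nonneg fun _ _ => Finset.sum_nonneg fun _ _ => by positivity
  refine ⟨δ / (K + 1), by positivity, fun B _ hB φ hφ p hp hv => ?_⟩
  obtain ⟨π₁, hπ₁⟩ := exists_lift_morA q hq.pvm
  obtain ⟨π₂, hπ₂⟩ := exists_lift_morA p hp
  obtain ⟨C, _, ρ₁, ρ₂, χ, hC', hχ, hc, h1, h2⟩ := hTT _ _ isPVMAlgebra_morA isPVMAlgebra_morA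
    B₁ B π₁ π₂ hB₁ hB φ hφ
  have hq' := hq.of_ker hπ₁ h1
  have hp' : ∀ f, IsPVM fun a => ρ₂ (MorA.p f a) := fun f => (isPVM_morA f).map ρ₂
  have e1 : ∀ a, (φ.comp π₂).toLin a = φ.toLin (π₂ a) := fun a => rfl
  have e2 : ∀ a, (φ.comp π₂).toLin a = χ.toLin (ρ₂ a) := h2
  have hv' : violA ℍ 𝔸 χ (fun f a => ρ₂ (MorA.p f a)) = violA ℍ 𝔸 φ p := by
    rw [← violA_of_eq e2, violA_of_eq e1]
    simp only [hπ₂]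
  have key := h C hC' χ hχ _
    (isPVM_homComp hq'.pvm hp' fun _ _ _ _ => hc _ _) (by
      refine (violA_homComp_le χ hq' fun _ _ _ _ => hc _ _).trans_lt ?_
      rw [← hK, hv']
      rw [lt_div_iff₀ (by positivity)] at hv
      have := violA_nonneg (𝔾 := ℍ) (𝔸 := 𝔸) φ p
      linarith)
  have ex : homComp (fun x f => ρ₁ (MorA.p x f)) (fun f a => ρ₂ (MorA.p f a)) x =
      fun a => ρ₂ (MorA.p u a) := funext fun a =>
    homComp_of_eq_one (q := fun x f => ρ₁ (MorA.p x f)) (hq'.pvm x)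
      (eq_one_of_ker hπ₁ h1 hqx) (fun f a => ρ₂ (MorA.p f a)) a
  have ey : homComp (fun x f => ρ₁ (MorA.p x f)) (fun f a => ρ₂ (MorA.p f a)) y =
      fun a => ρ₂ (MorA.p v a) := funext fun a =>
    homComp_of_eq_one (q := fun x f => ρ₁ (MorA.p x f)) (hq'.pvm y)
      (eq_one_of_ker hπ₁ h1 hqy) (fun f a => ρ₂ (MorA.p f a)) a
  rw [ex, ey, ← commSq_of_eq e2, commSq_of_eq e1] at key
  simpa only [hπ₂] using key

theorem CVRobustBound.of_isOPlusHom (hTT : Q.TraceTensor Q') (h : CVRobustBound Q' 𝔸 𝔾 x y)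
    {B₁ : Type} [CStarAlgebra B₁] {q : G → H → B₁} (hB₁ : Q'.mem B₁) (hq : IsOPlusHom 𝔾 ℍ q)
    (hqx : q x u = 1) (hqy : q y v = 1) : CVRobustBound Q 𝔸 ℍ u v := by
  intro ε hε
  obtain ⟨δ, hδ, h⟩ := h ε hε
  set K : ℝ := ∑ c : Constraint 𝔾, ∑ _b : Sat 𝔸 c.1, ∑ _i : Fin (σ.ar c.1),
    (Fintype.card (Sat ℍ c.1) : ℝ) ^ 2 with hK
  have hK0 : 0 ≤ K := Finset.sum_nonneg fun _ _ => Finset.sum_nonneg fun _ _ =>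
    Finset.sum_nonneg fun _ _ => by positivity
  refine ⟨δ / (K + 1), by positivity, fun B _ hB φ hφ Ψ p hΨ hp hv => ?_⟩
  obtain ⟨π₁, hπ₁⟩ := exists_lift_morA q hq.pvm
  obtain ⟨π₂, hπ₂, hπ₂'⟩ := exists_lift_morCV (𝔸 := 𝔸) Ψ p hΨ hp
  obtain ⟨C, _, ρ₁, ρ₂, χ, hC', hχ, hc, h1, h2⟩ := hTT _ _ isPVMAlgebra_morA isPVMAlgebra_morCV
    B₁ B π₁ π₂ hB₁ hB φ hφ
  have hq' := hq.of_ker hπ₁ h1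
  have hp' : ∀ f, IsPVM fun a => ρ₂ (MorCV.p ℍ 𝔸 f a) := fun f =>
    (isPVM_morCV_p f).map ρ₂
  have hΨ' : ∀ c, IsPVM fun b => ρ₂ (MorCV.phi ℍ 𝔸 c b) := fun c =>
    (isPVM_morCV_phi c).map ρ₂
  have e1 : ∀ a, (φ.comp π₂).toLin a = φ.toLin (π₂ a) := fun a => rfl
  have e2 : ∀ a, (φ.comp π₂).toLin a = χ.toLin (ρ₂ a) := h2
  have hv' : violCV ℍ 𝔸 χ (fun c b => ρ₂ (MorCV.phi ℍ 𝔸 c b))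
      (fun f a => ρ₂ (MorCV.p ℍ 𝔸 f a)) = violCV ℍ 𝔸 φ Ψ p := by
    rw [← violCV_of_eq e2, violCV_of_eq e1]
    simp only [hπ₂, hπ₂']
  obtain ⟨Φ, q', hΦq, hqx', hqy', hcΦ, hcq⟩ : ∃ (Φ : ∀ c : Constraint 𝔾, Sat ℍ c.1 → C)
      (q' : G → H → C), IsJointHom 𝔾 ℍ Φ q' ∧ q' x u = 1 ∧ q' y v = 1 ∧
      (∀ c F a, Commute (Φ c F) (ρ₂ a)) ∧ ∀ x f a, Commute (q' x f) (ρ₂ a) := by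
    refine ⟨_, _, hq'.joint, eq_one_of_ker hπ₁ h1 hqx, eq_one_of_ker hπ₁ h1 hqy, fun c F a => ?_,
      fun x f a => hc _ _⟩
    rw [← map_prodGen]
    exact hc _ _
  have key := h C hC' χ hχ _ _
    (isPVM_jointComp hΦq.joint hΨ' fun c F c' b => hcΦ c F _)
    (isPVM_homComp hΦq.pvm hp' fun _ _ _ _ => hcq _ _ _) (by
      refine (violCV_comp_le χ hΦq fun c F c' b => hcΦ c F _).trans_lt ?_
      rw [← hK, hv']
      rw [lt_div_iff₀ (by positivity)] at hv
      have := violCV_nonneg (𝔾 := ℍ) (𝔸 := 𝔸) φ Ψ p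
      linarith)
  have ex : homComp q' (fun f a => ρ₂ (MorCV.p ℍ 𝔸 f a)) x = fun a => ρ₂ (MorCV.p ℍ 𝔸 u a) :=
    funext fun a => homComp_of_eq_one (hΦq.pvm x) hqx' (fun f a => ρ₂ (MorCV.p ℍ 𝔸 f a)) a
  have ey : homComp q' (fun f a => ρ₂ (MorCV.p ℍ 𝔸 f a)) y = fun a => ρ₂ (MorCV.p ℍ 𝔸 v a) :=
    funext fun a => homComp_of_eq_one (hΦq.pvm y) hqy' (fun f a => ρ₂ (MorCV.p ℍ 𝔸 f a)) a
  rw [ex, ey, ← commSq_of_eq e2, commSq_of_eq e1] at key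
  simpa only [hπ₂'] using key

theorem ARobustBound.canonical (hC : Q'.mem ℂ) (hT : Q'.TensorClosed) (hTT : Q.TraceTensor Q')
    (hg : IsGadget Q' 𝔸 𝔾 x y) (h : ARobustBound Q' 𝔸 𝔾 x y) :
    ARobustBound Q 𝔸 (canStr 𝔸) (canFst A) (canSnd A) := by
  obtain ⟨B₁, _, q, hB₁, hq, hqx, hqy⟩ :=
    exists_isPlusHom_pow hC hT (canFst A) (canSnd A) (isGadget_iff.1 hg).1
  exact h.of_isPlusHom hTT hB₁ hq hqx hqy

theorem CVRobustBound.canonical (hC : Q'.mem ℂ) (hT : Q'.TensorClosed) (hTT : Q.TraceTensor Q')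
    (hg : IsOracularGadget Q' 𝔸 𝔾 x y) (h : CVRobustBound Q' 𝔸 𝔾 x y) :
    CVRobustBound Q 𝔸 (canStr 𝔸) (canFst A) (canSnd A) := by
  obtain ⟨B₁, _, q, hB₁, hq, hqx, hqy⟩ :=
    exists_isOPlusHom_pow hC hT (canFst A) (canSnd A) (isOracularGadget_iff.1 hg).1
  exact h.of_isOPlusHom hTT hB₁ hq hqx hqy

end Bounds

/-! ### Min-tensor monoids -/

namespace Model

variable {Q Q' : Model}

theorem IsMinTensorMonoid.tensorClosed (hQ : Q.IsMinTensorMonoid) : Q.TensorClosed := by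
  intro 𝒜₁ 𝒜₂ _ _ _ _ _ _ _ _ B₁ B₂ _ _ π₁ π₂ h1 h2
  obtain ⟨C, _, iA, iB, hC, hcomm, -⟩ := exists_minTensor B₁ B₂
  have := hQ.nontrivial B₁ h1
  have := hQ.nontrivial B₂ h2
  exact ⟨C, _, iA.comp π₁, iB.comp π₂, hQ.mem_tensor _ _ _ iA iB hC h1 h2, fun a b => hcomm _ _,
    fun a => map_eq_zero_iff iA hC.injective_left, fun a => map_eq_zero_iff iB hC.injective_right⟩

theorem IsMinTensorMonoid.traceTensor (hQ' : Q'.IsMinTensorMonoid) (h : Q.Subset Q')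
    (htr : Q'.IsTracial) : Q.TraceTensor Q' := by
  intro 𝒜₁ 𝒜₂ _ _ _ _ _ _ _ _ B₁ B₂ _ _ π₁ π₂ h1 h2 φ hφ
  obtain ⟨C, _, iA, iB, hC, hcomm, hprod⟩ := exists_minTensor B₁ B₂
  obtain ⟨ψ, hψ⟩ := htr B₁ h1
  obtain ⟨χ, hχ⟩ := hprod ψ φ
  obtain ⟨h2', hφ'⟩ := h B₂ h2
  refine ⟨C, _, iA.comp π₁, iB.comp π₂, χ, hQ'.mem_tensor _ _ _ iA iB hC h1 h2',
    hQ'.trace_tensor _ _ _ iA iB hC h1 h2' ψ φ χ hψ (hφ' φ hφ) hχ, fun a b => hcomm _ _,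
    fun a ha => ?_, fun a => ?_⟩
  · change iA (π₁ a) = 0
    rw [ha, map_zero]
  · have := hχ 1 (π₂ a)
    rw [map_one, one_mul, ψ.map_one, one_mul] at this
    exact this.symm

theorem isMinTensorMonoid_cstar : cstar.IsMinTensorMonoid where
  nontrivial _ _ h := h
  mem_complex := inferInstanceAs (Nontrivial ℂ)
  trace_complex _ := trivial
  mem_tensor A B C _ _ _ iA iB h hA hB := by
    have : Nontrivial A := hA
    have : Nontrivial B := hB
    exact h.injective_left.nontrivial
  trace_tensor := by intros; trivial

theorem IsMinTensorMonoid.algSubset_cstar (hQ : Q.IsMinTensorMonoid) : Q.AlgSubset cstar :=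
  fun B _ hB => hQ.nontrivial B hB

theorem Subset.algSubset (h : Q.Subset Q') : Q.AlgSubset Q' := fun B _ hB => (h B hB).1

end Model

/-! ### Compactness of spaces of tracial states -/

open Filter

theorem exists_tendsto_of_bounded (ω : Ultrafilter ℕ) {f : ℕ → ℂ} {M : ℝ} (h : ∀ n, ‖f n‖ ≤ M) :
    ∃ L, Tendsto f ω (𝓝 L) := by
  obtain ⟨L, -, hL⟩ := (isCompact_closedBall (0 : ℂ) M).ultrafilter_le_nhds (ω.map f) (by
    rw [le_principal_iff]
    exact Eventually.of_forall (f := (ω : Filter ℕ)) fun n => by simpa using h n)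
  exact ⟨L, hL⟩

theorem TracialState.norm_toLin_le {B : Type} [CStarAlgebra B] (φ : TracialState B) (b : B) :
    ‖φ.toLin b‖ ≤ ‖b‖ := by
  have h1 : ‖φ.vec 1‖ = 1 := by
    have h := φ.normSq_eq 1
    rw [TracialState.normSq, star_one, one_mul, φ.map_one, Complex.one_re] at h
    exact (sq_eq_sq₀ (norm_nonneg _) zero_le_one).1 (by rw [← h, one_pow])
  have h2 : φ.toLin b = ⟪φ.vec 1, φ.vec b⟫_ℂ := by
    refine Eq.symm ((φ.func.inner_gns_vec 1 b).trans ?_)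
    rw [star_one, one_mul]; rfl
  rw [h2]
  refine (norm_inner_le_norm _ _).trans ?_
  rw [h1, one_mul]
  have := φ.norm_vec_mul_le b 1
  rwa [mul_one, h1, mul_one] at this

section Limit

variable {𝒜 : Type} [Ring 𝒜] [StarRing 𝒜] [Algebra ℂ 𝒜]

/-- Pointwise bounded sequences of tracial states converge pointwise along ultrafilters. -/
theorem TracialState.exists_tendsto (ω : Ultrafilter ℕ) (τ : ℕ → TracialState 𝒜)
    (h : ∀ a, ∃ M : ℝ, ∀ n, ‖(τ n).toLin a‖ ≤ M) :
    ∃ τ' : TracialState 𝒜, ∀ a, Tendsto (fun n => (τ n).toLin a) ω (𝓝 (τ'.toLin a)) := by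
  have hL : ∀ a, ∃ L, Tendsto (fun n => (τ n).toLin a) ω (𝓝 L) := fun a =>
    let ⟨_, hM⟩ := h a
    exists_tendsto_of_bounded ω hM
  choose L hL using hL
  refine ⟨⟨⟨⟨L, fun a b => ?_⟩, fun c a => ?_⟩, ?_, fun a => ?_, fun a b => ?_⟩, hL⟩
  · refine tendsto_nhds_unique (hL (a + b)) ?_
    simpa only [map_add] using (hL a).add (hL b)
  · refine tendsto_nhds_unique (hL (c • a)) ?_
    simpa only [map_smul, smul_eq_mul, RingHom.id_apply] using (hL a).const_mul c
  · refine tendsto_nhds_unique (hL 1) ?_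
    simpa only [TracialState.map_one] using tendsto_const_nhds
  · exact ge_of_tendsto (hL _) (Eventually.of_forall fun n => (τ n).nonneg a)
  · refine tendsto_nhds_unique (hL (a * b)) ?_
    simp only [(τ _).tracial a b]
    exact hL (b * a)

theorem TracialState.tendsto_normSq {B : Type} [Ring B] [StarRing B] [Algebra ℂ B]
    {ω : Filter ℕ} {τ : ℕ → TracialState 𝒜} {χ : TracialState B} {π : 𝒜 →⋆ₐ[ℂ] B}
    (h : ∀ a, Tendsto (fun n => (τ n).toLin a) ω (𝓝 (χ.toLin (π a)))) (a : 𝒜) :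
    Tendsto (fun n => (τ n).normSq a) ω (𝓝 (χ.normSq (π a))) := by
  have := (Complex.continuous_re.tendsto _).comp (h (star a * a))
  rwa [map_mul, map_star] at this

end Limit

section VectorTrace

variable {H : Type} [NormedAddCommGroup H] [InnerProductSpace ℂ H] [CompleteSpace H]

/-- The tracial state on an algebra of operators given by a unit vector. -/
def vectorTrace (S : StarSubalgebra ℂ (H →L[ℂ] H)) {v : H} (hv : ‖v‖ = 1)
    (htr : ∀ x ∈ S, ∀ y ∈ S, ⟪v, (x * y) v⟫_ℂ = ⟪v, (y * x) v⟫_ℂ) : TracialState S where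
  toLin :=
    { toFun := fun c => ⟪v, (c : H →L[ℂ] H) v⟫_ℂ
      map_add' := fun c d => by
        rw [AddMemClass.coe_add, add_apply, inner_add_right]
      map_smul' := fun r c => by
        change ⟪v, (r • (c : H →L[ℂ] H)) v⟫_ℂ = _
        rw [smul_apply, inner_smul_right]; rfl }
  map_one := by
    change ⟪v, (1 : H →L[ℂ] H) v⟫_ℂ = 1
    rw [one_apply_eq_self, inner_self_eq_norm_sq_to_K, hv]
    simp
  nonneg c := by
    change 0 ≤ ⟪v, (star (c : H →L[ℂ] H) * (c : H →L[ℂ] H)) v⟫_ℂ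
    rw [mul_apply_eq_comp, ContinuousLinearMap.star_eq_adjoint,
      ContinuousLinearMap.adjoint_inner_right]
    exact complex_inner_self_nonneg _
  tracial c d := htr _ c.2 _ d.2

/-- A vector state that is tracial on an algebra of operators is tracial on its norm closure. -/
theorem tracial_topologicalClosure (S : StarSubalgebra ℂ (H →L[ℂ] H)) {v : H}
    (htr : ∀ x ∈ S, ∀ y ∈ S, ⟪v, (x * y) v⟫_ℂ = ⟪v, (y * x) v⟫_ℂ) :
    ∀ x ∈ S.topologicalClosure, ∀ y ∈ S.topologicalClosure,
      ⟪v, (x * y) v⟫_ℂ = ⟪v, (y * x) v⟫_ℂ := by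
  intro x hx
  refine closure_minimal (fun y hy => ?_) (isClosed_eq (by fun_prop) (by fun_prop))
  revert x
  refine closure_minimal (fun x hx => htr x hx y hy) (isClosed_eq (by fun_prop) (by fun_prop))

theorem vectorTrace_normSq {S : StarSubalgebra ℂ (H →L[ℂ] H)} {v : H}
    (χ : TracialState S) (hχ : ∀ c, χ.toLin c = ⟪v, (c : H →L[ℂ] H) v⟫_ℂ) (c : S) :
    χ.normSq c = ‖(c : H →L[ℂ] H) v‖ ^ 2 := by
  rw [TracialState.normSq, hχ]
  change (⟪v, (star (c : H →L[ℂ] H) * (c : H →L[ℂ] H)) v⟫_ℂ).re = _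
  rw [mul_apply_eq_comp, ContinuousLinearMap.star_eq_adjoint,
    ContinuousLinearMap.adjoint_inner_right, inner_self_eq_norm_sq_to_K]
  norm_cast

/-- A tracial vector state is faithful if the vector is cyclic. -/
theorem vectorTrace_faithful {S : StarSubalgebra ℂ (H →L[ℂ] H)} {v : H}
    (χ : TracialState S) (hχ : ∀ c, χ.toLin c = ⟪v, (c : H →L[ℂ] H) v⟫_ℂ)
    (hd : Dense {x : H | ∃ c : S, x = (c : H →L[ℂ] H) v}) (c : S) (hc : (c : H →L[ℂ] H) v = 0) :
    c = 0 := by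
  have h0 : ∀ c : S, (c : H →L[ℂ] H) v = 0 ↔ χ.normSq c = 0 := fun c => by
    rw [vectorTrace_normSq χ hχ, sq_eq_zero_iff, norm_eq_zero]
  have hmul : ∀ d : S, (c : H →L[ℂ] H) ((d : H →L[ℂ] H) v) = 0 := by
    intro d
    have h1 : ((star d * star c : S) : H →L[ℂ] H) v = 0 := by
      change (star d : S).1 ((star c : S).1 v) = 0
      rw [(h0 (star c)).2 (by rw [χ.normSq_star]; exact (h0 c).1 hc), map_zero]
    rw [h0, ← star_mul, χ.normSq_star, ← h0] at h1
    exact h1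
  refine Subtype.ext (DFunLike.coe_injective (Continuous.ext_on hd (map_continuous _)
    (map_continuous _) ?_))
  rintro _ ⟨d, rfl⟩
  exact hmul d

end VectorTrace

section Limit

variable {𝒜 : Type} [Ring 𝒜] [StarRing 𝒜] [Algebra ℂ 𝒜]

/-- The GNS representation of a bounded tracial state generates a `C*`-algebra with a faithful
tracial state. -/
theorem BddPosFunctional.exists_faithful [StarModule ℂ 𝒜] (f : BddPosFunctional 𝒜)
    (h1 : f.toLin 1 = 1) (htr : ∀ a b, f.toLin (a * b) = f.toLin (b * a)) :
    ∃ (C : Type) (_ : CStarAlgebra C) (π : 𝒜 →⋆ₐ[ℂ] C) (χ : TracialState C), χ.Faithful ∧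
      ∀ a, χ.toLin (π a) = f.toLin a := by
  let S : StarSubalgebra ℂ (f.GNS →L[ℂ] f.GNS) := f.gns.range
  have hcl : IsClosed (S.topologicalClosure : Set (f.GNS →L[ℂ] f.GNS)) :=
    S.isClosed_topologicalClosure
  let π : 𝒜 →⋆ₐ[ℂ] S.topologicalClosure := f.gns.codRestrict _ fun a =>
    S.le_topologicalClosure ⟨a, rfl⟩
  have hv : ‖f.gnsVec‖ = 1 := by
    have h := f.inner_vec_gns_vec 1
    rw [map_one, one_apply_eq_self, h1] at h
    refine (sq_eq_sq₀ (norm_nonneg _) zero_le_one).1 ?_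
    rw [@norm_sq_eq_re_inner ℂ, h, one_pow, RCLike.one_re]
  let χ : TracialState S.topologicalClosure :=
    vectorTrace S.topologicalClosure hv (tracial_topologicalClosure S (by
      rintro _ ⟨a, rfl⟩ _ ⟨b, rfl⟩
      change ⟪f.gnsVec, (f.gns a * f.gns b) f.gnsVec⟫_ℂ =
        ⟪f.gnsVec, (f.gns b * f.gns a) f.gnsVec⟫_ℂ
      rw [← map_mul, ← map_mul, f.inner_vec_gns_vec, f.inner_vec_gns_vec, htr]))
  have hχ : ∀ c, χ.toLin c = ⟪f.gnsVec, (c : f.GNS →L[ℂ] f.GNS) f.gnsVec⟫_ℂ := fun c => rfl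
  refine ⟨S.topologicalClosure, inferInstance, π, χ, fun c hc => ?_, fun a => ?_⟩
  · refine vectorTrace_faithful χ hχ (f.dense_gns_vec.mono ?_) c ?_
    · rintro _ ⟨a, rfl⟩
      exact ⟨π a, rfl⟩
    · have := vectorTrace_normSq χ hχ c
      rw [TracialState.normSq, hc, Complex.zero_re, eq_comm, sq_eq_zero_iff, norm_eq_zero] at this
      exact this
  · rw [hχ]
    exact f.inner_vec_gns_vec a

/-- The limits of sequences of tracial states over `Q₁` on PVM algebras factor through faithful
tracial states on members of `Q`. -/
def Model.LimitClosed (Q₁ Q : Model) : Prop :=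
  ∀ (𝒜 : Type) [Ring 𝒜] [StarRing 𝒜] [Algebra ℂ 𝒜] [StarModule ℂ 𝒜], IsPVMAlgebra 𝒜 →
    ∀ τ : ℕ → TracialState 𝒜, (∀ n, Q₁.Over (τ n)) →
    ∃ (C : Type) (_ : CStarAlgebra C) (π : 𝒜 →⋆ₐ[ℂ] C) (χ : TracialState C), Q.mem C ∧
      χ.Faithful ∧ ∀ a, Tendsto (fun n => (τ n).toLin a) (hyperfilter ℕ) (𝓝 (χ.toLin (π a)))

theorem IsPVMAlgebra.exists_bddPosFunctional (h : IsPVMAlgebra 𝒜) {Q : Model}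
    {τ : ℕ → TracialState 𝒜} (hτ : ∀ n, Q.Over (τ n)) {ω : Ultrafilter ℕ} {τ' : TracialState 𝒜}
    (hlim : ∀ a, Tendsto (fun n => (τ n).toLin a) ω (𝓝 (τ'.toLin a))) :
    ∃ f : BddPosFunctional 𝒜, f.toLin = τ'.toLin := by
  refine ⟨⟨τ'.toLin, τ'.nonneg, fun a => ?_⟩, rfl⟩
  obtain ⟨M, hM, hb⟩ := h.exists_bound a
  refine ⟨M, hM, fun b => ?_⟩
  have h1 := fun c => (Complex.continuous_re.tendsto _).comp (hlim c)
  refine le_of_tendsto_of_tendsto (h1 _) ((h1 _).const_mul (M ^ 2))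
    (Eventually.of_forall fun n => ?_)
  obtain ⟨B, _, π, φ, -, -, hφ⟩ := hτ n
  change (τ n).normSq (a * b) ≤ M ^ 2 * (τ n).normSq b
  rw [TracialState.normSq_of_eq hφ, TracialState.normSq_of_eq hφ, map_mul, φ.normSq_eq, φ.normSq_eq,
    ← mul_pow]
  gcongr
  exact (φ.norm_vec_mul_le _ _).trans (mul_le_mul_of_nonneg_right (hb B π) (norm_nonneg _))

theorem IsPVMAlgebra.exists_tendsto (h : IsPVMAlgebra 𝒜) {Q : Model}
    {τ : ℕ → TracialState 𝒜} (hτ : ∀ n, Q.Over (τ n)) (ω : Ultrafilter ℕ) :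
    ∃ τ' : TracialState 𝒜, ∀ a, Tendsto (fun n => (τ n).toLin a) ω (𝓝 (τ'.toLin a)) := by
  refine TracialState.exists_tendsto ω τ fun a => ?_
  obtain ⟨M, -, hb⟩ := h.exists_bound a
  refine ⟨M, fun n => ?_⟩
  obtain ⟨B, _, π, φ, -, -, hφ⟩ := hτ n
  rw [hφ]
  exact (φ.norm_toLin_le _).trans (hb B π)

theorem Model.limitClosed_of_faithful (Q₁ : Model) {Q : Model}
    (hQ : ∀ (C : Type) [CStarAlgebra C] (χ : TracialState C), χ.Faithful → Q.mem C) :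
    Q₁.LimitClosed Q := by
  intro 𝒜 _ _ _ _ h τ hτ
  obtain ⟨τ', hlim⟩ := h.exists_tendsto hτ (hyperfilter ℕ)
  obtain ⟨f, hf⟩ := h.exists_bddPosFunctional hτ hlim
  obtain ⟨C, _, π, χ, hχ, hπ⟩ := f.exists_faithful (by rw [hf, τ'.map_one])
    (by rw [hf]; exact τ'.tracial)
  refine ⟨C, _, π, χ, hQ C χ hχ, hχ, fun a => ?_⟩
  rw [hπ, hf]
  exact hlim a

theorem TracialState.nontrivial {B : Type} [CStarAlgebra B] (φ : TracialState B) :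
    Nontrivial B := by
  refine ⟨1, 0, fun h => ?_⟩
  have := φ.map_one
  rw [h, map_zero] at this
  exact zero_ne_one this

theorem Model.limitClosed_cstar (Q₁ : Model) : Q₁.LimitClosed Model.cstar :=
  Q₁.limitClosed_of_faithful fun _ _ χ _ => χ.nontrivial

theorem Model.limitClosed_qc (Q₁ : Model) : Q₁.LimitClosed Model.qc :=
  Q₁.limitClosed_of_faithful fun _ _ χ _ => ⟨χ⟩

theorem Model.limitClosed_qcFaithful (Q₁ : Model) : Q₁.LimitClosed Model.qcFaithful :=
  Q₁.limitClosed_of_faithful fun _ _ χ hχ => ⟨χ, hχ⟩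

end Limit

/-! ### Robustness by compactness -/

section Robust

variable {σ : Signature} {G A C : Type} [Fintype A] [Fintype G] [Fintype σ.Sym]
  {𝔾 : RelStr σ G} {𝔸 : RelStr σ A} {Q Q₁ : Model} {x y : G} [CStarAlgebra C]

theorem TracialState.Faithful.isPlusHom {χ : TracialState C} (hχ : χ.Faithful) {p : G → A → C}
    (hp : ∀ x, IsPVM (p x)) (h : violA 𝔾 𝔸 χ p = 0) : IsPlusHom 𝔾 𝔸 p := by
  refine ⟨hp, fun R z hz b hb => hχ.eq_zero (le_antisymm ?_ (χ.normSq_nonneg _))⟩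
  rw [← h]
  exact normSq_prodGen_le_violA χ p ⟨R, z, hz⟩ ⟨b, hb⟩

theorem TracialState.Faithful.isJointHom {χ : TracialState C} (hχ : χ.Faithful)
    {Φ : ∀ c : Constraint 𝔾, Sat 𝔸 c.1 → C} {p : G → A → C} (hΦ : ∀ c, IsPVM (Φ c))
    (hp : ∀ x, IsPVM (p x)) (h : violCV 𝔾 𝔸 χ Φ p = 0) : IsJointHom 𝔾 𝔸 Φ p := by
  refine ⟨hp, hΦ, fun c b i => hχ.eq_zero (le_antisymm ?_ (χ.normSq_nonneg _))⟩
  rw [← h]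
  exact normSq_le_violCV χ Φ p c b i

theorem commSq_eq_zero {𝒜 : Type} [Ring 𝒜] [StarRing 𝒜] [Algebra ℂ 𝒜] (χ : TracialState 𝒜)
    {p q : A → 𝒜} (h : ∀ a b, Commute (p a) (q b)) : commSq χ p q = 0 :=
  Finset.sum_eq_zero fun a _ => Finset.sum_eq_zero fun b _ => by
    rw [(h a b).eq, sub_self, χ.normSq_zero]

theorem TracialState.Faithful.commute {χ : TracialState C} (hχ : χ.Faithful) {p q : A → C}
    (h : commSq χ p q = 0) (a b : A) : Commute (p a) (q b) := by
  rw [commute_iff_eq, ← sub_eq_zero]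
  refine hχ.eq_zero ?_
  have h1 := (Finset.sum_eq_zero_iff_of_nonneg fun a _ => Finset.sum_nonneg fun b _ =>
    χ.normSq_nonneg _).1 h a (Finset.mem_univ a)
  exact (Finset.sum_eq_zero_iff_of_nonneg fun b _ => χ.normSq_nonneg _).1 h1 b (Finset.mem_univ b)

/-- By compactness, a gadget is robust: a sequence of counterexamples has a limit, which is an exact
quantum homomorphism without commutation. -/
theorem IsGadget.aRobustBound (hcl : Q₁.LimitClosed Q) (hg : IsGadget Q 𝔸 𝔾 x y) :
    ARobustBound Q₁ 𝔸 𝔾 x y := by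
  rw [isGadget_iff] at hg
  by_contra hcon
  rw [ARobustBound] at hcon
  push Not at hcon
  obtain ⟨ε, hε, h⟩ := hcon
  have h' : ∀ n : ℕ, ∃ τ : TracialState (MorA G A), Q₁.Over τ ∧
      violA 𝔾 𝔸 τ MorA.p < 1 / ((n : ℝ) + 1) ∧ ε ≤ commSq τ (MorA.p x) (MorA.p y) := by
    intro n
    obtain ⟨B, _, hB, φ, hφ, p, hp, h1, h2⟩ := h (1 / ((n : ℝ) + 1)) (by positivity)
    obtain ⟨ρ, hρ⟩ := exists_lift_morA p hp
    have e : ∀ a, (φ.comp ρ).toLin a = φ.toLin (ρ a) := fun a => rfl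
    refine ⟨φ.comp ρ, ⟨B, _, ρ, φ, hB, hφ, e⟩, ?_, ?_⟩
    · rw [violA_of_eq e]; simpa only [hρ] using h1
    · rw [commSq_of_eq e]; simpa only [hρ] using h2
  choose τ hτ h1 h2 using h'
  obtain ⟨C, _, π, χ, hC, hχ, hlim⟩ := hcl _ isPVMAlgebra_morA τ hτ
  have hn := TracialState.tendsto_normSq hlim
  have hv : Tendsto (fun n => violA 𝔾 𝔸 (τ n) MorA.p) (hyperfilter ℕ)
      (𝓝 (violA 𝔾 𝔸 χ fun x a => π (MorA.p x a))) := by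
    simp only [violA, ← map_prodGen]
    exact tendsto_finsetSum _ fun _ _ => tendsto_finsetSum _ fun _ _ => hn _
  have hc : Tendsto (fun n => commSq (τ n) (MorA.p (A := A) x) (MorA.p y)) (hyperfilter ℕ)
      (𝓝 (commSq χ (fun a => π (MorA.p x a)) fun a => π (MorA.p y a))) := by
    simp only [commSq, ← map_mul, ← map_sub]
    exact tendsto_finsetSum _ fun _ _ => tendsto_finsetSum _ fun _ _ => hn _
  have h0 : violA 𝔾 𝔸 χ (fun x a => π (MorA.p x a)) = 0 := by
    refine le_antisymm ?_ (violA_nonneg _ _)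
    exact le_of_tendsto_of_tendsto hv
      (tendsto_one_div_add_atTop_nhds_zero_nat.mono_left Nat.hyperfilter_le_atTop)
      (Eventually.of_forall fun n => (h1 n).le)
  have h3 := ge_of_tendsto hc (Eventually.of_forall h2)
  rw [commSq_eq_zero χ (hg.2 C hC _ (hχ.isPlusHom (fun x => (isPVM_morA x).map π) h0))] at h3
  exact hε.not_ge h3

theorem IsOracularGadget.cvRobustBound (hcl : Q₁.LimitClosed Q) (hg : IsOracularGadget Q 𝔸 𝔾 x y) :
    CVRobustBound Q₁ 𝔸 𝔾 x y := by
  rw [isOracularGadget_iff] at hg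
  by_contra hcon
  rw [CVRobustBound] at hcon
  push Not at hcon
  obtain ⟨ε, hε, h⟩ := hcon
  have h' : ∀ n : ℕ, ∃ τ : TracialState (MorCV 𝔾 𝔸), Q₁.Over τ ∧
      violCV 𝔾 𝔸 τ (MorCV.phi 𝔾 𝔸) (MorCV.p 𝔾 𝔸) < 1 / ((n : ℝ) + 1) ∧
      ε ≤ commSq τ (MorCV.p 𝔾 𝔸 x) (MorCV.p 𝔾 𝔸 y) := by
    intro n
    obtain ⟨B, _, hB, φ, hφ, Φ, p, hΦ, hp, h1, h2⟩ := h (1 / ((n : ℝ) + 1)) (by positivity)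
    obtain ⟨ρ, hρ, hρ'⟩ := exists_lift_morCV (𝔸 := 𝔸) Φ p hΦ hp
    have e : ∀ a, (φ.comp ρ).toLin a = φ.toLin (ρ a) := fun a => rfl
    refine ⟨φ.comp ρ, ⟨B, _, ρ, φ, hB, hφ, e⟩, ?_, ?_⟩
    · rw [violCV_of_eq e]; simpa only [hρ, hρ'] using h1
    · rw [commSq_of_eq e]; simpa only [hρ'] using h2
  choose τ hτ h1 h2 using h'
  obtain ⟨C, _, π, χ, hC, hχ, hlim⟩ := hcl _ isPVMAlgebra_morCV τ hτ
  have hn := TracialState.tendsto_normSq hlim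
  have hv : Tendsto (fun n => violCV 𝔾 𝔸 (τ n) (MorCV.phi 𝔾 𝔸) (MorCV.p 𝔾 𝔸)) (hyperfilter ℕ)
      (𝓝 (violCV 𝔾 𝔸 χ (fun c b => π (MorCV.phi 𝔾 𝔸 c b)) fun x a => π (MorCV.p 𝔾 𝔸 x a))) := by
    have e : violCV 𝔾 𝔸 χ (fun c b => π (MorCV.phi 𝔾 𝔸 c b)) (fun x a => π (MorCV.p 𝔾 𝔸 x a)) =
        ∑ c : Constraint 𝔾, ∑ b : Sat 𝔸 c.1, ∑ i : Fin (σ.ar c.1),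
          χ.normSq (π (MorCV.phi 𝔾 𝔸 c b * (1 - MorCV.p 𝔾 𝔸 (c.2.1 i) (b.1 i)))) := by
      simp only [violCV, map_mul, map_sub, map_one]
    rw [e]
    exact tendsto_finsetSum _ fun _ _ => tendsto_finsetSum _ fun _ _ =>
      tendsto_finsetSum _ fun _ _ => hn _
  have hc : Tendsto (fun n => commSq (τ n) (MorCV.p 𝔾 𝔸 x) (MorCV.p 𝔾 𝔸 y)) (hyperfilter ℕ)
      (𝓝 (commSq χ (fun a => π (MorCV.p 𝔾 𝔸 x a)) fun a => π (MorCV.p 𝔾 𝔸 y a))) := by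
    simp only [commSq, ← map_mul, ← map_sub]
    exact tendsto_finsetSum _ fun _ _ => tendsto_finsetSum _ fun _ _ => hn _
  have h0 : violCV 𝔾 𝔸 χ (fun c b => π (MorCV.phi 𝔾 𝔸 c b)) (fun x a => π (MorCV.p 𝔾 𝔸 x a)) =
    0 := by
    refine le_antisymm ?_ (violCV_nonneg _ _ _)
    exact le_of_tendsto_of_tendsto hv
      (tendsto_one_div_add_atTop_nhds_zero_nat.mono_left Nat.hyperfilter_le_atTop)
      (Eventually.of_forall fun n => (h1 n).le)
  have h3 := ge_of_tendsto hc (Eventually.of_forall h2)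
  rw [commSq_eq_zero χ (hg.2 C hC _ (hχ.isJointHom (fun c => (isPVM_morCV_phi c).map π)
    (fun x => (isPVM_morCV_p x).map π) h0).isOPlusHom)] at h3
  exact hε.not_ge h3

end Robust

/-! ### Algebras of operators with a tracial cyclic vector -/

section TracialVector

variable {H : Type} [NormedAddCommGroup H] [InnerProductSpace ℂ H] [CompleteSpace H]

/-- The vector `v` is cyclic for `U`, and its vector state is tracial on `U`. -/
structure IsTracialVec (U : StarSubalgebra ℂ (H →L[ℂ] H)) (v : H) : Prop where
  cyclic : Dense {x : H | ∃ T ∈ U, x = T v}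
  tracial : ∀ S ∈ U, ∀ T ∈ U, ⟪v, (S * T) v⟫_ℂ = ⟪v, (T * S) v⟫_ℂ

theorem inner_star_left (T : H →L[ℂ] H) (x y : H) : ⟪star T x, y⟫_ℂ = ⟪x, T y⟫_ℂ := by
  rw [ContinuousLinearMap.star_eq_adjoint, ContinuousLinearMap.adjoint_inner_left]

theorem inner_star_right (T : H →L[ℂ] H) (x y : H) : ⟪x, star T y⟫_ℂ = ⟪T x, y⟫_ℂ := by
  rw [ContinuousLinearMap.star_eq_adjoint, ContinuousLinearMap.adjoint_inner_right]

namespace IsTracialVec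

variable {U : StarSubalgebra ℂ (H →L[ℂ] H)} {v : H} (h : IsTracialVec U v)

/-- The map `T ↦ T v`. -/
def evalAt (U : StarSubalgebra ℂ (H →L[ℂ] H)) (v : H) : U →ₗ[ℂ] H where
  toFun T := T.1 v
  map_add' _ _ := rfl
  map_smul' _ _ := rfl

include h

theorem denseRange_evalAt : DenseRange (evalAt U v) := by
  refine h.cyclic.mono ?_
  rintro _ ⟨T, hT, rfl⟩
  exact ⟨⟨T, hT⟩, rfl⟩

theorem inner_comm {S T : H →L[ℂ] H} (hS : S ∈ U) (hT : T ∈ U) :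
    ⟪S v, T v⟫_ℂ = ⟪star T v, star S v⟫_ℂ := by
  rw [← inner_star_right, inner_star_left]
  exact h.tracial (star S) (star_mem hS) T hT

theorem norm_star_apply {T : H →L[ℂ] H} (hT : T ∈ U) : ‖star T v‖ = ‖T v‖ := by
  have := h.inner_comm hT hT
  rw [inner_self_eq_norm_sq_to_K, inner_self_eq_norm_sq_to_K] at this
  have h2 : ‖T v‖ ^ 2 = ‖star T v‖ ^ 2 := by exact_mod_cast this
  exact ((sq_eq_sq₀ (norm_nonneg _) (norm_nonneg _)).1 h2).symm

/-- Right multiplications extend to operators in the commutant. -/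
theorem exists_rightMul {S : H →L[ℂ] H} (hS : S ∈ U) :
    ∃ ρ : H →L[ℂ] H, ρ ∈ StarSubalgebra.centralizer ℂ (U : Set (H →L[ℂ] H)) ∧
      ∀ T ∈ U, ρ (T v) = T (S v) := by
  let f : U →ₗ[ℂ] H := evalAt U (S v)
  have hb : ∀ T : U, ‖f T‖ ≤ ‖S‖ * ‖evalAt U v T‖ := by
    intro T
    have h1 : ‖f T‖ = ‖star (T.1 * S) v‖ := (h.norm_star_apply (mul_mem T.2 hS)).symm
    rw [h1, star_mul]
    refine ((star S).le_opNorm _).trans ?_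
    rw [norm_star]
    exact mul_le_mul_of_nonneg_left (h.norm_star_apply T.2).le (norm_nonneg _)
  have hρ : ∀ T ∈ U, f.extendOfNorm (evalAt U v) (T v) = T (S v) := fun T hT =>
    LinearMap.extendOfNorm_eq h.denseRange_evalAt ⟨_, hb⟩ ⟨T, hT⟩
  have hcomm : ∀ T ∈ U, T * f.extendOfNorm (evalAt U v) = f.extendOfNorm (evalAt U v) * T := by
    intro T hT
    refine DFunLike.coe_injective (Continuous.ext_on h.cyclic (map_continuous _)
      (map_continuous _) ?_)
    rintro _ ⟨T', hT', rfl⟩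
    change T (f.extendOfNorm (evalAt U v) (T' v)) = f.extendOfNorm (evalAt U v) ((T * T') v)
    rw [hρ _ hT', hρ _ (mul_mem hT hT')]
    rfl
  exact ⟨_, (StarSubalgebra.mem_centralizer_iff ℂ).2 fun T hT =>
    ⟨hcomm T hT, hcomm _ (star_mem hT)⟩, hρ⟩

/-- The map `T v ↦ T* v` extends to an antiunitary involution, and `⟪J x, y⟫ = ⟪J y, x⟫`. -/
theorem exists_conjugation : ∃ J : H → H, Continuous J ∧ (∀ T ∈ U, J (T v) = star T v) ∧
    ∀ x y, ⟪J x, y⟫_ℂ = ⟪J y, x⟫_ℂ := by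
  let f : U →ₛₗ[starRingEnd ℂ] H :=
    { toFun := fun T => star T.1 v
      map_add' := fun S T => by
        change star (S.1 + T.1) v = _
        rw [star_add]; rfl
      map_smul' := fun c T => by
        change star (c • T.1) v = _
        rw [star_smul]; rfl }
  have hb : ∀ T : U, ‖f T‖ ≤ 1 * ‖evalAt U v T‖ := fun T => by
    rw [one_mul]
    exact (h.norm_star_apply T.2).le
  have hJ : ∀ T ∈ U, f.extendOfNorm (evalAt U v) (T v) = star T v := fun T hT =>
    LinearMap.extendOfNorm_eq h.denseRange_evalAt ⟨_, hb⟩ ⟨T, hT⟩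
  refine ⟨f.extendOfNorm (evalAt U v), map_continuous _, hJ, fun x y => ?_⟩
  have hcont : Continuous (f.extendOfNorm (evalAt U v)) := map_continuous _
  revert y
  refine h.cyclic.induction (P := fun x => ∀ y, ⟪f.extendOfNorm (evalAt U v) x, y⟫_ℂ =
    ⟪f.extendOfNorm (evalAt U v) y, x⟫_ℂ) ?_ ?_ x
  · rintro _ ⟨S, hS, rfl⟩ y
    refine h.cyclic.induction (P := fun y => ⟪f.extendOfNorm (evalAt U v) (S v), y⟫_ℂ =
      ⟪f.extendOfNorm (evalAt U v) y, S v⟫_ℂ) ?_ (isClosed_eq (by fun_prop) (by fun_prop)) y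
    rintro _ ⟨T, hT, rfl⟩
    rw [hJ S hS, hJ T hT, h.inner_comm (star_mem hS) hT, star_star]
  · simp only [Set.ofPred_forall]
    exact isClosed_iInter fun y => isClosed_eq (by fun_prop) (by fun_prop)

/-- The vector state of a tracial cyclic vector is tracial on the double commutant. -/
theorem tracial_centralizer {a b : H →L[ℂ] H}
    (ha : a ∈ StarSubalgebra.centralizer ℂ
      (StarSubalgebra.centralizer ℂ (U : Set (H →L[ℂ] H)) : Set (H →L[ℂ] H)))
    (hb : b ∈ StarSubalgebra.centralizer ℂ
      (StarSubalgebra.centralizer ℂ (U : Set (H →L[ℂ] H)) : Set (H →L[ℂ] H))) :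
    ⟪v, (a * b) v⟫_ℂ = ⟪v, (b * a) v⟫_ℂ := by
  obtain ⟨J, hJc, hJ, hJs⟩ := h.exists_conjugation
  have key : ∀ a ∈ StarSubalgebra.centralizer ℂ
      (StarSubalgebra.centralizer ℂ (U : Set (H →L[ℂ] H)) : Set (H →L[ℂ] H)),
      J (a v) = star a v := by
    intro a ha
    refine ext_inner_right ℂ fun y => ?_
    refine h.cyclic.induction (P := fun y => ⟪J (a v), y⟫_ℂ = ⟪star a v, y⟫_ℂ) ?_
      (isClosed_eq (by fun_prop) (by fun_prop)) y
    rintro _ ⟨S, hS, rfl⟩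
    obtain ⟨ρ, hρ, hρS⟩ := h.exists_rightMul hS
    have h1 : a * ρ = ρ * a := (((StarSubalgebra.mem_centralizer_iff ℂ).1 ha ρ hρ).1).symm
    have h2 : ρ v = S v := hρS 1 (one_mem _)
    -- The adjoint of a right multiplication is the right multiplication by the adjoint.
    have h3 : star ρ v = star S v := by
      refine ext_inner_right ℂ fun z => ?_
      refine h.cyclic.induction (P := fun z => ⟪star ρ v, z⟫_ℂ = ⟪star S v, z⟫_ℂ) ?_
        (isClosed_eq (by fun_prop) (by fun_prop)) z
      rintro _ ⟨T, hT, rfl⟩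
      rw [inner_star_left, inner_star_left, hρS T hT]
      exact h.tracial T hT S hS
    rw [hJs, hJ S hS, inner_star_left a, ← h2]
    change _ = ⟪v, (a * ρ) v⟫_ℂ
    rw [h1]
    change _ = ⟪v, ρ (a v)⟫_ℂ
    rw [← inner_star_left ρ, h3]
  have h1 := hJs (star a v) (b v)
  have h2 := key (star a) (star_mem ha)
  rw [star_star] at h2
  rw [h2, key b hb] at h1
  have h3 : ⟪v, (a * b) v⟫_ℂ = ⟪J (a v), b v⟫_ℂ := by
    rw [key a ha, inner_star_left]; rfl
  have h4 : ⟪v, (b * a) v⟫_ℂ = ⟪J (b v), a v⟫_ℂ := by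
    rw [key b hb, inner_star_left]; rfl
  rw [h3, h4, hJs]

end IsTracialVec

end TracialVector

section

open Filter

/-! ### Ranges of `*`-homomorphisms -/

section Range

variable {A B : Type} [CStarAlgebra A] [CStarAlgebra B]

/-- Self-adjoint elements of the range have lifts of the same norm, by truncation. -/
theorem exists_lift_norm_le_of_isSelfAdjoint (ρ : A →⋆ₐ[ℂ] B) {x : A} (hx : IsSelfAdjoint x) :
    ∃ x', ρ x' = ρ x ∧ ‖x'‖ ≤ ‖ρ x‖ := by
  let M := ‖ρ x‖
  have hM : 0 ≤ M := norm_nonneg _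
  let f : ℝ → ℝ := fun t => max (-M) (min t M)
  have hf : Continuous f := by fun_prop
  refine ⟨cfc f x, ?_, norm_cfc_le hM fun t _ => ?_⟩
  · have hρ : Continuous ρ := AddMonoidHomClass.continuous_of_bound ρ 1 fun x => by
      rw [one_mul]; exact NonUnitalStarAlgHom.norm_apply_le ρ x
    rw [StarAlgHomClass.map_cfc (S := ℂ) ρ f x hf.continuousOn hρ hx (hx.map ρ)]
    conv_rhs => rw [← cfc_id ℝ (ρ x) (hx.map ρ)]
    refine cfc_congr fun t ht => ?_
    have hn : Nontrivial B := by
      by_contra hn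
      rw [not_nontrivial_iff_subsingleton] at hn
      rw [spectrum.of_subsingleton] at ht
      exact ht
    have h1 : |t| ≤ M := spectrum.norm_le_norm_of_mem ht
    obtain ⟨h2, h3⟩ := abs_le.1 h1
    change max (-M) (min t M) = t
    rw [min_eq_left h3, max_eq_right h2]
  · rw [Real.norm_eq_abs, abs_le]
    exact ⟨le_max_left _ _, max_le (by linarith) (min_le_right _ _)⟩

theorem exists_lift_norm_le (ρ : A →⋆ₐ[ℂ] B) (x : A) : ∃ x', ρ x' = ρ x ∧ ‖x'‖ ≤ 2 * ‖ρ x‖ := by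
  have hs : ∀ y : A, ρ (realPart y : A) = (realPart (ρ y) : B) := fun y => by
    rw [realPart_apply_coe, realPart_apply_coe, ← Complex.coe_smul, map_smul, Complex.coe_smul,
      map_add, map_star]
  have hi : ∀ y : A, ρ (imaginaryPart y : A) = (imaginaryPart (ρ y) : B) := fun y => by
    rw [imaginaryPart_apply_coe, imaginaryPart_apply_coe, map_smul, ← Complex.coe_smul, map_smul,
      Complex.coe_smul, map_sub, map_star]
  obtain ⟨a, ha, ha'⟩ := exists_lift_norm_le_of_isSelfAdjoint ρ (realPart x).2
  obtain ⟨b, hb, hb'⟩ := exists_lift_norm_le_of_isSelfAdjoint ρ (imaginaryPart x).2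
  refine ⟨a + Complex.I • b, ?_, ?_⟩
  · rw [map_add, map_smul, ha, hb, ← map_smul, ← map_add, realPart_add_I_smul_imaginaryPart]
  · rw [hs] at ha'
    rw [hi] at hb'
    have h1 : ‖(realPart (ρ x) : B)‖ ≤ ‖ρ x‖ := realPart.norm_le (ρ x)
    have h2 : ‖(imaginaryPart (ρ x) : B)‖ ≤ ‖ρ x‖ := imaginaryPart.norm_le (ρ x)
    refine (norm_add_le _ _).trans ?_
    rw [norm_smul, Complex.norm_I, one_mul]
    linarith

theorem isClosed_range (ρ : A →⋆ₐ[ℂ] B) : IsClosed (ρ.range : Set B) := by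
  let f : NormedAddGroupHom A B :=
    { toFun := ρ
      map_add' := map_add ρ
      bound' := ⟨1, fun x => by
        rw [one_mul]; exact NonUnitalStarAlgHom.norm_apply_le ρ x⟩ }
  let K : AddSubgroup B := ρ.range.toSubalgebra.toSubmodule.toAddSubgroup
  have h1 : f.SurjectiveOnWith K 2 := by
    rintro _ ⟨x, rfl⟩
    exact exists_lift_norm_le ρ x
  have h2 := controlled_closure_of_complete two_pos one_pos h1
  refine isClosed_of_closure_subset fun y hy => ?_
  obtain ⟨x, hx, -⟩ := h2 y hy
  exact ⟨x, hx⟩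

/-- Every tracial state on a `C*`-algebra is faithful on a quotient. -/
theorem TracialState.exists_faithful_quotient (τ : TracialState A) :
    ∃ (C : Type) (_ : CStarAlgebra C) (g : A →⋆ₐ[ℂ] C) (χ : TracialState C),
      Function.Surjective g ∧ χ.Faithful ∧ ∀ a, χ.toLin (g a) = τ.toLin a := by
  have h1 : τ.func.toLin 1 = 1 := τ.map_one
  have htr : ∀ a b, τ.func.toLin (a * b) = τ.func.toLin (b * a) := τ.tracial
  generalize hf : τ.func = f at h1 htr
  have hτ : ∀ a, τ.toLin a = f.toLin a := fun a => by rw [← hf]; rfl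
  have hcl : IsClosed (f.gns.range : Set (f.GNS →L[ℂ] f.GNS)) := isClosed_range f.gns
  have hv : ‖f.gnsVec‖ = 1 := by
    have h := f.inner_vec_gns_vec 1
    rw [_root_.map_one, one_apply_eq_self, h1] at h
    refine (sq_eq_sq₀ (norm_nonneg _) zero_le_one).1 ?_
    rw [@norm_sq_eq_re_inner ℂ, h, one_pow, RCLike.one_re]
  let χ : TracialState f.gns.range := vectorTrace f.gns.range hv (by
    rintro _ ⟨a, rfl⟩ _ ⟨b, rfl⟩
    change ⟪f.gnsVec, (f.gns a * f.gns b) f.gnsVec⟫_ℂ =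
      ⟪f.gnsVec, (f.gns b * f.gns a) f.gnsVec⟫_ℂ
    rw [← map_mul, ← map_mul, f.inner_vec_gns_vec, f.inner_vec_gns_vec, htr])
  have hχ : ∀ c, χ.toLin c = ⟪f.gnsVec, (c : f.GNS →L[ℂ] f.GNS) f.gnsVec⟫_ℂ := fun c => rfl
  refine ⟨f.gns.range, inferInstance, f.gns.rangeRestrict, χ, ?_, fun c hc => ?_, fun a => ?_⟩
  · rintro ⟨_, a, rfl⟩
    exact ⟨a, rfl⟩
  · refine vectorTrace_faithful χ hχ (f.dense_gns_vec.mono ?_) c ?_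
    · rintro _ ⟨a, rfl⟩
      exact ⟨f.gns.rangeRestrict a, rfl⟩
    · have := vectorTrace_normSq χ hχ c
      rw [TracialState.normSq, hc, Complex.zero_re, eq_comm, sq_eq_zero_iff, norm_eq_zero] at this
      exact this
  · rw [hχ, hτ]
    exact f.inner_vec_gns_vec a

end Range

/-! ### The hyperfinite factor -/

namespace HyperfiniteII₁

variable (R : HyperfiniteII₁)

theorem range_mat_mono {k l : ℕ} (h : k ≤ l) : Set.range (R.mat k) ⊆ Set.range (R.mat l) := by
  induction l, h using Nat.le_induction with
  | base => exact le_rfl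
  | succ l _ ih => exact ih.trans (R.mono l)

theorem exists_mat_eq {k l : ℕ} (h : k ≤ l) (a : Matrix (Fin (2 ^ k)) (Fin (2 ^ k)) ℂ) :
    ∃ b, R.mat l b = R.mat k a :=
  R.range_mat_mono h ⟨a, rfl⟩

/-- The union of the matrix algebras. -/
def localAlg : StarSubalgebra ℂ (R.H →L[ℂ] R.H) where
  carrier := ⋃ n, Set.range (R.mat n)
  mul_mem' := by
    simp only [Set.mem_iUnion]
    rintro _ _ ⟨k, a, rfl⟩ ⟨l, b, rfl⟩
    obtain ⟨a', ha⟩ := R.exists_mat_eq (le_max_left k l) a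
    obtain ⟨b', hb⟩ := R.exists_mat_eq (le_max_right k l) b
    exact ⟨max k l, a' * b', by rw [map_mul, ha, hb]⟩
  add_mem' := by
    simp only [Set.mem_iUnion]
    rintro _ _ ⟨k, a, rfl⟩ ⟨l, b, rfl⟩
    obtain ⟨a', ha⟩ := R.exists_mat_eq (le_max_left k l) a
    obtain ⟨b', hb⟩ := R.exists_mat_eq (le_max_right k l) b
    exact ⟨max k l, a' + b', by rw [map_add, ha, hb]⟩
  algebraMap_mem' r := Set.mem_iUnion.2 ⟨0, algebraMap ℂ _ r, AlgHomClass.commutes _ _⟩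
  star_mem' := by
    simp only [Set.mem_iUnion]
    rintro _ ⟨k, a, rfl⟩
    exact ⟨k, star a, map_star _ _⟩

theorem mat_mem_localAlg (k : ℕ) (a) : R.mat k a ∈ R.localAlg := Set.mem_iUnion.2 ⟨k, a, rfl⟩

theorem alg_eq : R.alg = StarSubalgebra.centralizer ℂ
    (StarSubalgebra.centralizer ℂ (R.localAlg : Set (R.H →L[ℂ] R.H)) : Set (R.H →L[ℂ] R.H)) := rfl

theorem isTracialVec : IsTracialVec R.localAlg R.vec where
  cyclic := by
    refine R.cyclic.mono ?_
    rintro _ ⟨n, a, rfl⟩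
    exact ⟨_, R.mat_mem_localAlg n a, rfl⟩
  tracial S hS T hT := by
    obtain ⟨k, a, rfl⟩ := Set.mem_iUnion.1 hS
    obtain ⟨l, b, rfl⟩ := Set.mem_iUnion.1 hT
    obtain ⟨a', ha⟩ := R.exists_mat_eq (le_max_left k l) a
    obtain ⟨b', hb⟩ := R.exists_mat_eq (le_max_right k l) b
    rw [← ha, ← hb, ← map_mul, ← map_mul, R.vec_trace, R.vec_trace, Matrix.trace_mul_comm]

theorem norm_vec : ‖R.vec‖ = 1 := by
  have h := R.vec_trace 0 1
  rw [map_one, one_apply_eq_self] at h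
  refine (sq_eq_sq₀ (norm_nonneg _) zero_le_one).1 ?_
  rw [@norm_sq_eq_re_inner ℂ, h]
  simp

theorem mat_mem_alg (k : ℕ) (a) : R.mat k a ∈ R.alg := by
  rw [alg_eq, StarSubalgebra.mem_centralizer_iff]
  intro g hg
  have h1 : ∀ g ∈ StarSubalgebra.centralizer ℂ (R.localAlg : Set (R.H →L[ℂ] R.H)),
      R.mat k a * g = g * R.mat k a := fun g hg =>
    ((StarSubalgebra.mem_centralizer_iff ℂ).1 hg _ (R.mat_mem_localAlg k a)).1
  exact ⟨(h1 g hg).symm, (h1 _ (star_mem hg)).symm⟩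

theorem isClosed_alg : IsClosed (R.alg : Set (R.H →L[ℂ] R.H)) := Set.isClosed_centralizer _

instance : IsClosed (R.alg : Set (R.H →L[ℂ] R.H)) := R.isClosed_alg

/-- The trace of the factor. -/
def trace : TracialState R.alg :=
  vectorTrace R.alg R.norm_vec fun _ hx _ hy => R.isTracialVec.tracial_centralizer hx hy

theorem trace_apply (a : R.alg) : R.trace.toLin a = R.tr a := rfl

theorem trace_normSq (a : R.alg) : R.trace.normSq a = ‖(a : R.H →L[ℂ] R.H) R.vec‖ ^ 2 :=
  vectorTrace_normSq R.trace R.trace_apply a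

theorem norm_star_apply_vec {a : R.H →L[ℂ] R.H} (ha : a ∈ R.alg) : ‖star a R.vec‖ = ‖a R.vec‖ := by
  have h := R.trace.normSq_star ⟨a, ha⟩
  rw [trace_normSq, trace_normSq] at h
  exact (sq_eq_sq₀ (norm_nonneg _) (norm_nonneg _)).1 h

/-! ### The ultrapower -/

variable (ω : Ultrafilter ℕ)

/-- The bounded sequences as functions to the factor. -/
def ofSeq : R.boundedSeq →⋆ₐ[ℂ] BoundedContinuousFunction ℕ R.alg where
  toFun x := BoundedContinuousFunction.ofNormedAddCommGroupDiscrete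
    (fun n => ⟨x.1 n, x.2.1 n⟩) x.2.2.choose x.2.2.choose_spec
  map_one' := rfl
  map_mul' _ _ := rfl
  map_zero' := rfl
  map_add' _ _ := rfl
  commutes' _ := rfl
  map_star' _ := rfl

theorem ofSeq_surjective : Function.Surjective R.ofSeq := fun b =>
  ⟨⟨fun n => (b n : R.H →L[ℂ] R.H), fun n => (b n).2, ‖b‖, fun n => b.norm_coe_le_norm n⟩, rfl⟩

/-- The evaluation of a sequence at an index. -/
def evalSeq (n : ℕ) : BoundedContinuousFunction ℕ R.alg →⋆ₐ[ℂ] R.alg where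
  toFun x := x n
  map_one' := rfl
  map_mul' _ _ := rfl
  map_zero' := rfl
  map_add' _ _ := rfl
  commutes' _ := rfl
  map_star' _ := rfl

theorem toUltra_star (x : R.boundedSeq) : R.toUltra ω (star x) = star (R.toUltra ω x) := by
  have h : ∀ y, R.toUltra ω y = RingQuot.mkRingHom (R.ultraRel ω) y := fun y => by
    rw [← RingQuot.mkAlgHom_coe ℂ]; rfl
  rw [h, h]
  simp only [RingQuot.mkRingHom_def]
  rfl

/-- The quotient map to the ultrapower. -/
def toUltraHom : R.boundedSeq →⋆ₐ[ℂ] R.Ultrapower ω where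
  toFun := R.toUltra ω
  map_one' := map_one (RingQuot.mkAlgHom ℂ (R.ultraRel ω))
  map_mul' := map_mul (RingQuot.mkAlgHom ℂ (R.ultraRel ω))
  map_zero' := map_zero (RingQuot.mkAlgHom ℂ (R.ultraRel ω))
  map_add' := map_add (RingQuot.mkAlgHom ℂ (R.ultraRel ω))
  commutes' := AlgHomClass.commutes (RingQuot.mkAlgHom ℂ (R.ultraRel ω))
  map_star' := R.toUltra_star ω

theorem toUltraHom_apply (x : R.boundedSeq) : R.toUltraHom ω x = R.toUltra ω x := rfl

theorem toUltra_surjective : Function.Surjective (R.toUltra ω) :=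
  RingQuot.mkAlgHom_surjective ℂ _

/-- The ultrapower is a `C*`-algebra with a faithful tracial state, the limit of the traces. -/
theorem exists_ultrapower_equiv :
    ∃ (C : Type) (_ : CStarAlgebra C) (e : R.Ultrapower ω ≃⋆ₐ[ℂ] C) (χ : TracialState C),
      χ.Faithful ∧ ∀ x : R.boundedSeq,
        Tendsto (fun n => R.tr (x.1 n)) ω (𝓝 (χ.toLin (e (R.toUltra ω x)))) := by
  obtain ⟨τ, hτ⟩ := TracialState.exists_tendsto ω (fun n => R.trace.comp (R.evalSeq n)) fun b =>
    ⟨‖b‖, fun n => (R.trace.norm_toLin_le _).trans (b.norm_coe_le_norm n)⟩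
  have hlim : ∀ b, Tendsto (fun n => ‖(b n : R.H →L[ℂ] R.H) R.vec‖ ^ 2) ω (𝓝 (τ.normSq b)) := by
    intro b
    have h1 := (Complex.continuous_re.tendsto _).comp (hτ (star b * b))
    refine h1.congr fun n => ?_
    rw [← R.trace_normSq]
    rfl
  obtain ⟨C, _, g, χ, hgs, hfaith, hχg⟩ := τ.exists_faithful_quotient
  have hker : ∀ b, g b = 0 ↔ Tendsto (fun n => ‖(b n : R.H →L[ℂ] R.H) R.vec‖) ω (𝓝 0) := by
    intro b
    have h1 : χ.normSq (g b) = τ.normSq b := by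
      rw [TracialState.normSq, ← map_star, ← map_mul, hχg]; rfl
    constructor
    · intro h
      rw [h, χ.normSq_zero] at h1
      have h2 := hlim b
      rw [← h1] at h2
      have h3 := (Real.continuous_sqrt.tendsto _).comp h2
      simpa only [Function.comp_def, Real.sqrt_sq (norm_nonneg _), Real.sqrt_zero] using h3
    · intro h
      refine hfaith.eq_zero ?_
      rw [h1]
      refine tendsto_nhds_unique (hlim b) ?_
      simpa using h.pow 2
  let f : R.boundedSeq →⋆ₐ[ℂ] C := g.comp R.ofSeq
  have hf : ∀ ⦃x y⦄, R.ultraRel ω x y → f x = f y := by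
    intro x y hxy
    rw [← sub_eq_zero, ← map_sub]
    exact (hker _).2 hxy.1
  let L₀ : R.Ultrapower ω →ₐ[ℂ] C := RingQuot.liftAlgHom ℂ ⟨f.toAlgHom, hf⟩
  have hL₀ : ∀ x, L₀ (R.toUltra ω x) = f x := fun x => RingQuot.liftAlgHom_mkAlgHom_apply ℂ _ hf x
  let L : R.Ultrapower ω →⋆ₐ[ℂ] C :=
    { L₀ with
      map_star' := fun u => by
        obtain ⟨x, rfl⟩ := R.toUltra_surjective ω u
        change L₀ (star (R.toUltra ω x)) = star (L₀ (R.toUltra ω x))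
        rw [← toUltra_star, hL₀, hL₀, map_star] }
  have hL : ∀ x, L (R.toUltra ω x) = f x := hL₀
  have hbij : Function.Bijective L := by
    constructor
    · rw [injective_iff_map_eq_zero]
      intro u hu
      obtain ⟨x, rfl⟩ := R.toUltra_surjective ω u
      rw [hL] at hu
      have h1 : Tendsto (fun n => ‖x.1 n R.vec‖) ω (𝓝 0) := (hker _).1 hu
      have h2 : R.ultraRel ω x 0 := by
        have e : ∀ n, x.1 n - (0 : R.boundedSeq).1 n = x.1 n := fun n => sub_zero _
        refine ⟨by simpa only [e] using h1, ?_⟩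
        simpa only [e, R.norm_star_apply_vec (x.2.1 _)] using h1
      have h3 : R.toUltra ω x = R.toUltra ω 0 := RingQuot.mkAlgHom_rel ℂ h2
      rw [h3, ← toUltraHom_apply, map_zero]
    · intro c
      obtain ⟨b, rfl⟩ := hgs c
      obtain ⟨x, rfl⟩ := R.ofSeq_surjective b
      exact ⟨R.toUltra ω x, hL x⟩
  refine ⟨C, inferInstance, StarAlgEquiv.ofBijective L hbij, χ, hfaith, fun x => ?_⟩
  · rw [StarAlgEquiv.ofBijective_apply, hL]
    have h1 := hτ (R.ofSeq x)
    rw [← hχg] at h1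
    exact h1

theorem toUltra_eq_zero_iff (x : R.boundedSeq) :
    R.toUltra ω x = 0 ↔ Tendsto (fun n => ‖x.1 n R.vec‖) ω (𝓝 0) := by
  obtain ⟨C, _, e, χ, hχ, hlim⟩ := R.exists_ultrapower_equiv ω
  have h1 : Tendsto (fun n => ‖x.1 n R.vec‖ ^ 2) ω (𝓝 (χ.normSq (e (R.toUltra ω x)))) := by
    have h := (Complex.continuous_re.tendsto _).comp (hlim (star x * x))
    have e2 : χ.toLin (e (R.toUltra ω (star x * x))) =
        χ.toLin (star (e (R.toUltra ω x)) * e (R.toUltra ω x)) := by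
      rw [← toUltraHom_apply, map_mul, map_star, map_mul, map_star]; rfl
    rw [e2] at h
    refine h.congr fun n => ?_
    exact R.trace_normSq ⟨x.1 n, x.2.1 n⟩
  constructor
  · intro h
    rw [h, map_zero, χ.normSq_zero] at h1
    have h3 := (Real.continuous_sqrt.tendsto _).comp h1
    simpa only [Function.comp_def, Real.sqrt_sq (norm_nonneg _), Real.sqrt_zero] using h3
  · intro h
    have h2 : χ.normSq (e (R.toUltra ω x)) = 0 := by
      refine tendsto_nhds_unique h1 ?_
      simpa using h.pow 2
    exact (map_eq_zero_iff e e.injective).1 (hχ.eq_zero h2)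

end HyperfiniteII₁

end

section

open Filter
open scoped Kronecker

/-! ### Matrix algebras -/

/-- The normalised trace of `M_d`. -/
def matTrace (d : ℕ) [NeZero d] : TracialState (Matrix (Fin d) (Fin d) ℂ) where
  toLin := (d : ℂ)⁻¹ • Matrix.traceLinearMap (Fin d) ℂ ℂ
  map_one := by
    have : (d : ℂ) ≠ 0 := Nat.cast_ne_zero.2 (NeZero.ne d)
    simp [this]
  nonneg a := by
    have h : (0 : ℂ) ≤ (d : ℂ)⁻¹ := by
      rw [← Complex.ofReal_natCast, ← Complex.ofReal_inv]
      exact Complex.zero_le_real.2 (inv_nonneg.2 (Nat.cast_nonneg d))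
    have h' : (0 : ℂ) ≤ (star a * a).trace :=
      (Matrix.posSemidef_conjTranspose_mul_self a).trace_nonneg
    exact mul_nonneg h h'
  tracial a b := by
    change (d : ℂ)⁻¹ * (a * b).trace = (d : ℂ)⁻¹ * (b * a).trace
    rw [Matrix.trace_mul_comm]

theorem matTrace_apply (d : ℕ) [NeZero d] (a : Matrix (Fin d) (Fin d) ℂ) :
    (matTrace d).toLin a = (d : ℂ)⁻¹ * a.trace := rfl

/-- The embedding `a ↦ a ⊗ 1` of `M_d` in `M_{de}`. -/
def kronLeft (d e : ℕ) :
    Matrix (Fin d) (Fin d) ℂ →⋆ₐ[ℂ] Matrix (Fin (d * e)) (Fin (d * e)) ℂ where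
  toFun a := Matrix.reindex finProdFinEquiv finProdFinEquiv (a ⊗ₖ (1 : Matrix (Fin e) (Fin e) ℂ))
  map_one' := by simp [Matrix.reindex_apply]
  map_mul' a b := by
    rw [Matrix.reindex_apply, Matrix.reindex_apply, Matrix.reindex_apply,
      Matrix.submatrix_mul_equiv,
      ← Matrix.mul_kronecker_mul, mul_one]
  map_zero' := by simp [Matrix.reindex_apply]
  map_add' a b := by simp [Matrix.reindex_apply, Matrix.add_kronecker, Matrix.submatrix_add]
  commutes' r := by
    rw [Matrix.reindex_apply, Algebra.algebraMap_eq_smul_one, Matrix.smul_kronecker,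
      Matrix.one_kronecker_one,
      Algebra.algebraMap_eq_smul_one]
    rw [Matrix.submatrix_smul, Pi.smul_apply, Pi.smul_apply, Matrix.submatrix_one_equiv]
  map_star' a := by
    simp [Matrix.reindex_apply, Matrix.star_eq_conjTranspose, Matrix.conjTranspose_kronecker]

/-- The embedding `b ↦ 1 ⊗ b` of `M_e` in `M_{de}`. -/
def kronRight (d e : ℕ) :
    Matrix (Fin e) (Fin e) ℂ →⋆ₐ[ℂ] Matrix (Fin (d * e)) (Fin (d * e)) ℂ where
  toFun b := Matrix.reindex finProdFinEquiv finProdFinEquiv ((1 : Matrix (Fin d) (Fin d) ℂ) ⊗ₖ b)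
  map_one' := by simp [Matrix.reindex_apply]
  map_mul' a b := by
    rw [Matrix.reindex_apply, Matrix.reindex_apply, Matrix.reindex_apply,
      Matrix.submatrix_mul_equiv,
      ← Matrix.mul_kronecker_mul, mul_one]
  map_zero' := by simp [Matrix.reindex_apply]
  map_add' a b := by simp [Matrix.reindex_apply, Matrix.kronecker_add, Matrix.submatrix_add]
  commutes' r := by
    rw [Matrix.reindex_apply, Algebra.algebraMap_eq_smul_one, Matrix.kronecker_smul,
      Matrix.one_kronecker_one,
      Algebra.algebraMap_eq_smul_one]
    rw [Matrix.submatrix_smul, Pi.smul_apply, Pi.smul_apply, Matrix.submatrix_one_equiv]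
  map_star' a := by
    simp [Matrix.reindex_apply, Matrix.star_eq_conjTranspose, Matrix.conjTranspose_kronecker]

theorem commute_kron {d e : ℕ} (a : Matrix (Fin d) (Fin d) ℂ) (b : Matrix (Fin e) (Fin e) ℂ) :
    Commute (kronLeft d e a) (kronRight d e b) := by
  change Matrix.reindex _ _ _ * Matrix.reindex _ _ _ = Matrix.reindex _ _ _ * Matrix.reindex _ _ _
  rw [Matrix.reindex_apply, Matrix.reindex_apply, Matrix.submatrix_mul_equiv,
    Matrix.submatrix_mul_equiv, ← Matrix.mul_kronecker_mul, ← Matrix.mul_kronecker_mul]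
  simp

theorem trace_reindex {m n : Type} [Fintype m] [Fintype n] (e : m ≃ n) (a : Matrix m m ℂ) :
    (Matrix.reindex e e a).trace = a.trace :=
  Equiv.sum_comp e.symm fun i => a i i

theorem matTrace_kronLeft {d e : ℕ} [NeZero d] [NeZero e] [NeZero (d * e)]
    (a : Matrix (Fin d) (Fin d) ℂ) : (matTrace (d * e)).toLin (kronLeft d e a) =
      (matTrace d).toLin a := by
  have h : (e : ℂ) ≠ 0 := Nat.cast_ne_zero.2 (NeZero.ne e)
  have h1 : (kronLeft d e a).trace = a.trace * e := by
    refine (trace_reindex _ _).trans ?_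
    rw [Matrix.trace_kronecker]
    simp
  rw [matTrace_apply, matTrace_apply, h1]
  push_cast
  field_simp

theorem matTrace_kronRight {d e : ℕ} [NeZero d] [NeZero e] [NeZero (d * e)]
    (b : Matrix (Fin e) (Fin e) ℂ) : (matTrace (d * e)).toLin (kronRight d e b) =
      (matTrace e).toLin b := by
  have h : (d : ℂ) ≠ 0 := Nat.cast_ne_zero.2 (NeZero.ne d)
  have h1 : (kronRight d e b).trace = d * b.trace := by
    refine (trace_reindex _ _).trans ?_
    rw [Matrix.trace_kronecker]
    simp
  rw [matTrace_apply, matTrace_apply, h1]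
  push_cast
  field_simp

/-! ### Existence of the hyperfinite factor -/

namespace HyperfiniteII₁

/-- The matrix algebra `M_{2^m}`. -/
abbrev DyadicMat (m : ℕ) : Type := Matrix (Fin (2 ^ m)) (Fin (2 ^ m)) ℂ

/-- The embedding of `M_{2^m}` in `M_{2^(m+1)}`. -/
def dyadicStep (m : ℕ) : DyadicMat m →⋆ₐ[ℂ] DyadicMat (m + 1) := kronLeft (2 ^ m) 2

theorem matTrace_dyadicStep (m : ℕ) (a : DyadicMat m) :
    (matTrace (2 ^ (m + 1))).toLin (dyadicStep m a) = (matTrace (2 ^ m)).toLin a :=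
  have : NeZero (2 ^ m * 2) := inferInstanceAs (NeZero (2 ^ (m + 1)))
  matTrace_kronLeft (d := 2 ^ m) (e := 2) a

/-- The embedding of `M_{2^k}` in `M_{2^m}` for `k ≤ m`. -/
def dyadicEmbed {k m : ℕ} (h : k ≤ m) : DyadicMat k →⋆ₐ[ℂ] DyadicMat m :=
  Nat.leRec (motive := fun m _ => DyadicMat k →⋆ₐ[ℂ] DyadicMat m) (StarAlgHom.id ℂ _)
    (fun m _ f => (dyadicStep m).comp f) h

theorem dyadicEmbed_self (k : ℕ) (a : DyadicMat k) : dyadicEmbed le_rfl a = a := by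
  rw [dyadicEmbed, Nat.leRec_self]; rfl

theorem dyadicEmbed_succ {k m : ℕ} (h : k ≤ m) (a : DyadicMat k) :
    dyadicEmbed (h.trans (Nat.le_succ m)) a = dyadicStep m (dyadicEmbed h a) := by
  rw [dyadicEmbed, Nat.leRec_succ]; rfl

theorem dyadicEmbed_step {k m : ℕ} (h : k + 1 ≤ m) (a : DyadicMat k) :
    dyadicEmbed h (dyadicStep k a) = dyadicEmbed ((Nat.le_succ k).trans h) a := by
  induction m, h using Nat.le_induction with
  | base => rw [dyadicEmbed_self, dyadicEmbed_succ le_rfl, dyadicEmbed_self]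
  | succ m h ih => rw [dyadicEmbed_succ h, ih, dyadicEmbed_succ ((Nat.le_succ k).trans h)]

theorem matTrace_dyadicEmbed {k m : ℕ} (h : k ≤ m) (a : DyadicMat k) :
    (matTrace (2 ^ m)).toLin (dyadicEmbed h a) = (matTrace (2 ^ k)).toLin a := by
  induction m, h using Nat.le_induction with
  | base => rw [dyadicEmbed_self]
  | succ m h ih => rw [dyadicEmbed_succ h, matTrace_dyadicStep, ih]

/-- The sequences of matrices that are eventually coherent with the embeddings. -/
def coherentSeq : StarSubalgebra ℂ (∀ m, DyadicMat m) where
  carrier := {x | ∃ k, ∀ m, k ≤ m → x (m + 1) = dyadicStep m (x m)}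
  mul_mem' := by
    rintro x y ⟨k, hx⟩ ⟨l, hy⟩
    refine ⟨max k l, fun m hm => ?_⟩
    rw [Pi.mul_apply, Pi.mul_apply, hx m (le_of_max_le_left hm), hy m (le_of_max_le_right hm),
      map_mul]
  add_mem' := by
    rintro x y ⟨k, hx⟩ ⟨l, hy⟩
    refine ⟨max k l, fun m hm => ?_⟩
    rw [Pi.add_apply, Pi.add_apply, hx m (le_of_max_le_left hm), hy m (le_of_max_le_right hm),
      map_add]
  algebraMap_mem' r := ⟨0, fun m _ => (AlgHomClass.commutes (dyadicStep m) r).symm⟩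
  star_mem' := by
    rintro x ⟨k, hx⟩
    refine ⟨k, fun m hm => ?_⟩
    rw [Pi.star_apply, Pi.star_apply, hx m hm, map_star]

theorem coherentSeq_eq {x : ∀ m, DyadicMat m} {k : ℕ}
    (h : ∀ m, k ≤ m → x (m + 1) = dyadicStep m (x m)) {m : ℕ} (hm : k ≤ m) :
    x m = dyadicEmbed hm (x k) := by
  induction m, hm using Nat.le_induction with
  | base => rw [dyadicEmbed_self]
  | succ m hm ih => rw [dyadicEmbed_succ hm, h m hm, ← ih]

/-- The coherent sequence that starts with a given matrix. -/
def coherentOf (k : ℕ) (a : DyadicMat k) : coherentSeq :=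
  ⟨fun m => if h : k ≤ m then dyadicEmbed h a else 0, k, fun m hm => by
    beta_reduce
    rw [dif_pos hm, dif_pos (hm.trans (Nat.le_succ m)), dyadicEmbed_succ]⟩

theorem coherentOf_apply {k m : ℕ} (h : k ≤ m) (a : DyadicMat k) :
    (coherentOf k a).1 m = dyadicEmbed h a := dif_pos h

/-- The evaluation of a coherent sequence. -/
def evalCoherent (m : ℕ) : coherentSeq →⋆ₐ[ℂ] DyadicMat m where
  toFun x := x.1 m
  map_one' := rfl
  map_mul' _ _ := rfl
  map_zero' := rfl
  map_add' _ _ := rfl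
  commutes' _ := rfl
  map_star' _ := rfl

theorem eventually_hyperfilter_ge (k : ℕ) : ∀ᶠ m in (hyperfilter ℕ : Filter ℕ), k ≤ m :=
  (eventually_ge_atTop k).filter_mono Nat.hyperfilter_le_atTop

open scoped Matrix.Norms.L2Operator in
theorem exists_coherent_functional : ∃ f : BddPosFunctional coherentSeq,
    ∀ x, Tendsto (fun m => (matTrace (2 ^ m)).toLin (x.1 m)) (hyperfilter ℕ) (𝓝 (f.toLin x)) := by
  obtain ⟨τ, hτ⟩ := TracialState.exists_tendsto (hyperfilter ℕ)
    (fun m => (matTrace (2 ^ m)).comp (evalCoherent m)) (by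
      intro x
      obtain ⟨k, hx⟩ := x.2
      refine ⟨∑ i ∈ Finset.range (k + 1), ‖(matTrace (2 ^ i)).toLin (x.1 i)‖, fun n => ?_⟩
      have h1 : (matTrace (2 ^ n)).toLin (x.1 n) =
          (matTrace (2 ^ (min n k))).toLin (x.1 (min n k)) := by
        rcases le_total n k with h | h
        · rw [min_eq_left h]
        · rw [min_eq_right h, coherentSeq_eq hx h, matTrace_dyadicEmbed]
      change ‖(matTrace (2 ^ n)).toLin (x.1 n)‖ ≤ _
      rw [h1]
      exact Finset.single_le_sum (f := fun i => ‖(matTrace (2 ^ i)).toLin (x.1 i)‖)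
        (fun _ _ => norm_nonneg _) (Finset.mem_range.2 (Nat.lt_succ_of_le (min_le_right _ _))))
  refine ⟨⟨τ.toLin, τ.nonneg, fun x => ?_⟩, hτ⟩
  obtain ⟨k, hx⟩ := x.2
  refine ⟨‖x.1 k‖, norm_nonneg _, fun b => ?_⟩
  have h1 := fun c => (Complex.continuous_re.tendsto _).comp (hτ c)
  refine le_of_tendsto_of_tendsto (h1 _) ((h1 _).const_mul (‖x.1 k‖ ^ 2)) ?_
  filter_upwards [eventually_hyperfilter_ge k] with m hm
  change (matTrace (2 ^ m)).normSq (x.1 m * b.1 m) ≤ ‖x.1 k‖ ^ 2 * (matTrace (2 ^ m)).normSq (b.1 m)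
  rw [TracialState.normSq_eq, TracialState.normSq_eq, ← mul_pow, coherentSeq_eq hx hm]
  gcongr
  exact ((matTrace (2 ^ m)).norm_vec_mul_le _ _).trans (mul_le_mul_of_nonneg_right
    (NonUnitalStarAlgHom.norm_apply_le _ _) (norm_nonneg _))

/-- The limit of the normalised traces along a coherent sequence. -/
def limitTrace : BddPosFunctional coherentSeq := exists_coherent_functional.choose

theorem tendsto_limitTrace (x : coherentSeq) :
    Tendsto (fun m => (matTrace (2 ^ m)).toLin (x.1 m)) (hyperfilter ℕ) (𝓝 (limitTrace.toLin x)) :=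
  exists_coherent_functional.choose_spec x

theorem gns_eq_of_eventually {x y : coherentSeq} (k : ℕ) (h : ∀ m, k ≤ m → x.1 m = y.1 m) :
    limitTrace.gns x = limitTrace.gns y := by
  rw [← sub_eq_zero, ← map_sub, limitTrace.gns_eq_zero_iff]
  intro b
  refine tendsto_nhds_unique (tendsto_limitTrace _) (tendsto_const_nhds.congr' ?_)
  filter_upwards [eventually_hyperfilter_ge k] with m hm
  change 0 = (matTrace (2 ^ m)).toLin (star ((x.1 m - y.1 m) * b.1 m) * ((x.1 m - y.1 m) * b.1 m))
  rw [h m hm, sub_self, zero_mul, mul_zero, map_zero]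

/-- The representation of `M_{2^k}` on the GNS space of the limit trace. -/
def dyadicGNS (k : ℕ) : DyadicMat k →⋆ₐ[ℂ] (limitTrace.GNS →L[ℂ] limitTrace.GNS) where
  toFun a := limitTrace.gns (coherentOf k a)
  map_one' := by
    refine (gns_eq_of_eventually (y := 1) k fun m hm => ?_).trans (map_one limitTrace.gns)
    exact (coherentOf_apply hm _).trans (map_one (dyadicEmbed hm))
  map_mul' a b := by
    refine (gns_eq_of_eventually (y := coherentOf k a * coherentOf k b) k fun m hm => ?_).trans
      (map_mul limitTrace.gns _ _)
    change _ = (coherentOf k a).1 m * (coherentOf k b).1 m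
    rw [coherentOf_apply hm, coherentOf_apply hm, coherentOf_apply hm, map_mul]
  map_zero' := by
    refine (gns_eq_of_eventually (y := 0) k fun m hm => ?_).trans (map_zero limitTrace.gns)
    exact (coherentOf_apply hm _).trans (map_zero (dyadicEmbed hm))
  map_add' a b := by
    refine (gns_eq_of_eventually (y := coherentOf k a + coherentOf k b) k fun m hm => ?_).trans
      (map_add limitTrace.gns _ _)
    change _ = (coherentOf k a).1 m + (coherentOf k b).1 m
    rw [coherentOf_apply hm, coherentOf_apply hm, coherentOf_apply hm, map_add]
  commutes' r := by
    refine (gns_eq_of_eventually (y := algebraMap ℂ coherentSeq r) k fun m hm => ?_).trans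
      (AlgHomClass.commutes limitTrace.gns r)
    exact (coherentOf_apply hm _).trans (AlgHomClass.commutes (dyadicEmbed hm) r)
  map_star' a := by
    refine (gns_eq_of_eventually (y := star (coherentOf k a)) k fun m hm => ?_).trans
      (map_star limitTrace.gns _)
    change _ = star ((coherentOf k a).1 m)
    rw [coherentOf_apply hm, coherentOf_apply hm, map_star]

theorem dyadicGNS_apply (k : ℕ) (a : DyadicMat k) :
    dyadicGNS k a = limitTrace.gns (coherentOf k a) := rfl

theorem range_dyadicGNS_mono (k : ℕ) :
    Set.range (dyadicGNS k) ⊆ Set.range (dyadicGNS (k + 1)) := by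
  rintro _ ⟨a, rfl⟩
  refine ⟨dyadicStep k a, ?_⟩
  rw [dyadicGNS_apply, dyadicGNS_apply]
  refine gns_eq_of_eventually (k + 1) fun m hm => ?_
  rw [coherentOf_apply hm, coherentOf_apply ((Nat.le_succ k).trans hm), dyadicEmbed_step]

theorem inner_dyadicGNS (k : ℕ) (a : DyadicMat k) :
    ⟪limitTrace.gnsVec, dyadicGNS k a limitTrace.gnsVec⟫_ℂ = Matrix.trace a / 2 ^ k := by
  rw [dyadicGNS_apply, limitTrace.inner_vec_gns_vec]
  refine tendsto_nhds_unique (tendsto_limitTrace _) (tendsto_const_nhds.congr' ?_)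
  filter_upwards [eventually_hyperfilter_ge k] with m hm
  rw [coherentOf_apply hm, matTrace_dyadicEmbed, matTrace_apply, div_eq_inv_mul]
  push_cast
  rfl

theorem dense_dyadicGNS :
    Dense {v : limitTrace.GNS | ∃ k a, v = dyadicGNS k a limitTrace.gnsVec} := by
  refine limitTrace.dense_gns_vec.mono ?_
  rintro _ ⟨x, rfl⟩
  obtain ⟨k, hx⟩ := x.2
  refine ⟨k, x.1 k, ?_⟩
  rw [dyadicGNS_apply]
  refine congrArg (fun T : limitTrace.GNS →L[ℂ] limitTrace.GNS => T limitTrace.gnsVec) ?_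
  refine gns_eq_of_eventually k fun m hm => ?_
  rw [coherentOf_apply hm, coherentSeq_eq hx hm]

theorem nonempty : Nonempty HyperfiniteII₁ :=
  ⟨@HyperfiniteII₁.mk limitTrace.GNS _ _ _ limitTrace.gnsVec dyadicGNS range_dyadicGNS_mono
    inner_dyadicGNS dense_dyadicGNS⟩

end HyperfiniteII₁

end

section

open Filter
open scoped Kronecker

/-! ### Ultraproducts of matrix algebras -/

section Block

variable (d e : ℕ)

/-- An identification of the indices of `M_e` with `⌊e / d⌋` copies of those of `M_d` and a
remainder. -/
def blockEquiv : (Fin d × Fin (e / d)) ⊕ Fin (e % d) ≃ Fin e :=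
  Fintype.equivFinOfCardEq (by simp [Nat.div_add_mod])

/-- The non-unital embedding of `M_d` in `M_e` by `⌊e / d⌋` diagonal blocks, followed by zeros. -/
def blockEmbed (a : Matrix (Fin d) (Fin d) ℂ) : Matrix (Fin e) (Fin e) ℂ :=
  Matrix.reindex (blockEquiv d e) (blockEquiv d e)
    (Matrix.fromBlocks (a ⊗ₖ (1 : Matrix (Fin (e / d)) (Fin (e / d)) ℂ)) 0 0 0)

variable {d e}

theorem blockEmbed_mul (a b : Matrix (Fin d) (Fin d) ℂ) :
    blockEmbed d e (a * b) = blockEmbed d e a * blockEmbed d e b := by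
  rw [blockEmbed, blockEmbed, blockEmbed, Matrix.reindex_apply, Matrix.reindex_apply,
    Matrix.reindex_apply, Matrix.submatrix_mul_equiv, Matrix.fromBlocks_multiply]
  simp [← Matrix.mul_kronecker_mul]

theorem blockEmbed_add (a b : Matrix (Fin d) (Fin d) ℂ) :
    blockEmbed d e (a + b) = blockEmbed d e a + blockEmbed d e b := by
  rw [blockEmbed, Matrix.add_kronecker]
  have h : ∀ x y : Matrix (Fin d × Fin (e / d)) (Fin d × Fin (e / d)) ℂ,
      Matrix.fromBlocks (x + y) 0 0 (0 : Matrix (Fin (e % d)) (Fin (e % d)) ℂ) =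
        Matrix.fromBlocks x 0 0 0 + Matrix.fromBlocks y 0 0 0 := fun x y => by
    rw [Matrix.fromBlocks_add]; simp
  rw [h]
  rfl

theorem blockEmbed_smul (r : ℂ) (a : Matrix (Fin d) (Fin d) ℂ) :
    blockEmbed d e (r • a) = r • blockEmbed d e a := by
  rw [blockEmbed, Matrix.smul_kronecker]
  have h : ∀ x : Matrix (Fin d × Fin (e / d)) (Fin d × Fin (e / d)) ℂ,
      Matrix.fromBlocks (r • x) 0 0 (0 : Matrix (Fin (e % d)) (Fin (e % d)) ℂ) =
        r • Matrix.fromBlocks x 0 0 0 := fun x => by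
    rw [Matrix.fromBlocks_smul]; simp
  rw [h]
  rfl

theorem blockEmbed_star (a : Matrix (Fin d) (Fin d) ℂ) :
    blockEmbed d e (star a) = star (blockEmbed d e a) := by
  rw [blockEmbed, blockEmbed, Matrix.star_eq_conjTranspose, Matrix.star_eq_conjTranspose,
    Matrix.reindex_apply, Matrix.reindex_apply, Matrix.conjTranspose_submatrix,
    Matrix.fromBlocks_conjTranspose, Matrix.conjTranspose_kronecker]
  simp

theorem trace_blockEmbed (a : Matrix (Fin d) (Fin d) ℂ) :
    (blockEmbed d e a).trace = (e / d : ℕ) * a.trace := by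
  rw [blockEmbed, Matrix.reindex_apply]
  refine (Equiv.sum_comp (blockEquiv d e).symm fun i =>
    (Matrix.fromBlocks (a ⊗ₖ (1 : Matrix (Fin (e / d)) (Fin (e / d)) ℂ)) 0 0 0) i i).trans ?_
  rw [Fintype.sum_sum_type]
  have h := Matrix.trace_kronecker a (1 : Matrix (Fin (e / d)) (Fin (e / d)) ℂ)
  rw [Matrix.trace_one, Fintype.card_fin, mul_comm] at h
  simpa [Matrix.trace] using h

theorem blockEmbed_zero : blockEmbed d e 0 = 0 := by
  have h := blockEmbed_smul (d := d) (e := e) 0 0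
  rwa [zero_smul, zero_smul] at h

open scoped Matrix.Norms.L2Operator in
theorem norm_blockEmbed_le (a : Matrix (Fin d) (Fin d) ℂ) : ‖blockEmbed d e a‖ ≤ ‖a‖ := by
  let f : Matrix (Fin d) (Fin d) ℂ →⋆ₙₐ[ℂ] Matrix (Fin e) (Fin e) ℂ :=
    { toFun := blockEmbed d e
      map_smul' := blockEmbed_smul
      map_zero' := blockEmbed_zero
      map_add' := blockEmbed_add
      map_mul' := blockEmbed_mul
      map_star' := blockEmbed_star }
  exact NonUnitalStarAlgHom.norm_apply_le f a

end Block

section Ultraproduct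

variable (d : ℕ → ℕ)

open scoped Matrix.Norms.L2Operator in
/-- The sequences of matrices, of sizes `d n`, that are bounded in the operator norm. -/
def boundedMat : StarSubalgebra ℂ (∀ n, Matrix (Fin (d n)) (Fin (d n)) ℂ) where
  carrier := {x | ∃ M : ℝ, ∀ n, ‖x n‖ ≤ M}
  mul_mem' := by
    rintro x y ⟨M, hM⟩ ⟨N, hN⟩
    refine ⟨M * N, fun n => (norm_mul_le (x n) (y n)).trans ?_⟩
    exact mul_le_mul (hM n) (hN n) (norm_nonneg _) ((norm_nonneg _).trans (hM n))
  add_mem' := by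
    rintro x y ⟨M, hM⟩ ⟨N, hN⟩
    exact ⟨M + N, fun n => (norm_add_le (x n) (y n)).trans (add_le_add (hM n) (hN n))⟩
  algebraMap_mem' r := by
    refine ⟨‖r‖, fun n => ?_⟩
    change ‖algebraMap ℂ (Matrix (Fin (d n)) (Fin (d n)) ℂ) r‖ ≤ ‖r‖
    rw [Algebra.algebraMap_eq_smul_one]
    refine (norm_smul_le _ _).trans (mul_le_of_le_one_right (norm_nonneg _) ?_)
    rcases isEmpty_or_nonempty (Fin (d n)) with h | h
    · rw [Subsingleton.elim (1 : Matrix (Fin (d n)) (Fin (d n)) ℂ) 0, norm_zero]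
      exact zero_le_one
    · exact CStarRing.norm_one.le
  star_mem' := by
    rintro x ⟨M, hM⟩
    exact ⟨M, fun n => (norm_star (x n)).trans_le (hM n)⟩

namespace HyperfiniteII₁

variable (R : HyperfiniteII₁)

theorem tr_mat (k : ℕ) (a) : R.tr (R.mat k a) = Matrix.trace a / 2 ^ k := R.vec_trace k a

theorem norm_mat_vec_sq (k : ℕ) (a : DyadicMat k) :
    ‖R.mat k a R.vec‖ ^ 2 = (Matrix.trace (star a * a)).re / 2 ^ k := by
  have h := R.trace_normSq ⟨_, R.mat_mem_alg k a⟩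
  change _ = ‖R.mat k a R.vec‖ ^ 2 at h
  rw [← h, TracialState.normSq, trace_apply]
  change (R.tr (star (R.mat k a) * R.mat k a)).re = _
  rw [← map_star, ← map_mul, tr_mat]
  have h2 : (2 : ℂ) ^ k = ((2 ^ k : ℝ) : ℂ) := by push_cast; rfl
  rw [h2, Complex.div_ofReal_re]

variable {d} [∀ n, NeZero (d n)]

/-- The exponent of a matrix algebra `M_{2^k}` in which `M_{d n}` fits with little loss. -/
def blockExp (d : ℕ → ℕ) (n : ℕ) : ℕ := (n + 1) * d n

/-- The sequence of the block embeddings of a bounded sequence of matrices. -/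
def blockSeq (x : boundedMat d) : R.boundedSeq :=
  ⟨fun n => R.mat (blockExp d n) (blockEmbed (d n) (2 ^ blockExp d n) (x.1 n)),
    fun n => R.mat_mem_alg _ _, by
      obtain ⟨M, hM⟩ := x.2
      refine ⟨M, fun n => ?_⟩
      open scoped Matrix.Norms.L2Operator in
      exact (NonUnitalStarAlgHom.norm_apply_le (R.mat (blockExp d n)) _).trans
        ((norm_blockEmbed_le _).trans (hM n))⟩

theorem tendsto_block_ratio (d : ℕ → ℕ) [∀ n, NeZero (d n)] :
    Tendsto (fun n => ((2 ^ blockExp d n / d n : ℕ) * d n : ℝ) / 2 ^ blockExp d n) atTop (𝓝 1) := by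
  have h0 : Tendsto (fun n : ℕ => 1 - 1 / ((n : ℝ) + 1)) atTop (𝓝 1) := by
    simpa using tendsto_one_div_add_atTop_nhds_zero_nat.const_sub (1 : ℝ)
  refine tendsto_of_tendsto_of_tendsto_of_le_of_le h0 tendsto_const_nhds (fun n => ?_) fun n => ?_
  · have hp : (0 : ℝ) < 2 ^ blockExp d n := by positivity
    have hn : (0 : ℝ) < (n : ℝ) + 1 := by positivity
    have h1 : (2 ^ blockExp d n / d n : ℕ) * d n + 2 ^ blockExp d n % d n = 2 ^ blockExp d n := by
      rw [mul_comm]; exact Nat.div_add_mod _ _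
    have h2 : 2 ^ blockExp d n % d n < d n := Nat.mod_lt _ (Nat.pos_of_ne_zero (NeZero.ne _))
    have h3 : blockExp d n < 2 ^ blockExp d n := Nat.lt_two_pow_self
    have h1' : ((2 ^ blockExp d n / d n : ℕ) * d n : ℝ) + (2 ^ blockExp d n % d n : ℕ) =
        2 ^ blockExp d n := by exact_mod_cast h1
    have h2' : ((2 ^ blockExp d n % d n : ℕ) : ℝ) ≤ d n := by exact_mod_cast h2.le
    have h3' : ((n : ℝ) + 1) * d n ≤ 2 ^ blockExp d n := by exact_mod_cast h3.le
    change 1 - 1 / ((n : ℝ) + 1) ≤ _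
    rw [le_div_iff₀ hp]
    have h4 : (d n : ℝ) ≤ 1 / ((n : ℝ) + 1) * 2 ^ blockExp d n := by
      rw [one_div, ← div_eq_inv_mul, le_div_iff₀ hn, mul_comm]
      exact h3'
    linarith
  · have hp : (0 : ℝ) < 2 ^ blockExp d n := by positivity
    change _ / _ ≤ (1 : ℝ)
    rw [div_le_one hp]
    exact_mod_cast Nat.div_mul_le_self _ _

theorem tr_blockSeq (x : boundedMat d) (n : ℕ) : R.tr ((R.blockSeq x).1 n) =
    ((((2 ^ blockExp d n / d n : ℕ) * d n : ℝ) / 2 ^ blockExp d n : ℝ) : ℂ) *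
      (matTrace (d n)).toLin (x.1 n) := by
  have h : (d n : ℂ) ≠ 0 := Nat.cast_ne_zero.2 (NeZero.ne _)
  change R.tr (R.mat _ _) = _
  rw [tr_mat, trace_blockEmbed, matTrace_apply]
  push_cast
  field_simp

variable (ω : Ultrafilter ℕ)

/-- Although the block embeddings are not unital, the unit is preserved in the limit. -/
theorem toUltra_blockSeq_one (hω : (ω : Filter ℕ) ≤ atTop) :
    R.toUltra ω (R.blockSeq (1 : boundedMat d)) = 1 := by
  rw [← sub_eq_zero, ← map_one (R.toUltraHom ω), ← toUltraHom_apply, ← map_sub, toUltraHom_apply,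
    toUltra_eq_zero_iff]
  have h1 : ∀ n, ‖(R.blockSeq (1 : boundedMat d) - 1).1 n R.vec‖ ^ 2 =
      1 - ((2 ^ blockExp d n / d n : ℕ) * d n : ℝ) / 2 ^ blockExp d n := by
    intro n
    let b := blockEmbed (d n) (2 ^ blockExp d n) 1
    have hb1 : star b = b := by rw [← blockEmbed_star, star_one]
    have hb2 : b * b = b := by rw [← blockEmbed_mul, one_mul]
    have e1 : (R.blockSeq (1 : boundedMat d) - 1).1 n = R.mat (blockExp d n) (b - 1) := by
      rw [map_sub, map_one]; rfl
    have e2 : star (b - 1) * (b - 1) = 1 - b := by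
      rw [star_sub, hb1, star_one, sub_mul, mul_sub, hb2]
      noncomm_ring
    have hb3 : b.trace = ((2 ^ blockExp d n / d n : ℕ) : ℂ) * d n := by
      rw [trace_blockEmbed, Matrix.trace_one, Fintype.card_fin]
    have e3 : (1 - b).trace = ((2 ^ blockExp d n -
        (2 ^ blockExp d n / d n : ℕ) * d n : ℝ) : ℂ) := by
      rw [Matrix.trace_sub, hb3, Matrix.trace_one, Fintype.card_fin]
      push_cast
      rfl
    rw [e1, norm_mat_vec_sq, e2, e3, Complex.ofReal_re, sub_div, div_self (by positivity)]
  have h2 : Tendsto (fun n => ‖(R.blockSeq (1 : boundedMat d) - 1).1 n R.vec‖ ^ 2) ω (𝓝 0) := by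
    simp only [h1]
    simpa using ((tendsto_block_ratio d).const_sub 1).mono_left hω
  have h3 := (Real.continuous_sqrt.tendsto _).comp h2
  simpa only [Function.comp_def, Real.sqrt_sq (norm_nonneg _), Real.sqrt_zero] using h3

/-- The embedding of a matrix ultraproduct in the ultrapower of the hyperfinite factor. -/
def blockHom (hω : (ω : Filter ℕ) ≤ atTop) : boundedMat d →⋆ₐ[ℂ] R.Ultrapower ω where
  toFun x := R.toUltra ω (R.blockSeq x)
  map_one' := R.toUltra_blockSeq_one ω hω
  map_mul' x y := by
    rw [← toUltraHom_apply, ← toUltraHom_apply, ← toUltraHom_apply, ← map_mul]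
    congr 1
    refine Subtype.ext (funext fun n => ?_)
    exact (congrArg (R.mat (blockExp d n)) (blockEmbed_mul _ _)).trans
      (map_mul (R.mat (blockExp d n)) _ _)
  map_zero' := by
    rw [← toUltraHom_apply, ← map_zero (R.toUltraHom ω)]
    congr 1
    refine Subtype.ext (funext fun n => ?_)
    exact (congrArg (R.mat (blockExp d n)) blockEmbed_zero).trans
      (map_zero (R.mat (blockExp d n)))
  map_add' x y := by
    rw [← toUltraHom_apply, ← toUltraHom_apply, ← toUltraHom_apply, ← map_add]
    congr 1
    refine Subtype.ext (funext fun n => ?_)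
    exact (congrArg (R.mat (blockExp d n)) (blockEmbed_add _ _)).trans
      (map_add (R.mat (blockExp d n)) _ _)
  commutes' r := by
    rw [Algebra.algebraMap_eq_smul_one, Algebra.algebraMap_eq_smul_one,
      ← R.toUltra_blockSeq_one (d := d) ω hω, ← toUltraHom_apply, ← toUltraHom_apply, ← map_smul]
    congr 1
    refine Subtype.ext (funext fun n => ?_)
    exact (congrArg (R.mat (blockExp d n)) (blockEmbed_smul _ _)).trans
      (map_smul (R.mat (blockExp d n)) _ _)
  map_star' x := by
    rw [← toUltraHom_apply, ← toUltraHom_apply, ← map_star]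
    congr 1
    refine Subtype.ext (funext fun n => ?_)
    exact (congrArg (R.mat (blockExp d n)) (blockEmbed_star _)).trans
      (map_star (R.mat (blockExp d n)) _)

end HyperfiniteII₁

/-- The ultraproduct of matrix algebras, with the limit of the normalised traces, belongs to the
model `qa`. -/
theorem exists_matrix_ultraproduct [∀ n, NeZero (d n)] :
    ∃ (C : Type) (_ : CStarAlgebra C) (Θ : boundedMat d →⋆ₐ[ℂ] C) (χ : TracialState C),
      Model.qa.mem C ∧ Model.qa.trace C χ ∧ χ.Faithful ∧
      ∀ x : boundedMat d, Tendsto (fun n => (matTrace (d n)).toLin (x.1 n)) (hyperfilter ℕ)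
        (𝓝 (χ.toLin (Θ x))) := by
  obtain ⟨R⟩ := HyperfiniteII₁.nonempty
  let ω : Ultrafilter ℕ := hyperfilter ℕ
  have hω : (ω : Filter ℕ) ≤ atTop := Nat.hyperfilter_le_atTop
  obtain ⟨C, _, e, χ, hχ, hlim⟩ := R.exists_ultrapower_equiv ω
  have hfree : ∀ n, {n} ∉ ω := fun n => by
    have h := (Set.finite_singleton n).notMem_hyperfilter
    exact h
  refine ⟨C, inferInstance, (e : R.Ultrapower ω →⋆ₐ[ℂ] C).comp (R.blockHom ω hω), χ,
    ⟨R, ω, (e.symm : C →⋆ₐ[ℂ] R.Ultrapower ω), hfree, e.symm.injective⟩,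
    ⟨R, ω, (e.symm : C →⋆ₐ[ℂ] R.Ultrapower ω), hfree, e.symm.injective, fun b x hb => ?_⟩, hχ,
    fun x => ?_⟩
  · have h1 : b = e (R.toUltra ω x) := by
      rw [← hb]; exact (e.apply_symm_apply b).symm
    rw [h1]
    exact hlim x
  · have h1 : Tendsto (fun n => R.tr ((R.blockSeq x).1 n)) ω
        (𝓝 (χ.toLin (e (R.toUltra ω (R.blockSeq x))))) := hlim _
    have h2 := (Complex.continuous_ofReal.tendsto _).comp
      ((HyperfiniteII₁.tendsto_block_ratio d).mono_left hω)
    have h3 := h1.div h2 (by simp)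
    rw [Complex.ofReal_one, div_one] at h3
    have h4 := ((HyperfiniteII₁.tendsto_block_ratio d).mono_left hω).eventually_ne one_ne_zero
    refine h3.congr' ?_
    filter_upwards [h4] with n hn
    change R.tr ((R.blockSeq x).1 n) / _ = _
    rw [R.tr_blockSeq]
    exact mul_div_cancel_left₀ _ (Complex.ofReal_ne_zero.2 hn)

end Ultraproduct

end

section

open Filter Polynomial

/-! ### Functions of projection-valued measures -/

namespace IsPVM

variable {D I S : Type} [Ring D] [StarRing D] [Algebra ℂ D] [Fintype I] {e : I → D}

/-- The functional calculus `f ↦ ∑ i, f i • e i` of a projection-valued measure. -/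
def func (h : IsPVM e) : (I → ℂ) →ₐ[ℂ] D :=
  AlgHom.ofLinearMap (Fintype.linearCombination ℂ e) (by
      rw [Fintype.linearCombination_apply]; simpa using h.sum) fun f g => by
    classical
    simp only [Fintype.linearCombination_apply, Finset.sum_mul_sum]
    refine Finset.sum_congr rfl fun i _ => ?_
    rw [Finset.sum_eq_single i]
    · rw [smul_mul_smul_comm, h.idem]; rfl
    · intro j _ hj
      rw [smul_mul_smul_comm, h.orth i j (Ne.symm hj), smul_zero]
    · simp

theorem func_apply (h : IsPVM e) (f : I → ℂ) : h.func f = ∑ i, f i • e i :=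
  Fintype.linearCombination_apply ℂ e f

theorem func_star [StarModule ℂ D] (h : IsPVM e) (f : I → ℂ) :
    star (h.func f) = h.func (star f) := by
  rw [func_apply, func_apply, star_sum]
  refine Finset.sum_congr rfl fun i _ => ?_
  rw [star_smul, (h.sa i).star_eq]
  rfl

theorem aeval_func (h : IsPVM e) (f : I → ℂ) (P : ℂ[X]) :
    aeval (h.func f) P = h.func fun i => P.eval (f i) := by
  rw [aeval_algHom_apply, aeval_pi_apply]
  simp only [coe_aeval_eq_eval]

theorem normSq_func [StarModule ℂ D] (h : IsPVM e) (τ : TracialState D) (f : I → ℂ) :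
    τ.normSq (h.func f) = ∑ i, ‖f i‖ ^ 2 * τ.normSq (e i) := by
  rw [TracialState.normSq, func_star, ← map_mul, func_apply, map_sum, Complex.re_sum]
  refine Finset.sum_congr rfl fun i _ => ?_
  have h1 : e i = star (e i) * e i := by rw [(h.sa i).star_eq, h.idem]
  have h2 : (star f * f) i = ((‖f i‖ ^ 2 : ℝ) : ℂ) := by
    change star (f i) * f i = _
    rw [Complex.star_def, Complex.conj_mul']
    push_cast
    rfl
  conv_lhs => rw [h1]
  rw [map_smul, τ.toLin_star_mul_self, smul_eq_mul, h2, ← Complex.ofReal_mul, Complex.ofReal_re]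

theorem normSq_func_le [StarModule ℂ D] (h : IsPVM e) (τ : TracialState D) {f g : I → ℂ} {K : ℝ}
    (hfg : ∀ i, ‖f i‖ ≤ K * ‖g i‖) : τ.normSq (h.func f) ≤ K ^ 2 * τ.normSq (h.func g) := by
  rw [normSq_func, normSq_func, Finset.mul_sum]
  refine Finset.sum_le_sum fun i _ => ?_
  rw [← mul_assoc, ← mul_pow]
  have := τ.normSq_nonneg (e i)
  have := hfg i
  gcongr

/-- The coarse-graining of a projection-valued measure along a map of the outcomes. -/
def coarsen [DecidableEq S] (h : IsPVM e) (g : I → S) (s : S) : D :=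
  h.func fun i => if g i = s then 1 else 0

theorem isPVM_coarsen [StarModule ℂ D] [Fintype S] [DecidableEq S] (h : IsPVM e) (g : I → S) :
    IsPVM (h.coarsen g) where
  sa s := by
    rw [isSelfAdjoint_iff, coarsen, func_star]
    congr 1
    funext i
    simp [apply_ite star]
  idem s := by
    rw [coarsen, ← map_mul]
    congr 1
    funext i
    simp
  orth s t hst := by
    rw [coarsen, coarsen, ← map_mul, ← map_zero h.func]
    congr 1
    funext i
    simp only [Pi.mul_apply, Pi.zero_apply, mul_ite, mul_one, mul_zero]
    split_ifs with h1 h2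
    · exact (hst (h2.symm.trans h1)).elim
    all_goals rfl
  sum := by
    simp only [coarsen]
    rw [← map_sum, ← map_one h.func]
    congr 1
    funext i
    simp

theorem sum_coarsen [Fintype S] [DecidableEq S] (h : IsPVM e) (g : I → S) (v : S → ℂ) :
    ∑ s, v s • h.coarsen g s = h.func fun i => v (g i) := by
  simp only [coarsen, ← map_smul]
  rw [← map_sum]
  congr 1
  funext i
  simp

/-- Two projection-valued measures with the same distinct values and the same mean are equal. -/
theorem eq_of_sum_smul_eq {p q : I → D} (hp : IsPVM p) (hq : IsPVM q) {v : I → ℂ}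
    (hv : Function.Injective v) (h : ∑ i, v i • p i = ∑ i, v i • q i) : p = q := by
  classical
  have h1 : ∀ {r : I → D} (hr : IsPVM r) (t : I), r t * ∑ i, v i • r i = v t • r t := by
    intro r hr t
    rw [Finset.mul_sum, Finset.sum_eq_single t]
    · rw [mul_smul_comm, hr.idem]
    · intro s _ hs
      rw [mul_smul_comm, hr.orth t s (Ne.symm hs), smul_zero]
    · simp
  have h2 : ∀ {r : I → D} (hr : IsPVM r) (t : I), (∑ i, v i • r i) * r t = v t • r t := by
    intro r hr t
    rw [Finset.sum_mul, Finset.sum_eq_single t]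
    · rw [smul_mul_assoc, hr.idem]
    · intro s _ hs
      rw [smul_mul_assoc, hr.orth s t hs, smul_zero]
    · simp
  have h3 : ∀ s t, t ≠ s → p t * q s = 0 := by
    intro s t hts
    have e1 : v t • (p t * q s) = v s • (p t * q s) := by
      rw [← smul_mul_assoc, ← h1 hp t, h, mul_assoc, h2 hq s, mul_smul_comm]
    rw [← sub_eq_zero, ← sub_smul] at e1
    exact (smul_eq_zero.1 e1).resolve_left (sub_ne_zero.2 (hv.ne hts))
  funext s
  calc p s = p s * ∑ t, q t := by rw [hq.sum, mul_one]
    _ = p s * q s := by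
      rw [Finset.mul_sum, Finset.sum_eq_single s]
      · exact fun t _ ht => h3 t s (Ne.symm ht)
      · simp
    _ = (∑ t, p t) * q s := by
      rw [Finset.sum_mul, Finset.sum_eq_single s]
      · exact fun t _ ht => h3 s t ht
      · simp
    _ = q s := by rw [hp.sum, one_mul]

end IsPVM

/-! ### Rounding to projection-valued measures -/

section Rounding

variable {S : Type} [Fintype S]

/-- Distinct integer labels of the outcomes of a measurement. -/
def label (s : S) : ℂ := (Fintype.equivFin S s : ℕ)

theorem label_injective : Function.Injective (label (S := S)) := fun _ _ h =>
  (Fintype.equivFin S).injective (Fin.ext (Nat.cast_injective (R := ℂ) h))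

theorem one_le_norm_label_sub {s t : S} (h : s ≠ t) : 1 ≤ ‖label s - label t‖ := by
  have h1 : ((Fintype.equivFin S s : ℕ) : ℤ) - (Fintype.equivFin S t : ℕ) ≠ 0 := by
    intro h2
    refine h ((Fintype.equivFin S).injective (Fin.ext ?_))
    exact_mod_cast sub_eq_zero.1 h2
  have h2 : label s - label t =
      ((((Fintype.equivFin S s : ℕ) : ℤ) - (Fintype.equivFin S t : ℕ) : ℤ) : ℂ) := by
    simp [label]
  rw [h2, Complex.norm_intCast]
  exact_mod_cast Int.one_le_abs h1

/-- The polynomial whose roots are the labels. -/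
def labelPoly (S : Type) [Fintype S] : ℂ[X] := ∏ s : S, (X - C (label s))

theorem eval_labelPoly (t : ℂ) : (labelPoly S).eval t = ∏ s : S, (t - label s) := by
  simp [labelPoly, eval_prod]

theorem eval_labelPoly_label (s : S) : (labelPoly S).eval (label s) = 0 := by
  rw [eval_labelPoly]
  exact Finset.prod_eq_zero (Finset.mem_univ s) (sub_self _)

/-- The distance to the nearest label is controlled by the polynomial of the labels: the distance to
any other label is at least one half. -/
theorem norm_sub_label_le {t : ℂ} {s : S} (hs : ∀ u : S, ‖t - label s‖ ≤ ‖t - label u‖) :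
    ‖t - label s‖ ≤ 2 ^ Fintype.card S * ‖(labelPoly S).eval t‖ := by
  classical
  rw [eval_labelPoly, norm_prod, ← Finset.card_univ, ← Finset.prod_const, ← Finset.prod_mul_distrib,
    ← Finset.mul_prod_erase _ _ (Finset.mem_univ s)]
  have h1 : (1 : ℝ) ≤ ∏ u ∈ Finset.univ.erase s, 2 * ‖t - label u‖ := by
    refine Finset.prod_induction _ (fun x => (1 : ℝ) ≤ x)
      (fun a b ha hb => ?_) le_rfl fun u hu => ?_
    · exact one_le_mul_of_one_le_of_one_le ha hb
    · have h2 := one_le_norm_label_sub (Finset.ne_of_mem_erase hu)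
      have h3 : ‖label u - label s‖ ≤ ‖t - label u‖ + ‖t - label s‖ := by
        rw [norm_sub_rev t (label u)]
        exact norm_sub_le_norm_sub_add_norm_sub _ _ _
      have := hs u
      linarith
  have h4 := norm_nonneg (t - label s)
  nlinarith [mul_le_mul_of_nonneg_left h1 h4]

/-- A self-adjoint element with a spectral decomposition is close to the mean of a projection-valued
measure with outcomes `S`, as soon as the polynomial of the labels nearly vanishes on it. -/
theorem IsPVM.exists_rounding [Nonempty S] {D I : Type} [Ring D] [StarRing D] [Algebra ℂ D]
    [StarModule ℂ D] [Fintype I] {e : I → D} (h : IsPVM e) (f : I → ℂ) (τ : TracialState D) :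
    ∃ q : S → D, IsPVM q ∧ τ.normSq (h.func f - ∑ s, label s • q s) ≤
      (2 ^ Fintype.card S) ^ 2 * τ.normSq (aeval (h.func f) (labelPoly S)) := by
  classical
  choose g hg using fun i => Finite.exists_min fun s : S => ‖f i - label s‖
  refine ⟨h.coarsen g, h.isPVM_coarsen g, ?_⟩
  rw [h.sum_coarsen, ← map_sub, h.aeval_func]
  exact h.normSq_func_le τ fun i => norm_sub_label_le (hg i)

theorem exists_spectral_decomposition {N : ℕ} {m : Matrix (Fin N) (Fin N) ℂ}
    (hm : IsSelfAdjoint m) : ∃ (e : Fin N → Matrix (Fin N) (Fin N) ℂ) (h : IsPVM e) (f : Fin N → ℂ),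
      m = h.func f := by
  have hm' : m.IsHermitian := hm
  let Φ := Unitary.conjStarAlgAut ℂ (Matrix (Fin N) (Fin N) ℂ) hm'.eigenvectorUnitary
  have h0 : IsPVM fun i : Fin N => Matrix.diagonal (Pi.single i (1 : ℂ)) := by
    refine ⟨fun i => ?_, fun i => ?_, fun i j hij => ?_, ?_⟩
    · rw [isSelfAdjoint_iff, Matrix.star_eq_conjTranspose, Matrix.diagonal_conjTranspose,
        Pi.star_single, star_one]
    · rw [Matrix.diagonal_mul_diagonal']
      congr 1
      funext k
      by_cases hk : k = i
      · subst hk; simp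
      · simp [hk]
    · rw [Matrix.diagonal_mul_diagonal', ← Matrix.diagonal_zero]
      congr 1
      funext k
      by_cases hk : k = i
      · subst hk; simp [hij]
      · simp [hk]
    · have : ∑ i : Fin N, Matrix.diagonal (Pi.single i (1 : ℂ)) =
          Matrix.diagonal (∑ i : Fin N, Pi.single i (1 : ℂ)) :=
        (map_sum (Matrix.diagonalAddMonoidHom (Fin N) ℂ) _ _).symm
      rw [this, Finset.univ_sum_single (fun _ : Fin N => (1 : ℂ)), Matrix.diagonal_one]
  refine ⟨_, h0.map (Φ : _ →⋆ₐ[ℂ] _), fun i => (hm'.eigenvalues i : ℂ), ?_⟩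
  rw [IsPVM.func_apply]
  have h1 : Matrix.diagonal (fun i => (hm'.eigenvalues i : ℂ)) =
      ∑ i, (hm'.eigenvalues i : ℂ) • Matrix.diagonal (Pi.single i (1 : ℂ)) := by
    have h2 : ∀ i, (hm'.eigenvalues i : ℂ) • Matrix.diagonal (Pi.single i (1 : ℂ)) =
        Matrix.diagonal (Pi.single i (hm'.eigenvalues i : ℂ)) := fun i => by
      rw [← Matrix.diagonal_smul, ← Pi.single_smul, smul_eq_mul, mul_one]
    simp only [h2]
    rw [← Finset.univ_sum_single fun i => (hm'.eigenvalues i : ℂ)]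
    exact map_sum (Matrix.diagonalAddMonoidHom (Fin N) ℂ) _ _
  have h3 : m = Φ (Matrix.diagonal fun i => (hm'.eigenvalues i : ℂ)) := hm'.spectral_theorem
  conv_lhs => rw [h3, h1, map_sum]
  refine Finset.sum_congr rfl fun i _ => ?_
  exact map_smul Φ _ _

end Rounding

end

section

open Filter Polynomial

/-! ### Matrix approximations in the hyperfinite factor -/

namespace HyperfiniteII₁

variable (R : HyperfiniteII₁)

theorem norm_mat_vec_sq_eq (k : ℕ) (a : DyadicMat k) :
    ‖R.mat k a R.vec‖ ^ 2 = (matTrace (2 ^ k)).normSq a := by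
  rw [norm_mat_vec_sq, TracialState.normSq, matTrace_apply]
  have h2 : (((2 ^ k : ℕ) : ℂ))⁻¹ = (((2 ^ k : ℝ)⁻¹ : ℝ) : ℂ) := by push_cast; rfl
  rw [h2, Complex.re_ofReal_mul, div_eq_inv_mul]

/-- The space of the vectors `a v`, `a ∈ M_{2^k}`. -/
def matVec (k : ℕ) : DyadicMat k →ₗ[ℂ] R.H where
  toFun a := R.mat k a R.vec
  map_add' a b := by rw [map_add, add_apply]
  map_smul' c a := by rw [map_smul, smul_apply]; rfl

theorem matVec_apply (k : ℕ) (a : DyadicMat k) : R.matVec k a = R.mat k a R.vec := rfl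

/-- If `m v` is the projection of `a v` to the space of `M_{2^k}`, then `m` is the compression
of `a` to that space. -/
theorem inner_mat_mul_of_inner_mat {k : ℕ} {a : R.H →L[ℂ] R.H} (ha : a ∈ R.alg) {m : DyadicMat k}
    (h : ∀ c, ⟪R.matVec k c, R.matVec k m⟫_ℂ = ⟪R.matVec k c, a R.vec⟫_ℂ) (b c : DyadicMat k) :
    ⟪R.matVec k b, R.matVec k (m * c)⟫_ℂ = ⟪R.matVec k b, a (R.matVec k c)⟫_ℂ := by
  have key : ∀ {x y z : R.H →L[ℂ] R.H}, x ∈ R.alg → y ∈ R.alg → z ∈ R.alg →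
      ⟪x R.vec, y (z R.vec)⟫_ℂ = ⟪(x * star z) R.vec, y R.vec⟫_ℂ := by
    intro x y z hx hy hz
    have h1 := R.isTracialVec.tracial_centralizer (mul_mem (star_mem hx) hy) hz
    have h2 : ⟪x R.vec, y (z R.vec)⟫_ℂ = ⟪R.vec, (star x * y * z) R.vec⟫_ℂ :=
      (inner_star_right x R.vec _).symm
    have h3 : ⟪(x * star z) R.vec, y R.vec⟫_ℂ = ⟪R.vec, (z * (star x * y)) R.vec⟫_ℂ := by
      rw [← inner_star_right, star_mul, star_star]; rfl
    rw [h2, h3, h1]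
  have h4 : R.mat k b * star (R.mat k c) = R.mat k (b * star c) := by rw [map_mul, map_star]
  have h5 : R.matVec k (m * c) = R.mat k m (R.mat k c R.vec) := by
    rw [matVec_apply, map_mul]; rfl
  rw [h5, matVec_apply, matVec_apply,
    key (R.mat_mem_alg k b) (R.mat_mem_alg k m) (R.mat_mem_alg k c),
    key (R.mat_mem_alg k b) ha (R.mat_mem_alg k c), h4]
  exact h _

open scoped Matrix.Norms.L2Operator in
/-- The norm bound for the compression is obtained on matrices with a single nonzero column. -/
theorem norm_le_of_inner_mat {k : ℕ} {a : R.H →L[ℂ] R.H} (ha : a ∈ R.alg) {m : DyadicMat k}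
    (h : ∀ c, ⟪R.matVec k c, R.matVec k m⟫_ℂ = ⟪R.matVec k c, a R.vec⟫_ℂ) : ‖m‖ ≤ ‖a‖ := by
  have h1 : ∀ c, ‖R.matVec k (m * c)‖ ≤ ‖a‖ * ‖R.matVec k c‖ := by
    intro c
    have h2 := R.inner_mat_mul_of_inner_mat ha h (m * c) c
    have h3 : ‖R.matVec k (m * c)‖ ^ 2 ≤ ‖R.matVec k (m * c)‖ * (‖a‖ * ‖R.matVec k c‖) := by
      have h4 : ‖⟪R.matVec k (m * c), R.matVec k (m * c)⟫_ℂ‖ = ‖R.matVec k (m * c)‖ ^ 2 := by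
        rw [inner_self_eq_norm_sq_to_K]; simp
      rw [← h4, h2]
      exact (norm_inner_le_norm _ _).trans
        (mul_le_mul_of_nonneg_left (a.le_opNorm _) (norm_nonneg _))
    rcases (norm_nonneg (R.matVec k (m * c))).eq_or_lt with h0 | h0
    · rw [← h0]; positivity
    · rw [pow_two] at h3
      exact le_of_mul_le_mul_left h3 h0
  let i₀ : Fin (2 ^ k) := ⟨0, by positivity⟩
  let col : EuclideanSpace ℂ (Fin (2 ^ k)) → DyadicMat k := fun ξ =>
    Matrix.vecMulVec (WithLp.ofLp ξ) (Pi.single i₀ 1)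
  have h2 : ∀ ξ, ‖R.matVec k (col ξ)‖ = (Real.sqrt (2 ^ k))⁻¹ * ‖ξ‖ := by
    intro ξ
    have e1 : star (col ξ) * col ξ =
        (star (WithLp.ofLp ξ) ⬝ᵥ WithLp.ofLp ξ) •
          Matrix.vecMulVec (Pi.single i₀ 1) (Pi.single i₀ 1) := by
      rw [Matrix.star_eq_conjTranspose, Matrix.conjTranspose_vecMulVec,
        Matrix.vecMulVec_mul_vecMulVec,
        Pi.star_single, star_one]
      ext i j
      simp [Matrix.vecMulVec_apply]
      ring
    have e2 : (star (col ξ) * col ξ).trace = ((‖ξ‖ ^ 2 : ℝ) : ℂ) := by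
      rw [e1, Matrix.trace_smul, Matrix.trace_vecMulVec, single_dotProduct, Pi.single_eq_same,
        EuclideanSpace.norm_sq_eq]
      simp [dotProduct, Complex.conj_mul']
    refine (sq_eq_sq₀ (norm_nonneg _) (by positivity)).1 ?_
    rw [matVec_apply, norm_mat_vec_sq, e2, Complex.ofReal_re, mul_pow, inv_pow,
      Real.sq_sqrt (by positivity), div_eq_inv_mul]
  have h3 : ∀ ξ, m * col ξ = col (Matrix.toEuclideanCLM (𝕜 := ℂ) m ξ) := by
    intro ξ
    change m * Matrix.vecMulVec _ _ = Matrix.vecMulVec (m.mulVec _) _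
    rw [Matrix.mul_vecMulVec]
    rfl
  rw [← Matrix.l2_opNorm_toEuclideanCLM]
  refine ContinuousLinearMap.opNorm_le_bound _ (norm_nonneg _) fun ξ => ?_
  have h4 := h1 (col ξ)
  rw [h3, h2, h2, mul_left_comm] at h4
  exact le_of_mul_le_mul_left h4 (by positivity)

open scoped Matrix.Norms.L2Operator in
theorem exists_mat_approx {a : R.H →L[ℂ] R.H} (ha : a ∈ R.alg) (hsa : IsSelfAdjoint a) {ε : ℝ}
    (hε : 0 < ε) : ∃ k₀, ∀ k, k₀ ≤ k → ∃ m : DyadicMat k, IsSelfAdjoint m ∧ ‖m‖ ≤ ‖a‖ ∧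
      ‖(R.mat k m - a) R.vec‖ < ε := by
  obtain ⟨_, ⟨k₀, c, rfl⟩, hc⟩ := R.cyclic.exists_dist_lt (a R.vec) hε
  rw [dist_eq_norm] at hc
  refine ⟨k₀, fun k hk => ?_⟩
  obtain ⟨c', hc'⟩ := R.exists_mat_eq hk c
  let K := LinearMap.range (R.matVec k)
  have : FiniteDimensional ℂ K := LinearMap.finiteDimensional_range _
  obtain ⟨m, hm⟩ : K.starProjection (a R.vec) ∈ K := K.starProjection_apply_mem _
  have h1 : ∀ b, ⟪R.matVec k b, R.matVec k m⟫_ℂ = ⟪R.matVec k b, a R.vec⟫_ℂ := by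
    intro b
    have h2 := K.sub_starProjection_mem_orthogonal (a R.vec) (R.matVec k b) ⟨b, rfl⟩
    rw [inner_sub_right, sub_eq_zero, ← hm] at h2
    exact h2.symm
  have h2 : ‖(R.mat k m - a) R.vec‖ < ε := by
    have e : (R.mat k m - a) R.vec = -(a R.vec - K.starProjection (a R.vec)) := by
      rw [← hm, neg_sub]; rfl
    rw [e, norm_neg, Submodule.starProjection_minimal]
    refine lt_of_le_of_lt (ciInf_le ⟨0, Set.forall_mem_range.2 fun _ => norm_nonneg _⟩
      (⟨R.matVec k c', c', rfl⟩ : K)) ?_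
    change ‖a R.vec - R.mat k c' R.vec‖ < ε
    rwa [hc']
  refine ⟨(realPart m : DyadicMat k), (realPart m).2,
    (realPart.norm_le m).trans (R.norm_le_of_inner_mat ha h1), ?_⟩
  have h3 : R.mat k (realPart m : DyadicMat k) - a =
      (2 : ℂ)⁻¹ • (R.mat k m - a) + (2 : ℂ)⁻¹ • star (R.mat k m - a) := by
    rw [realPart_apply_coe, ← Complex.coe_smul, map_smul, map_add, map_star, star_sub, hsa.star_eq]
    push_cast
    rw [smul_add, smul_sub, smul_sub]
    have : a = (2 : ℂ)⁻¹ • a + (2 : ℂ)⁻¹ • a := by rw [← add_smul]; norm_num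
    nth_rw 1 [this]
    abel
  have h4 : ‖star (R.mat k m - a) R.vec‖ = ‖(R.mat k m - a) R.vec‖ :=
    R.norm_star_apply_vec (sub_mem (R.mat_mem_alg k m) ha)
  rw [h3, add_apply, smul_apply, smul_apply]
  refine (norm_add_le _ _).trans_lt ?_
  rw [norm_smul, norm_smul, h4, norm_inv, Complex.norm_ofNat]
  linarith

end HyperfiniteII₁

end

section

open Filter Polynomial

/-! ### Tracial states over `qa` are limits of matrix traces -/

theorem Ultrafilter.le_atTop_of_free {ω : Ultrafilter ℕ} (h : ∀ n, {n} ∉ ω) :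
    (ω : Filter ℕ) ≤ atTop := by
  rw [← Nat.cofinite_eq_atTop]
  refine ω.le_cofinite_or_eq_pure.resolve_right ?_
  rintro ⟨n, hn⟩
  refine h n ?_
  rw [hn]
  exact Set.mem_singleton n

/-- A projection-valued measure in the algebra of bounded sequences. -/
theorem isPVM_boundedMat {d : ℕ → ℕ} {S : Type} [Fintype S]
    {q : ∀ n, S → Matrix (Fin (d n)) (Fin (d n)) ℂ} (hq : ∀ n, IsPVM (q n))
    (hb : ∀ s, (fun n => q n s) ∈ boundedMat d) :
    IsPVM fun s => (⟨fun n => q n s, hb s⟩ : boundedMat d) where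
  sa s := Subtype.ext (funext fun n => (hq n).sa s)
  idem s := Subtype.ext (funext fun n => (hq n).idem s)
  orth s t hst := Subtype.ext (funext fun n => (hq n).orth s t hst)
  sum := by
    refine Subtype.ext (funext fun n => ?_)
    rw [AddSubmonoidClass.coe_finsetSum, Finset.sum_apply]
    exact (hq n).sum

open scoped Matrix.Norms.L2Operator in
theorem IsPVM.mem_boundedMat {d : ℕ → ℕ} {S : Type} [Fintype S]
    {q : ∀ n, S → Matrix (Fin (d n)) (Fin (d n)) ℂ} (hq : ∀ n, IsPVM (q n)) (s : S) :
    (fun n => q n s) ∈ boundedMat d :=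
  ⟨1, fun n => (hq n).norm_le_one s⟩

theorem boundedMat_aeval {d : ℕ → ℕ} (x : boundedMat d) (P : ℂ[X]) (n : ℕ) :
    (aeval x P).1 n = aeval (x.1 n) P := by
  have h := aeval_algHom_apply ((boundedMat d).subtype : boundedMat d →⋆ₐ[ℂ] _) x P
  change aeval x.1 P = (aeval x P).1 at h
  rw [← h, aeval_pi_apply]

namespace HyperfiniteII₁

variable (R : HyperfiniteII₁)

/-- The bounded sequences of matrices as sequences in the factor. -/
def dyadicSeq (k : ℕ → ℕ) : boundedMat (fun n => 2 ^ k n) →⋆ₐ[ℂ] R.boundedSeq where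
  toFun x := ⟨fun n => R.mat (k n) (x.1 n), fun n => R.mat_mem_alg _ _, by
    obtain ⟨M, hM⟩ := x.2
    open scoped Matrix.Norms.L2Operator in
    exact ⟨M, fun n => (NonUnitalStarAlgHom.norm_apply_le (R.mat (k n)) _).trans (hM n)⟩⟩
  map_one' := Subtype.ext (funext fun n => map_one (R.mat (k n)))
  map_mul' _ _ := Subtype.ext (funext fun n => map_mul (R.mat (k n)) _ _)
  map_zero' := Subtype.ext (funext fun n => map_zero (R.mat (k n)))
  map_add' _ _ := Subtype.ext (funext fun n => map_add (R.mat (k n)) _ _)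
  commutes' r := Subtype.ext (funext fun n => AlgHomClass.commutes (R.mat (k n)) r)
  map_star' _ := Subtype.ext (funext fun n => map_star (R.mat (k n)) _)

variable (ω : Ultrafilter ℕ)

theorem ultrapower_one_ne_zero : (1 : R.Ultrapower ω) ≠ 0 := by
  rw [← map_one (R.toUltraHom ω), toUltraHom_apply, Ne, toUltra_eq_zero_iff]
  intro h
  have h1 : ∀ n, ‖(1 : R.boundedSeq).1 n R.vec‖ = 1 := fun n => R.norm_vec
  simp only [h1] at h
  exact one_ne_zero (tendsto_nhds_unique tendsto_const_nhds h)

theorem exists_isSelfAdjoint_lift {p : R.Ultrapower ω} (hp : IsSelfAdjoint p) :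
    ∃ x : R.boundedSeq, IsSelfAdjoint x ∧ R.toUltraHom ω x = p := by
  obtain ⟨y, rfl⟩ := R.toUltra_surjective ω p
  refine ⟨(2 : ℂ)⁻¹ • (y + star y), ?_, ?_⟩
  · rw [isSelfAdjoint_iff, star_smul, star_add, star_star, add_comm]
    simp
  · rw [map_smul, map_add, map_star, toUltraHom_apply, hp.star_eq, ← two_smul ℂ, smul_smul]
    norm_num

theorem tendsto_norm_vec_iff {k : ℕ → ℕ} (x : boundedMat fun n => 2 ^ k n) :
    R.toUltraHom ω (R.dyadicSeq k x) = 0 ↔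
      Tendsto (fun n => (matTrace (2 ^ k n)).normSq (x.1 n)) ω (𝓝 0) := by
  rw [toUltraHom_apply, toUltra_eq_zero_iff]
  have h : ∀ n, (matTrace (2 ^ k n)).normSq (x.1 n) = ‖(R.dyadicSeq k x).1 n R.vec‖ ^ 2 := fun n =>
    (R.norm_mat_vec_sq_eq _ _).symm
  simp only [h]
  constructor
  · intro h1
    simpa using h1.pow 2
  · intro h1
    have h3 := (Real.continuous_sqrt.tendsto _).comp h1
    simpa only [Function.comp_def, Real.sqrt_sq (norm_nonneg _), Real.sqrt_zero] using h3

/-- Self-adjoint elements of the ultrapower are represented by sequences of matrices, whose sizes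
can be chosen in common for finitely many elements. -/
theorem exists_matrix_lift (hω : (ω : Filter ℕ) ≤ atTop) {ι : Type} [Finite ι]
    (h : ι → R.Ultrapower ω)
    (hh : ∀ i, ∃ x : R.boundedSeq, IsSelfAdjoint x ∧ R.toUltraHom ω x = h i) :
    ∃ (k : ℕ → ℕ) (m : ι → boundedMat fun n => 2 ^ k n), ∀ i, (∀ n, IsSelfAdjoint ((m i).1 n)) ∧
      R.toUltraHom ω (R.dyadicSeq k (m i)) = h i := by
  choose x hx hxh using hh
  have hsa : ∀ i n, IsSelfAdjoint ((x i).1 n) := fun i n => congrFun (congrArg Subtype.val (hx i)) n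
  have hpos : ∀ n : ℕ, (0 : ℝ) < 1 / ((n : ℝ) + 1) := fun n => Nat.one_div_pos_of_nat
  choose k₀ hk₀ using fun i n => R.exists_mat_approx ((x i).2.1 n) (hsa i n) (hpos n)
  choose k hk using fun n => (Set.finite_range fun i => k₀ i n).bddAbove
  choose m hm1 hm2 hm3 using fun i n => hk₀ i n (k n) (hk n (Set.mem_range_self i))
  have hb : ∀ i, (fun n => m i n) ∈ boundedMat fun n => 2 ^ k n := by
    intro i
    obtain ⟨M, hM⟩ := (x i).2.2
    exact ⟨M, fun n => (hm2 i n).trans (hM n)⟩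
  refine ⟨k, fun i => ⟨fun n => m i n, hb i⟩, fun i => ⟨fun n => hm1 i n, ?_⟩⟩
  rw [← hxh i, ← sub_eq_zero, ← map_sub, toUltraHom_apply, toUltra_eq_zero_iff]
  refine squeeze_zero (fun n => norm_nonneg _) (fun n => (hm3 i n).le) ?_
  exact tendsto_one_div_add_atTop_nhds_zero_nat.mono_left hω

/-- Projection-valued measures in the ultrapower are represented by sequences of projection-valued
measures of matrices. -/
theorem exists_pvm_lift (hω : (ω : Filter ℕ) ≤ atTop) {ι : Type} [Finite ι] {S : ι → Type}
    [∀ i, Fintype (S i)] {p : ∀ i, S i → R.Ultrapower ω} (hp : ∀ i, IsPVM (p i)) :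
    ∃ (k : ℕ → ℕ) (q : ∀ n i, S i → DyadicMat (k n)) (hq : ∀ n i, IsPVM (q n i)), ∀ i s,
      R.toUltraHom ω (R.dyadicSeq k ⟨fun n => q n i s, IsPVM.mem_boundedMat (fun n => hq n i) s⟩) =
        p i s := by
  obtain ⟨k, m, hm⟩ := R.exists_matrix_lift ω hω (fun i => (hp i).func label) fun i => by
    choose x hx hxp using fun s => R.exists_isSelfAdjoint_lift ω ((hp i).sa s)
    refine ⟨∑ s, label s • x s, ?_, ?_⟩
    · rw [isSelfAdjoint_iff, star_sum]
      refine Finset.sum_congr rfl fun s _ => ?_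
      rw [star_smul, (hx s).star_eq, label, star_natCast]
    · rw [map_sum, IsPVM.func_apply]
      refine Finset.sum_congr rfl fun s _ => ?_
      rw [map_smul, hxp]
  have hne : ∀ i, Nonempty (S i) := by
    intro i
    by_contra hn
    rw [not_nonempty_iff] at hn
    exact R.ultrapower_one_ne_zero ω ((hp i).sum.symm.trans (by simp))
  choose e he f hf using fun i n => exists_spectral_decomposition ((hm i).1 n)
  choose q hq hqm using fun n i => (he i n).exists_rounding (S := S i) (f i n) (matTrace (2 ^ k n))
  refine ⟨k, q, hq, fun i s => ?_⟩
  let Q : S i → boundedMat fun n => 2 ^ k n := fun s =>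
    ⟨fun n => q n i s, IsPVM.mem_boundedMat (fun n => hq n i) s⟩
  have hQ : IsPVM fun s => R.toUltraHom ω (R.dyadicSeq k (Q s)) :=
    (isPVM_boundedMat (fun n => hq n i) _).map ((R.toUltraHom ω).comp (R.dyadicSeq k))
  have h1 : R.toUltraHom ω (R.dyadicSeq k (aeval (m i) (labelPoly (S i)))) = 0 := by
    have h2 := aeval_algHom_apply ((R.toUltraHom ω).comp (R.dyadicSeq k)) (m i) (labelPoly (S i))
    refine h2.symm.trans ?_
    change aeval (R.toUltraHom ω (R.dyadicSeq k (m i))) _ = 0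
    rw [(hm i).2, IsPVM.aeval_func]
    simp only [eval_labelPoly_label]
    exact map_zero (hp i).func
  have h2 : R.toUltraHom ω (R.dyadicSeq k (m i - ∑ s, label s • Q s)) = 0 := by
    rw [tendsto_norm_vec_iff] at h1 ⊢
    have h3 := h1.const_mul (((2 : ℝ) ^ Fintype.card (S i)) ^ 2)
    rw [mul_zero] at h3
    refine squeeze_zero (fun n => TracialState.normSq_nonneg _ _) (fun n => ?_) h3
    have h4 := hqm n i
    rw [← hf i n, ← boundedMat_aeval] at h4
    have h5 : (m i - ∑ s, label s • Q s).1 n = (m i).1 n - ∑ s, label s • q n i s := by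
      change (m i).1 n - (∑ s, label s • Q s).1 n = _
      rw [AddSubmonoidClass.coe_finsetSum, Finset.sum_apply]
      rfl
    rw [h5]
    exact h4
  have h3 : ∑ s, label s • R.toUltraHom ω (R.dyadicSeq k (Q s)) = ∑ s, label s • p i s := by
    rw [map_sub, map_sub, (hm i).2, sub_eq_zero, map_sum, map_sum, IsPVM.func_apply] at h2
    rw [h2]
    refine Finset.sum_congr rfl fun s _ => ?_
    rw [map_smul, map_smul]
  exact congrFun (hQ.eq_of_sum_smul_eq (hp i) label_injective h3) s

end HyperfiniteII₁

/-- A tracial state is approximable if it is the limit of normalised traces of matrix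
representations. -/
def TracialState.Approximable {𝒜 : Type} [Ring 𝒜] [StarRing 𝒜] [Algebra ℂ 𝒜] (τ : TracialState 𝒜) :
    Prop :=
  ∃ (d : ℕ → ℕ) (_ : ∀ n, NeZero (d n)) (ρ : ∀ n, 𝒜 →⋆ₐ[ℂ] Matrix (Fin (d n)) (Fin (d n)) ℂ),
    ∀ a, Tendsto (fun n => (matTrace (d n)).toLin (ρ n a)) atTop (𝓝 (τ.toLin a))

section Approximation

variable {𝒜 : Type} [Ring 𝒜] [StarRing 𝒜] [Algebra ℂ 𝒜]

open scoped Matrix.Norms.L2Operator in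
theorem IsPVMAlgebra.mem_boundedMat (h𝒜 : IsPVMAlgebra 𝒜) {d : ℕ → ℕ}
    (ρ : ∀ n, 𝒜 →⋆ₐ[ℂ] Matrix (Fin (d n)) (Fin (d n)) ℂ) (a : 𝒜) :
    (fun n => ρ n a) ∈ boundedMat d := by
  obtain ⟨C, -, hC⟩ := h𝒜.exists_bound a
  exact ⟨C, fun n => hC _ (ρ n)⟩

/-- A sequence of matrix representations as a representation in bounded sequences. -/
def IsPVMAlgebra.seqHom (h𝒜 : IsPVMAlgebra 𝒜) {d : ℕ → ℕ}
    (ρ : ∀ n, 𝒜 →⋆ₐ[ℂ] Matrix (Fin (d n)) (Fin (d n)) ℂ) : 𝒜 →⋆ₐ[ℂ] boundedMat d where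
  toFun a := ⟨fun n => ρ n a, h𝒜.mem_boundedMat ρ a⟩
  map_one' := Subtype.ext (funext fun n => map_one (ρ n))
  map_mul' _ _ := Subtype.ext (funext fun n => map_mul (ρ n) _ _)
  map_zero' := Subtype.ext (funext fun n => map_zero (ρ n))
  map_add' _ _ := Subtype.ext (funext fun n => map_add (ρ n) _ _)
  commutes' r := Subtype.ext (funext fun n => AlgHomClass.commutes (ρ n) r)
  map_star' _ := Subtype.ext (funext fun n => map_star (ρ n) _)

theorem IsPVMAlgebra.seqHom_apply (h𝒜 : IsPVMAlgebra 𝒜) {d : ℕ → ℕ}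
    (ρ : ∀ n, 𝒜 →⋆ₐ[ℂ] Matrix (Fin (d n)) (Fin (d n)) ℂ) (a : 𝒜) (n : ℕ) :
    (h𝒜.seqHom ρ a).1 n = ρ n a := rfl

/-- A representation of finitely many projection-valued measures in the ultrapower lifts to matrix
representations. -/
theorem IsPVMAlgebra.exists_matrix_lift (h𝒜 : IsPVMAlgebra 𝒜) (R : HyperfiniteII₁)
    {ω : Ultrafilter ℕ} (hω : (ω : Filter ℕ) ≤ atTop) (π : 𝒜 →⋆ₐ[ℂ] R.Ultrapower ω) :
    ∃ (k : ℕ → ℕ) (ρ : ∀ n, 𝒜 →⋆ₐ[ℂ] Matrix (Fin (2 ^ k n)) (Fin (2 ^ k n)) ℂ),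
      ∀ a, R.toUltraHom ω (R.dyadicSeq k (h𝒜.seqHom ρ a)) = π a := by
  have h0 := h𝒜
  obtain ⟨ι, _, S, _, e, he, hadj, hlift⟩ := h0
  obtain ⟨k, q, hq, hqp⟩ := R.exists_pvm_lift ω hω (fun i => (he i).map π)
  choose ρ hρ using fun n => hlift (Matrix (Fin (2 ^ k n)) (Fin (2 ^ k n)) ℂ) (q n) (hq n)
  refine ⟨k, ρ, fun a => ?_⟩
  let Ψ : 𝒜 →⋆ₐ[ℂ] R.Ultrapower ω := ((R.toUltraHom ω).comp (R.dyadicSeq k)).comp (h𝒜.seqHom ρ)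
  have h1 : Ψ.toAlgHom = π.toAlgHom := by
    refine AlgHom.ext_of_adjoin_eq_top hadj ?_
    rintro _ ⟨i, s, rfl⟩
    change R.toUltraHom ω (R.dyadicSeq k (h𝒜.seqHom ρ (e i s))) = π (e i s)
    rw [← hqp i s]
    congr 2
    exact Subtype.ext (funext fun n => hρ n i s)
  exact DFunLike.congr_fun h1 a

/-- Pointwise approximation on finite sets suffices, since the algebra has countable dimension. -/
theorem IsPVMAlgebra.exists_seq_tendsto (h𝒜 : IsPVMAlgebra 𝒜) (f : ℕ → 𝒜 →ₗ[ℂ] ℂ)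
    (hf : ∀ (n : ℕ) (s : Finset 𝒜) (ε : ℝ), 0 < ε → ∃ (d : ℕ) (_ : NeZero d)
      (ρ : 𝒜 →⋆ₐ[ℂ] Matrix (Fin d) (Fin d) ℂ),
        ∀ a ∈ s, ‖(matTrace d).toLin (ρ a) - f n a‖ < ε) :
    ∃ (d : ℕ → ℕ) (_ : ∀ n, NeZero (d n)) (ρ : ∀ n, 𝒜 →⋆ₐ[ℂ] Matrix (Fin (d n)) (Fin (d n)) ℂ),
      ∀ a, Tendsto (fun n => (matTrace (d n)).toLin (ρ n a) - f n a) atTop (𝓝 0) := by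
  classical
  obtain ⟨w, hw⟩ := h𝒜.exists_seq_span
  have hpos : ∀ n : ℕ, (0 : ℝ) < 1 / ((n : ℝ) + 1) := fun n => Nat.one_div_pos_of_nat
  choose d hd ρ hρ using fun n => hf n ((Finset.range (n + 1)).image w) _ (hpos n)
  refine ⟨d, hd, ρ, fun a => ?_⟩
  have ha : a ∈ Submodule.span ℂ (Set.range w) := hw ▸ Submodule.mem_top
  induction ha using Submodule.span_induction with
  | mem x hx =>
    obtain ⟨i, rfl⟩ := hx
    rw [tendsto_zero_iff_norm_tendsto_zero]
    refine squeeze_zero' (Eventually.of_forall fun n => norm_nonneg _) ?_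
      tendsto_one_div_add_atTop_nhds_zero_nat
    filter_upwards [eventually_ge_atTop i] with n hn
    exact (hρ n _ (Finset.mem_image_of_mem w (Finset.mem_range.2 (Nat.lt_succ_of_le hn)))).le
  | zero => simp
  | add x y _ _ hx hy =>
    have := hx.add hy
    rw [add_zero] at this
    refine this.congr fun n => ?_
    rw [map_add, map_add, map_add]
    ring
  | smul c x _ hx =>
    have := hx.const_mul c
    rw [mul_zero] at this
    refine this.congr fun n => ?_
    rw [map_smul, map_smul, map_smul, smul_eq_mul, smul_eq_mul]
    ring

theorem IsPVMAlgebra.exists_approx_of_over_qa (h𝒜 : IsPVMAlgebra 𝒜) {τ : TracialState 𝒜}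
    (hτ : Model.qa.Over τ) (s : Finset 𝒜) {ε : ℝ} (hε : 0 < ε) :
    ∃ (d : ℕ) (_ : NeZero d) (ρ : 𝒜 →⋆ₐ[ℂ] Matrix (Fin d) (Fin d) ℂ),
      ∀ a ∈ s, ‖(matTrace d).toLin (ρ a) - τ.toLin a‖ < ε := by
  obtain ⟨B, _, π, φ, -, ⟨R, ω, j, hω, -, hlim⟩, hτφ⟩ := hτ
  obtain ⟨k, ρ, hρ⟩ := h𝒜.exists_matrix_lift R (Ultrafilter.le_atTop_of_free hω) (j.comp π)
  have h1 : ∀ a, Tendsto (fun n => (matTrace (2 ^ k n)).toLin (ρ n a)) ω (𝓝 (τ.toLin a)) := by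
    intro a
    rw [hτφ]
    refine (hlim (π a) _ (hρ a).symm).congr fun n => ?_
    refine (R.tr_mat _ _).trans ?_
    rw [matTrace_apply, div_eq_inv_mul]
    push_cast
    rfl
  have h2 : ∀ᶠ n in (ω : Filter ℕ), ∀ a ∈ s,
    ‖(matTrace (2 ^ k n)).toLin (ρ n a) - τ.toLin a‖ < ε := by
    rw [eventually_all_finset]
    intro a _
    have := Metric.tendsto_nhds.1 (h1 a) ε hε
    simpa only [dist_eq_norm] using this
  obtain ⟨n, hn⟩ := h2.exists
  exact ⟨2 ^ k n, inferInstance, ρ n, hn⟩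

theorem IsPVMAlgebra.approximable_of_over_qa (h𝒜 : IsPVMAlgebra 𝒜) {τ : TracialState 𝒜}
    (hτ : Model.qa.Over τ) : τ.Approximable := by
  obtain ⟨d, hd, ρ, h⟩ := h𝒜.exists_seq_tendsto (fun _ => τ.toLin) fun _ s _ hε =>
    h𝒜.exists_approx_of_over_qa hτ s hε
  refine ⟨d, hd, ρ, fun a => ?_⟩
  simpa using (h a).add_const (τ.toLin a)

end Approximation

end

section

open Filter
open scoped Matrix.Norms.L2Operator

/-! ### The models `q` and `qa` -/

section Approximable

theorem TracialState.eq_matTrace {d : ℕ} [NeZero d] (φ : TracialState (Matrix (Fin d) (Fin d) ℂ))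
    (a : Matrix (Fin d) (Fin d) ℂ) : φ.toLin a = (matTrace d).toLin a := by
  have hoff : ∀ i j : Fin d, i ≠ j → φ.toLin (Matrix.single i j 1) = 0 := by
    intro i j hij
    have h := φ.tracial (Matrix.single i i 1) (Matrix.single i j 1)
    rwa [Matrix.single_mul_single_same, Matrix.single_mul_single_of_ne _ _ _ _ hij.symm, map_zero,
      one_mul] at h
  have hdiag : ∀ i j : Fin d, φ.toLin (Matrix.single i i 1) = φ.toLin (Matrix.single j j 1) := by
    intro i j
    have h := φ.tracial (Matrix.single i j 1) (Matrix.single j i 1)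
    rwa [Matrix.single_mul_single_same, Matrix.single_mul_single_same, one_mul] at h
  have h1 : φ.toLin = φ.toLin (Matrix.single 0 0 1) • Matrix.traceLinearMap (Fin d) ℂ ℂ := by
    refine Matrix.ext_linearMap ℂ fun i j => LinearMap.ext_ring ?_
    change φ.toLin (Matrix.single i j 1) =
      φ.toLin (Matrix.single 0 0 1) * (Matrix.single i j 1).trace
    by_cases hij : i = j
    · subst hij
      rw [Matrix.trace_single_eq_same, mul_one, hdiag i 0]
    · rw [Matrix.trace_single_eq_of_ne _ _ _ hij, mul_zero, hoff i j hij]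
  have h2 : φ.toLin (Matrix.single 0 0 1) = (d : ℂ)⁻¹ := by
    have h := φ.map_one
    rw [h1] at h
    change φ.toLin (Matrix.single 0 0 1) * (1 : Matrix (Fin d) (Fin d) ℂ).trace = 1 at h
    rw [Matrix.trace_one, Fintype.card_fin] at h
    exact eq_inv_of_mul_eq_one_left h
  rw [h1, h2]
  rfl

variable {𝒜 𝒜₁ 𝒜₂ : Type} [Ring 𝒜] [StarRing 𝒜] [Algebra ℂ 𝒜] [Ring 𝒜₁] [StarRing 𝒜₁]
  [Algebra ℂ 𝒜₁] [Ring 𝒜₂] [StarRing 𝒜₂] [Algebra ℂ 𝒜₂]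

theorem TracialState.approximable_of_over_q {τ : TracialState 𝒜} (hτ : Model.q.Over τ) :
    τ.Approximable := by
  obtain ⟨B, _, π, φ, ⟨d, hd, ⟨f⟩⟩, -, h⟩ := hτ
  have : NeZero d := ⟨hd⟩
  let g : Matrix (Fin d) (Fin d) ℂ →⋆ₐ[ℂ] B := f.symm
  refine ⟨fun _ => d, fun _ => ⟨hd⟩, fun _ => (f : B →⋆ₐ[ℂ] _).comp π, fun a => ?_⟩
  have h1 : (matTrace d).toLin (f (π a)) = τ.toLin a := by
    rw [← (φ.comp g).eq_matTrace, h]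
    exact congrArg φ.toLin (f.symm_apply_apply (π a))
  refine tendsto_const_nhds.congr fun n => ?_
  exact h1.symm

/-- Approximable tracial states are realised by commuting representations in a common member of
`qa`. -/
theorem IsPVMAlgebra.exists_commuting_qa (h₁ : IsPVMAlgebra 𝒜₁) (h₂ : IsPVMAlgebra 𝒜₂)
    {τ₁ : TracialState 𝒜₁} {τ₂ : TracialState 𝒜₂} (hτ₁ : τ₁.Approximable) (hτ₂ : τ₂.Approximable) :
    ∃ (C : Type) (_ : CStarAlgebra C) (ρ₁ : 𝒜₁ →⋆ₐ[ℂ] C) (ρ₂ : 𝒜₂ →⋆ₐ[ℂ] C) (χ : TracialState C),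
      Model.qa.mem C ∧ Model.qa.trace C χ ∧ χ.Faithful ∧ (∀ a b, Commute (ρ₁ a) (ρ₂ b)) ∧
      (∀ a, χ.toLin (ρ₁ a) = τ₁.toLin a) ∧ ∀ a, χ.toLin (ρ₂ a) = τ₂.toLin a := by
  obtain ⟨d, hd, α, hα⟩ := hτ₁
  obtain ⟨e, he, β, hβ⟩ := hτ₂
  have hde : ∀ n, NeZero (d n * e n) := fun n => ⟨mul_ne_zero (NeZero.ne _) (NeZero.ne _)⟩
  obtain ⟨C, _, Θ, χ, hC, hχ, hf, hlim⟩ := exists_matrix_ultraproduct fun n => d n * e n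
  refine ⟨C, _, Θ.comp (h₁.seqHom fun n => (kronLeft (d n) (e n)).comp (α n)),
    Θ.comp (h₂.seqHom fun n => (kronRight (d n) (e n)).comp (β n)), χ, hC, hχ, hf, fun a b => ?_,
    fun a => ?_, fun a => ?_⟩
  · refine Commute.map (x := h₁.seqHom _ a) (y := h₂.seqHom _ b) ?_ Θ
    exact Subtype.ext (funext fun n => commute_kron (α n a) (β n b))
  · refine tendsto_nhds_unique (hlim _) ?_
    refine ((hα a).mono_left Nat.hyperfilter_le_atTop).congr fun n => ?_
    exact (matTrace_kronLeft (α n a)).symm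
  · refine tendsto_nhds_unique (hlim _) ?_
    refine ((hβ a).mono_left Nat.hyperfilter_le_atTop).congr fun n => ?_
    exact (matTrace_kronRight (β n a)).symm

end Approximable

namespace Model

theorem faithful_of_qa_trace {B : Type} [CStarAlgebra B] {φ : TracialState B}
    (h : qa.trace B φ) : φ.Faithful := by
  obtain ⟨R, ω, j, -, hj, hlim⟩ := h
  obtain ⟨C, _, e, χ, hχ, hχlim⟩ := R.exists_ultrapower_equiv ω
  have h1 : ∀ b, φ.toLin b = χ.toLin (e (j b)) := by
    intro b
    obtain ⟨x, hx⟩ := R.toUltra_surjective ω (j b)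
    rw [← hx]
    exact tendsto_nhds_unique (hlim b x hx.symm) (hχlim x)
  intro b hb
  rw [h1, map_mul, map_star, map_mul, map_star] at hb
  have h2 := hχ _ hb
  rw [map_eq_zero_iff e e.injective, map_eq_zero_iff j hj] at h2
  exact h2

theorem exists_qa_trace {B : Type} [CStarAlgebra B] (h : qa.mem B) :
    ∃ φ : TracialState B, qa.trace B φ := by
  obtain ⟨R, ω, j, hω, hj⟩ := h
  obtain ⟨C, _, e, χ, hχ, hχlim⟩ := R.exists_ultrapower_equiv ω
  refine ⟨χ.comp ((e : R.Ultrapower ω →⋆ₐ[ℂ] C).comp j), R, ω, j, hω, hj, fun b x hx => ?_⟩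
  rw [TracialState.comp_apply]
  change Tendsto _ _ (𝓝 (χ.toLin (e (j b))))
  rw [hx]
  exact hχlim x

theorem tensorClosed_qa : qa.TensorClosed := by
  intro 𝒜₁ 𝒜₂ _ _ _ _ _ _ h₁ h₂ B₁ B₂ _ _ π₁ π₂ hB₁ hB₂
  obtain ⟨φ₁, hφ₁⟩ := exists_qa_trace hB₁
  obtain ⟨φ₂, hφ₂⟩ := exists_qa_trace hB₂
  obtain ⟨C, _, ρ₁, ρ₂, χ, hC, -, hχ, hc, e₁, e₂⟩ := h₁.exists_commuting_qa h₂
    (h₁.approximable_of_over_qa (τ := φ₁.comp π₁) ⟨B₁, _, π₁, φ₁, hB₁, hφ₁, fun _ => rfl⟩)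
    (h₂.approximable_of_over_qa (τ := φ₂.comp π₂) ⟨B₂, _, π₂, φ₂, hB₂, hφ₂, fun _ => rfl⟩)
  -- Both kernels are those of the trace seminorm.
  have key : ∀ {𝒜 B : Type} [Ring 𝒜] [StarRing 𝒜] [Algebra ℂ 𝒜] [CStarAlgebra B]
      {φ : TracialState B} {π : 𝒜 →⋆ₐ[ℂ] B} {ρ : 𝒜 →⋆ₐ[ℂ] C}, φ.Faithful →
      (∀ a, χ.toLin (ρ a) = (φ.comp π).toLin a) → ∀ a, ρ a = 0 ↔ π a = 0 := by
    intro 𝒜 B _ _ _ _ φ π ρ hφ h a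
    have h1 : χ.normSq (ρ a) = φ.normSq (π a) := by
      rw [← TracialState.normSq_of_eq (fun a => (h a).symm) a]
      exact TracialState.normSq_of_eq (fun a => rfl) a
    constructor
    · intro h2
      rw [h2, χ.normSq_zero] at h1
      exact hφ.eq_zero h1.symm
    · intro h2
      rw [h2, φ.normSq_zero] at h1
      exact hχ.eq_zero h1
  exact ⟨C, _, ρ₁, ρ₂, hC, hc, key (faithful_of_qa_trace hφ₁) e₁, key (faithful_of_qa_trace hφ₂) e₂⟩

theorem traceTensor_q_qa : q.TraceTensor qa := by
  intro 𝒜₁ 𝒜₂ _ _ _ _ _ _ h₁ h₂ B₁ B₂ _ _ π₁ π₂ hB₁ hB₂ φ hφ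
  obtain ⟨φ₁, hφ₁⟩ := exists_qa_trace hB₁
  obtain ⟨C, _, ρ₁, ρ₂, χ, hC, hχC, hχ, hc, e₁, e₂⟩ := h₁.exists_commuting_qa h₂
    (h₁.approximable_of_over_qa (τ := φ₁.comp π₁) ⟨B₁, _, π₁, φ₁, hB₁, hφ₁, fun _ => rfl⟩)
    (TracialState.approximable_of_over_q (τ := φ.comp π₂) ⟨B₂, _, π₂, φ, hB₂, hφ, fun _ => rfl⟩)
  refine ⟨C, _, ρ₁, ρ₂, χ, hC, hχC, hc, fun a ha => hχ.eq_zero ?_, fun a => (e₂ a).symm⟩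
  rw [← TracialState.normSq_of_eq (fun a => (e₁ a).symm) a,
    TracialState.normSq_of_eq (φ := φ₁) (π := π₁) (fun a => rfl) a, ha, φ₁.normSq_zero]

theorem limitClosed_qa : qa.LimitClosed qa := by
  intro 𝒜 _ _ _ _ h τ hτ
  obtain ⟨d, _, ρ, hρ⟩ := h.exists_seq_tendsto (fun n => (τ n).toLin) fun n s _ hε =>
    h.exists_approx_of_over_qa (hτ n) s hε
  obtain ⟨C, _, Θ, χ, hC, -, hf, hlim⟩ := exists_matrix_ultraproduct d
  refine ⟨C, _, Θ.comp (h.seqHom ρ), χ, hC, hf, fun a => ?_⟩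
  have h1 := (hlim (h.seqHom ρ a)).sub ((hρ a).mono_left Nat.hyperfilter_le_atTop)
  rw [sub_zero] at h1
  refine h1.congr fun n => ?_
  rw [h.seqHom_apply, sub_sub_cancel]

theorem q_algSubset_qa : q.AlgSubset qa := by
  rintro B _ ⟨d, hd, ⟨f⟩⟩
  have : NeZero d := ⟨hd⟩
  obtain ⟨C, _, Θ, χ, ⟨R, ω, j, hω, hj⟩, -, hf, hlim⟩ := exists_matrix_ultraproduct (fun _ => d)
  let c : Matrix (Fin d) (Fin d) ℂ →⋆ₐ[ℂ] boundedMat fun _ => d :=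
    { toFun := fun a => ⟨fun _ => a, ‖a‖, fun _ => le_rfl⟩
      map_one' := rfl
      map_mul' := fun _ _ => rfl
      map_zero' := rfl
      map_add' := fun _ _ => rfl
      commutes' := fun _ => rfl
      map_star' := fun _ => rfl }
  refine ⟨R, ω, (j.comp (Θ.comp c)).comp (f : B →⋆ₐ[ℂ] _), hω, ?_⟩
  refine (hj.comp ((injective_iff_map_eq_zero (Θ.comp c)).2 fun a ha => ?_)).comp f.injective
  have h1 : (matTrace d).toLin (star a * a) = 0 := by
    have h2 := hlim (c (star a * a))
    have h3 : Θ (c (star a * a)) = 0 := by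
      change (Θ.comp c) (star a * a) = 0
      rw [map_mul, ha, mul_zero]
    rw [h3, map_zero] at h2
    exact tendsto_nhds_unique tendsto_const_nhds h2
  rw [matTrace_apply] at h1
  have h4 := (mul_eq_zero.1 h1).resolve_left (inv_ne_zero (Nat.cast_ne_zero.2 hd))
  exact Matrix.trace_conjTranspose_mul_self_eq_zero_iff.1 h4

theorem q_mem_matrix (d : ℕ) [NeZero d] : q.mem (Matrix (Fin d) (Fin d) ℂ) :=
  ⟨d, NeZero.ne d, ⟨StarAlgEquiv.refl ℂ _⟩⟩

theorem q_mem_complex : q.mem ℂ := by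
  let f : ℂ →⋆ₐ[ℂ] Matrix (Fin 1) (Fin 1) ℂ :=
    { Algebra.ofId ℂ (Matrix (Fin 1) (Fin 1) ℂ) with
      map_star' := fun c => algebraMap_star_comm c }
  refine ⟨1, one_ne_zero, ⟨StarAlgEquiv.ofBijective f ⟨(algebraMap ℂ _).injective, fun a => ?_⟩⟩⟩
  refine ⟨a 0 0, ?_⟩
  change algebraMap ℂ (Matrix (Fin 1) (Fin 1) ℂ) (a 0 0) = a
  ext i j
  rw [Subsingleton.elim i 0, Subsingleton.elim j 0, Matrix.algebraMap_eq_diagonal]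
  rfl

theorem qa_mem_complex : qa.mem ℂ := q_algSubset_qa ℂ q_mem_complex

end Model

/-! ### Robust `q`-gadgets are `qa`-gadgets -/

section QToQa

variable {σ : Signature} {G A : Type} [Fintype A] [Fintype G] [Fintype σ.Sym]
  {𝔾 : RelStr σ G} {𝔸 : RelStr σ A} {x y : G}

theorem ARobustBound.qa_of_q (h : ARobustBound Model.q 𝔸 𝔾 x y) :
    ARobustBound Model.qa 𝔸 𝔾 x y := by
  intro ε hε
  obtain ⟨δ, hδ, h⟩ := h (ε / 2) (half_pos hε)
  refine ⟨δ, hδ, fun B _ hB φ hφ p hp hv => ?_⟩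
  obtain ⟨π, hπ⟩ := exists_lift_morA p hp
  obtain ⟨d, _, ρ, hρ⟩ := isPVMAlgebra_morA.approximable_of_over_qa (τ := φ.comp π)
    ⟨B, _, π, φ, hB, hφ, fun _ => rfl⟩
  have hn := TracialState.tendsto_normSq (τ := fun n => (matTrace (d n)).comp (ρ n)) (π := π) hρ
  have hV : Tendsto (fun n => violA 𝔾 𝔸 ((matTrace (d n)).comp (ρ n)) MorA.p) atTop
      (𝓝 (violA 𝔾 𝔸 φ p)) := by
    have e : p = fun x a => π (MorA.p x a) := funext fun x => funext fun a => (hπ x a).symm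
    rw [e]
    simp only [violA, ← map_prodGen]
    exact tendsto_finsetSum _ fun _ _ => tendsto_finsetSum _ fun _ _ => hn _
  have hc : Tendsto (fun n => commSq ((matTrace (d n)).comp (ρ n)) (MorA.p (A := A) x) (MorA.p y))
      atTop (𝓝 (commSq φ (p x) (p y))) := by
    have e : ∀ x, p x = fun a => π (MorA.p x a) := fun x => funext fun a => (hπ x a).symm
    rw [e, e]
    simp only [commSq, ← map_mul, ← map_sub]
    exact tendsto_finsetSum _ fun _ _ => tendsto_finsetSum _ fun _ _ => hn _
  refine lt_of_le_of_lt (le_of_tendsto hc ?_) (half_lt_self hε)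
  filter_upwards [hV.eventually_lt_const hv] with n hvn
  rw [commSq_of_eq (π := ρ n) (φ := matTrace (d n)) fun _ => rfl]
  rw [violA_of_eq (π := ρ n) (φ := matTrace (d n)) fun _ => rfl] at hvn
  exact (h _ (Model.q_mem_matrix _) (matTrace (d n)) trivial (fun x a => ρ n (MorA.p x a))
    (fun x => (isPVM_morA x).map (ρ n)) hvn).le

theorem CVRobustBound.qa_of_q (h : CVRobustBound Model.q 𝔸 𝔾 x y) :
    CVRobustBound Model.qa 𝔸 𝔾 x y := by
  intro ε hε
  obtain ⟨δ, hδ, h⟩ := h (ε / 2) (half_pos hε)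
  refine ⟨δ, hδ, fun B _ hB φ hφ Φ p hΦ hp hv => ?_⟩
  obtain ⟨π, hπΦ, hπ⟩ := exists_lift_morCV (𝔸 := 𝔸) Φ p hΦ hp
  obtain ⟨d, _, ρ, hρ⟩ := isPVMAlgebra_morCV.approximable_of_over_qa (τ := φ.comp π)
    ⟨B, _, π, φ, hB, hφ, fun _ => rfl⟩
  have hn := TracialState.tendsto_normSq (τ := fun n => (matTrace (d n)).comp (ρ n)) (π := π) hρ
  have hV : Tendsto (fun n => violCV 𝔾 𝔸 ((matTrace (d n)).comp (ρ n)) (MorCV.phi 𝔾 𝔸)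
      (MorCV.p 𝔾 𝔸)) atTop (𝓝 (violCV 𝔾 𝔸 φ Φ p)) := by
    simp only [violCV, ← hπΦ, ← hπ]
    simp only [← map_one π, ← map_sub, ← map_mul]
    exact tendsto_finsetSum _ fun _ _ => tendsto_finsetSum _ fun _ _ => tendsto_finsetSum _
      fun _ _ => hn _
  have hc : Tendsto (fun n => commSq ((matTrace (d n)).comp (ρ n)) (MorCV.p 𝔾 𝔸 x) (MorCV.p 𝔾 𝔸 y))
      atTop (𝓝 (commSq φ (p x) (p y))) := by
    simp only [commSq, ← hπ, ← map_mul, ← map_sub]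
    exact tendsto_finsetSum _ fun _ _ => tendsto_finsetSum _ fun _ _ => hn _
  refine lt_of_le_of_lt (le_of_tendsto hc ?_) (half_lt_self hε)
  filter_upwards [hV.eventually_lt_const hv] with n hvn
  rw [commSq_of_eq (π := ρ n) (φ := matTrace (d n)) fun _ => rfl]
  rw [violCV_of_eq (π := ρ n) (φ := matTrace (d n)) fun _ => rfl] at hvn
  exact (h _ (Model.q_mem_matrix _) (matTrace (d n)) trivial (fun c b => ρ n (MorCV.phi 𝔾 𝔸 c b))
    (fun x a => ρ n (MorCV.p 𝔾 𝔸 x a)) (fun c => (isPVM_morCV_phi c).map (ρ n))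
    (fun x => (isPVM_morCV_p x).map (ρ n)) hvn).le

theorem eq_zero_of_forall_lt {t : ℝ} (h0 : 0 ≤ t) (h : ∀ ε : ℝ, 0 < ε → t < ε) : t = 0 := by
  by_contra hne
  exact lt_irrefl t (h t (lt_of_le_of_ne h0 (Ne.symm hne)))

theorem IsARobustGadget.qa_of_q (h : IsARobustGadget Model.q 𝔸 𝔾 x y) :
    IsARobustGadget Model.qa 𝔸 𝔾 x y := by
  rw [isARobustGadget_iff, isGadget_iff] at h ⊢
  have hb := h.2.qa_of_q
  refine ⟨⟨fun a b => ?_, fun B _ hB p hp => ?_⟩, hb⟩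
  · obtain ⟨B, _, p, hB, hp⟩ := h.1.1 a b
    exact ⟨B, _, p, Model.q_algSubset_qa B hB, hp⟩
  · obtain ⟨φ, hφ⟩ := Model.exists_qa_trace hB
    refine (Model.faithful_of_qa_trace hφ).commute
      (eq_zero_of_forall_lt (commSq_nonneg _ _ _) fun ε hε => ?_)
    obtain ⟨δ, hδ, hb⟩ := hb ε hε
    refine hb B hB φ hφ p hp.pvm ?_
    rw [violA]
    rwa [Finset.sum_eq_zero fun c _ => Finset.sum_eq_zero fun b _ => ?_]
    rw [hp.rel c.1 _ c.2.2 b.1 b.2, φ.normSq_zero]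

theorem IsCVRobustGadget.qa_of_q (h : IsCVRobustGadget Model.q 𝔸 𝔾 x y) :
    IsCVRobustGadget Model.qa 𝔸 𝔾 x y := by
  rw [isCVRobustGadget_iff, isOracularGadget_iff] at h ⊢
  have hb := h.2.qa_of_q
  refine ⟨⟨fun a b => ?_, fun B _ hB p hp => ?_⟩, hb⟩
  · obtain ⟨B, _, p, hB, hp⟩ := h.1.1 a b
    exact ⟨B, _, p, Model.q_algSubset_qa B hB, hp⟩
  · obtain ⟨φ, hφ⟩ := Model.exists_qa_trace hB
    refine (Model.faithful_of_qa_trace hφ).commute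
      (eq_zero_of_forall_lt (commSq_nonneg _ _ _) fun ε hε => ?_)
    obtain ⟨δ, hδ, hb⟩ := hb ε hε
    refine hb B hB φ hφ _ p hp.joint.joint hp.pvm ?_
    rw [violCV]
    rwa [Finset.sum_eq_zero fun c _ => Finset.sum_eq_zero fun b _ =>
      Finset.sum_eq_zero fun i _ => ?_]
    rw [hp.joint.consistent, φ.normSq_zero]

end QToQa

end

/-! ### Relations between the notions of gadget -/

section Main

variable {σ : Signature} {A : Type} [Fintype A] {𝔸 : RelStr σ A} {Q Q' : Model}

theorem HasGadget.of_algSubset (hQ : Q.IsMinTensorMonoid) (hQ' : Q'.IsMinTensorMonoid)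
    (h : Q.AlgSubset Q') : HasGadget Q' 𝔸 → HasGadget Q 𝔸 := by
  rintro ⟨G, _, 𝔾, x, y, hg⟩
  exact ⟨_, inferInstance, _, _, _,
    hg.canonical hQ'.mem_complex hQ'.tensorClosed hQ.mem_complex h⟩

theorem HasOracularGadget.of_algSubset (hQ : Q.IsMinTensorMonoid) (hQ' : Q'.IsMinTensorMonoid)
    (h : Q.AlgSubset Q') : HasOracularGadget Q' 𝔸 → HasOracularGadget Q 𝔸 := by
  rintro ⟨G, _, 𝔾, x, y, hg⟩
  exact ⟨_, inferInstance, _, _, _,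
    hg.canonical hQ'.mem_complex hQ'.tensorClosed hQ.mem_complex h⟩

/-- If the canonical structure is a gadget, it is also an oracular one, since it is realised by
commuting projections. -/
theorem IsGadget.isOracularGadget (hC : Q.mem ℂ)
    (h : IsGadget Q 𝔸 (canStr 𝔸) (canFst A) (canSnd A)) :
    IsOracularGadget Q 𝔸 (canStr 𝔸) (canFst A) (canSnd A) := by
  rw [isGadget_iff] at h
  rw [isOracularGadget_iff]
  exact ⟨exists_canonical_realization hC, fun B _ hB p hp => h.2 B hB p hp.toIsPlusHom⟩

theorem HasGadget.hasOracularGadget (hQ : Q.IsMinTensorMonoid) :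
    HasGadget Q 𝔸 → HasOracularGadget Q 𝔸 := by
  rintro ⟨G, _, 𝔾, x, y, hg⟩
  exact ⟨_, inferInstance, _, _, _, (hg.canonical hQ.mem_complex hQ.tensorClosed hQ.mem_complex
    fun _ _ h => h).isOracularGadget hQ.mem_complex⟩

variable [Fintype σ.Sym]

theorem HasGadget.hasARobustGadget_of_cstar (h : HasGadget Model.cstar 𝔸)
    (hQ : Q.IsMinTensorMonoid) : HasARobustGadget Q 𝔸 := by
  obtain ⟨G, _, 𝔾, x, y, hg⟩ := h
  have hS := Model.isMinTensorMonoid_cstar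
  refine ⟨_, inferInstance, _, _, _, isARobustGadget_iff.2
    ⟨hg.canonical hS.mem_complex hS.tensorClosed hQ.mem_complex hQ.algSubset_cstar, ?_⟩⟩
  exact (hg.canonical hS.mem_complex hS.tensorClosed hS.mem_complex fun _ _ h => h).aRobustBound
    (Model.limitClosed_cstar Q)

theorem HasOracularGadget.hasCVRobustGadget_of_cstar (h : HasOracularGadget Model.cstar 𝔸)
    (hQ : Q.IsMinTensorMonoid) : HasCVRobustGadget Q 𝔸 := by
  obtain ⟨G, _, 𝔾, x, y, hg⟩ := h
  have hS := Model.isMinTensorMonoid_cstar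
  refine ⟨_, inferInstance, _, _, _, isCVRobustGadget_iff.2
    ⟨hg.canonical hS.mem_complex hS.tensorClosed hQ.mem_complex hQ.algSubset_cstar, ?_⟩⟩
  exact (hg.canonical hS.mem_complex hS.tensorClosed hS.mem_complex fun _ _ h => h).cvRobustBound
    (Model.limitClosed_cstar Q)

theorem HasARobustGadget.hasGadget : HasARobustGadget Q 𝔸 → HasGadget Q 𝔸 := by
  rintro ⟨G, hG, 𝔾, x, y, h⟩
  exact ⟨G, hG, 𝔾, x, y, h.gadget⟩

theorem HasCVRobustGadget.hasOracularGadget : HasCVRobustGadget Q 𝔸 → HasOracularGadget Q 𝔸 := by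
  rintro ⟨G, hG, 𝔾, x, y, h⟩
  exact ⟨G, hG, 𝔾, x, y, h.gadget⟩

/-- The canonical structure inherits the robustness of a gadget of a larger model. -/
theorem HasARobustGadget.canonical (hC' : Q'.mem ℂ) (hT : Q'.TensorClosed) (hTT : Q.TraceTensor Q')
    (hC : Q.mem ℂ) (hQ : Q.AlgSubset Q') (h : HasARobustGadget Q' 𝔸) :
    IsARobustGadget Q 𝔸 (canStr 𝔸) (canFst A) (canSnd A) := by
  obtain ⟨G, _, 𝔾, x, y, h⟩ := h
  rw [isARobustGadget_iff] at h ⊢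
  exact ⟨h.1.canonical hC' hT hC hQ, h.2.canonical hC' hT hTT h.1⟩

theorem HasCVRobustGadget.canonical (hC' : Q'.mem ℂ) (hT : Q'.TensorClosed)
    (hTT : Q.TraceTensor Q') (hC : Q.mem ℂ) (hQ : Q.AlgSubset Q') (h : HasCVRobustGadget Q' 𝔸) :
    IsCVRobustGadget Q 𝔸 (canStr 𝔸) (canFst A) (canSnd A) := by
  obtain ⟨G, _, 𝔾, x, y, h⟩ := h
  rw [isCVRobustGadget_iff] at h ⊢
  exact ⟨h.1.canonical hC' hT hC hQ, h.2.canonical hC' hT hTT h.1⟩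

theorem HasARobustGadget.of_subset (hQ : Q.IsMinTensorMonoid) (hQ' : Q'.IsMinTensorMonoid)
    (hs : Q.Subset Q') (htr : Q'.IsTracial ∨ Q' = Model.cstar) (h : HasARobustGadget Q' 𝔸) :
    HasARobustGadget Q 𝔸 := by
  rcases htr with htr | rfl
  · exact ⟨_, inferInstance, _, _, _, h.canonical hQ'.mem_complex hQ'.tensorClosed
      (hQ'.traceTensor hs htr) hQ.mem_complex hs.algSubset⟩
  · exact h.hasGadget.hasARobustGadget_of_cstar hQ

theorem HasCVRobustGadget.of_subset (hQ : Q.IsMinTensorMonoid) (hQ' : Q'.IsMinTensorMonoid)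
    (hs : Q.Subset Q') (htr : Q'.IsTracial ∨ Q' = Model.cstar) (h : HasCVRobustGadget Q' 𝔸) :
    HasCVRobustGadget Q 𝔸 := by
  rcases htr with htr | rfl
  · exact ⟨_, inferInstance, _, _, _, h.canonical hQ'.mem_complex hQ'.tensorClosed
      (hQ'.traceTensor hs htr) hQ.mem_complex hs.algSubset⟩
  · exact h.hasOracularGadget.hasCVRobustGadget_of_cstar hQ

theorem HasARobustGadget.hasCVRobustGadget (hQ : Q.IsMinTensorMonoid)
    (htr : Q.IsTracial ∨ Q = Model.cstar) (h : HasARobustGadget Q 𝔸) : HasCVRobustGadget Q 𝔸 := by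
  rcases htr with htr | rfl
  · have h' := h.canonical hQ.mem_complex hQ.tensorClosed
      (hQ.traceTensor (fun _ _ hB => ⟨hB, fun _ h => h⟩) htr) hQ.mem_complex fun _ _ h => h
    rw [isARobustGadget_iff] at h'
    exact ⟨_, inferInstance, _, _, _, isCVRobustGadget_iff.2
      ⟨h'.1.isOracularGadget hQ.mem_complex, h'.2.cvRobustBound⟩⟩
  · exact (h.hasGadget.hasOracularGadget hQ).hasCVRobustGadget_of_cstar hQ

theorem hasGadget_iff_hasARobustGadget (h : Q.LimitClosed Q) :
    HasGadget Q 𝔸 ↔ HasARobustGadget Q 𝔸 := by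
  refine ⟨?_, HasARobustGadget.hasGadget⟩
  rintro ⟨G, _, 𝔾, x, y, hg⟩
  exact ⟨G, _, 𝔾, x, y, isARobustGadget_iff.2 ⟨hg, hg.aRobustBound h⟩⟩

theorem hasOracularGadget_iff_hasCVRobustGadget (h : Q.LimitClosed Q) :
    HasOracularGadget Q 𝔸 ↔ HasCVRobustGadget Q 𝔸 := by
  refine ⟨?_, HasCVRobustGadget.hasOracularGadget⟩
  rintro ⟨G, _, 𝔾, x, y, hg⟩
  exact ⟨G, _, 𝔾, x, y, isCVRobustGadget_iff.2 ⟨hg, hg.cvRobustBound h⟩⟩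

theorem hasARobustGadget_qa_iff_q :
    HasARobustGadget Model.qa 𝔸 ↔ HasARobustGadget Model.q 𝔸 := by
  constructor
  · intro h
    exact ⟨_, inferInstance, _, _, _, h.canonical Model.qa_mem_complex Model.tensorClosed_qa
      Model.traceTensor_q_qa Model.q_mem_complex Model.q_algSubset_qa⟩
  · rintro ⟨G, _, 𝔾, x, y, h⟩
    exact ⟨G, _, 𝔾, x, y, h.qa_of_q⟩

theorem hasCVRobustGadget_qa_iff_q :
    HasCVRobustGadget Model.qa 𝔸 ↔ HasCVRobustGadget Model.q 𝔸 := by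
  constructor
  · intro h
    exact ⟨_, inferInstance, _, _, _, h.canonical Model.qa_mem_complex Model.tensorClosed_qa
      Model.traceTensor_q_qa Model.q_mem_complex Model.q_algSubset_qa⟩
  · rintro ⟨G, _, 𝔾, x, y, h⟩
    exact ⟨G, _, 𝔾, x, y, h.qa_of_q⟩

end Main

end QuantumCSP

end

theorem mainTheorem4 {σ : QuantumCSP.Signature} [Fintype σ.Sym] {A : Type} [Fintype A]
    (𝔸 : QuantumCSP.RelStr σ A) :
    -- (i)
    (∀ Q Q' : QuantumCSP.Model, Q.IsMinTensorMonoid → Q'.IsMinTensorMonoid → Q.AlgSubset Q' →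
      QuantumCSP.HasGadget Q' 𝔸 → QuantumCSP.HasGadget Q 𝔸) ∧
    -- (ii)
    (∀ Q Q' : QuantumCSP.Model, Q.IsMinTensorMonoid → Q'.IsMinTensorMonoid → Q.AlgSubset Q' →
      QuantumCSP.HasOracularGadget Q' 𝔸 → QuantumCSP.HasOracularGadget Q 𝔸) ∧
    -- (iii)
    (∀ Q Q' : QuantumCSP.Model, Q.IsMinTensorMonoid → Q'.IsMinTensorMonoid → Q.Subset Q' →
      (Q'.IsTracial ∨ Q' = QuantumCSP.Model.cstar) →
      QuantumCSP.HasARobustGadget Q' 𝔸 → QuantumCSP.HasARobustGadget Q 𝔸) ∧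
    -- (iv)
    (∀ Q Q' : QuantumCSP.Model, Q.IsMinTensorMonoid → Q'.IsMinTensorMonoid → Q.Subset Q' →
      (Q'.IsTracial ∨ Q' = QuantumCSP.Model.cstar) →
      QuantumCSP.HasCVRobustGadget Q' 𝔸 → QuantumCSP.HasCVRobustGadget Q 𝔸) ∧
    -- (v)
    (∀ Q : QuantumCSP.Model, Q.IsMinTensorMonoid →
      QuantumCSP.HasGadget Q 𝔸 → QuantumCSP.HasOracularGadget Q 𝔸) ∧
    -- (vi)
    (∀ Q : QuantumCSP.Model, Q.IsMinTensorMonoid →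
      (Q.IsTracial ∨ Q = QuantumCSP.Model.cstar) →
      QuantumCSP.HasARobustGadget Q 𝔸 → QuantumCSP.HasCVRobustGadget Q 𝔸) ∧
    -- (vii)
    (QuantumCSP.HasGadget QuantumCSP.Model.cstar 𝔸 →
      ∀ Q : QuantumCSP.Model, Q.IsMinTensorMonoid → QuantumCSP.HasARobustGadget Q 𝔸) ∧
    -- (viii)
    (QuantumCSP.HasOracularGadget QuantumCSP.Model.cstar 𝔸 →
      ∀ Q : QuantumCSP.Model, Q.IsMinTensorMonoid → QuantumCSP.HasCVRobustGadget Q 𝔸) ∧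
    -- (ix)
    ((QuantumCSP.HasGadget QuantumCSP.Model.qa 𝔸 ↔
        QuantumCSP.HasARobustGadget QuantumCSP.Model.qa 𝔸) ∧
      (QuantumCSP.HasARobustGadget QuantumCSP.Model.qa 𝔸 ↔
        QuantumCSP.HasARobustGadget QuantumCSP.Model.q 𝔸)) ∧
    -- (x)
    ((QuantumCSP.HasOracularGadget QuantumCSP.Model.qa 𝔸 ↔
        QuantumCSP.HasCVRobustGadget QuantumCSP.Model.qa 𝔸) ∧
      (QuantumCSP.HasCVRobustGadget QuantumCSP.Model.qa 𝔸 ↔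
        QuantumCSP.HasCVRobustGadget QuantumCSP.Model.q 𝔸)) ∧
    -- (xi)
    ((QuantumCSP.HasGadget QuantumCSP.Model.qc 𝔸 ↔
        QuantumCSP.HasARobustGadget QuantumCSP.Model.qc 𝔸) ∧
      (QuantumCSP.HasGadget QuantumCSP.Model.qcFaithful 𝔸 ↔
        QuantumCSP.HasARobustGadget QuantumCSP.Model.qcFaithful 𝔸)) ∧
    -- (xii)
    ((QuantumCSP.HasOracularGadget QuantumCSP.Model.qc 𝔸 ↔
        QuantumCSP.HasCVRobustGadget QuantumCSP.Model.qc 𝔸) ∧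
      (QuantumCSP.HasOracularGadget QuantumCSP.Model.qcFaithful 𝔸 ↔
        QuantumCSP.HasCVRobustGadget QuantumCSP.Model.qcFaithful 𝔸)) := by
  open QuantumCSP in
  exact ⟨fun _ _ hQ hQ' h => HasGadget.of_algSubset hQ hQ' h,
    fun _ _ hQ hQ' h => HasOracularGadget.of_algSubset hQ hQ' h,
    fun _ _ hQ hQ' h htr => HasARobustGadget.of_subset hQ hQ' h htr,
    fun _ _ hQ hQ' h htr => HasCVRobustGadget.of_subset hQ hQ' h htr,
    fun _ hQ => HasGadget.hasOracularGadget hQ,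
    fun _ hQ htr => HasARobustGadget.hasCVRobustGadget hQ htr,
    fun h _ hQ => h.hasARobustGadget_of_cstar hQ,
    fun h _ hQ => h.hasCVRobustGadget_of_cstar hQ,
    ⟨hasGadget_iff_hasARobustGadget Model.limitClosed_qa, hasARobustGadget_qa_iff_q⟩,
    ⟨hasOracularGadget_iff_hasCVRobustGadget Model.limitClosed_qa, hasCVRobustGadget_qa_iff_q⟩,
    ⟨hasGadget_iff_hasARobustGadget (Model.limitClosed_qc _),
      hasGadget_iff_hasARobustGadget (Model.limitClosed_qcFaithful _)⟩,
    ⟨hasOracularGadget_iff_hasCVRobustGadget (Model.limitClosed_qc _),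
      hasOracularGadget_iff_hasCVRobustGadget (Model.limitClosed_qcFaithful _)⟩⟩
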